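/- Setting. Let $H_0$ and $H_1=H_0+V$ be Hermitian operators on a finite-dimensional Hilbert space $\mathcal H_{\rm s}\neq 0$ with a fixed computational basis, $\beta\ge 0$, $0<\epsilon\le 1$, $\|\cdot\|$ the spectral norm, $\mathcal Z_i=\mathrm{tr}(e^{-\beta H_i})$, $\rho_1=e^{-\beta H_1}/\mathcal Z_1$, $e^{-\beta\Delta A}=\mathcal Z_1/\mathcal Z_0$. With eigenvectors $H_0|\phi_{0,m}\rangle=\varepsilon_{0,m}|\phi_{0,m}\rangle$, $H_1|\phi_{1,n}\rangle=\varepsilon_{1,n}|\phi_{1,n}\rangle$ and a unitary $\mathcal U$, the work distribution is $P(w)=\sum_{m,n:\varepsilon_{1,n}-\varepsilon_{0,m}=w}\frac{e^{-\beta\varepsilon_{0,m}}}{\mathcal Z_0}|\langle\phi_{1,n}|\mathcal U|\phi_{0,m}\rangle|^2$. A real $w_l$ is a work cutoff if $\sum_{w<w_l}P(w)e^{-\beta(w-\Delta A)}\le(\epsilon/6)^2$. Algorithm. Let $|\Psi_0\rangle=\mathcal Z_0^{-1/2}\sum_m e^{-\beta\varepsilon_{0,m}/2}|\phi_{0,m}\rangle|\phi_{0,m}^*\rangle$,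 $W=H_1\otimes 1-1\otimes H_0^*$, let $w_l$ be a work cutoff and $w_{\max}$ an upper bound on all $\varepsilon_{1,n}-\varepsilon_{0,m}$. Put $\Delta=\max\{4,\sqrt{\ln(6/\epsilon)}\}$, $z=\beta(w_{\max}-w_l)+2\Delta^2$, $\delta=2\pi/z$, $J\ge\lceil z^{3/2}/3\rceil-1$, $U=e^{i\delta\beta W/2}$, $X=\sum_{j=-J}^{J}\alpha_jU^j$ with $\alpha_j=e^{-\beta w_l/2}\frac{\delta}{\sqrt{2\pi}}H(j\delta)e^{-ij\delta\beta w_l/2}$, where $H(\omega)=\frac{1}{\sqrt{2\pi}}e^{-\omega^2/4-1/4}\frac{e^{(1+i\omega)(\Delta+1/2)}}{1+i\omega}$, and $\alpha=\sum_{|j|\le J}|\alpha_j|$. Let $S$ be a unitary block encoding of $X/(r\alpha)$ with an ancilla, $1\le r\le 2$ ($r=1$ for linear combinations of unitaries, $r=2$ for quantum signal processing; a block encoding with $r=1$ exists). Starting from $|\psi\rangle=S(1\otimes\mathcal U\otimes 1)|0\rangle|\Psi_0\rangle$, amplitude amplification for an unknown amplitude (Brassard, Høyer, Mosca, Tapp;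 growth parameter $c\in(1,2)$: in stage $l=1,2,\dots$ test $|\psi\rangle$, then test $|\psi\rangle$ after $j$ rounds, $j$ uniform in $\{1,\dots,\lceil c^l\rceil\}$, until a test finds the ancilla in $|0\rangle$) is run with rounds $-R'R$, $R'=1-2|\psi\rangle\langle\psi|$, $R=1-2|0\rangle\langle 0|\otimes 1\otimes 1$. Finally $1\otimes 1\otimes\mathcal U^*$ is applied and the ancilla and the second copy of $\mathcal H_{\rm s}$ are discarded. Claim. Let $\mathcal U=1$. For every $c\in(1,2)$ there is a constant $C>0$, depending on $c$ only, such that the following holds for all data as above. For each of the values $w_*$ below, $w_*$ is a work cutoff, and with every work cutoff $w_l\ge w_*$ (in particular $w_l=w_*$) the algorithm stops with probability one, prepares a state $\tau_1$ with $\frac12\|\tau_1-\rho_1\|_1\le\epsilon$, and uses at most $Q$ amplitude amplification rounds on average, where 1. (general Hamiltonians) $w_*=-6\|V\|/\epsilon$ and $Q=C\,e^{\sqrt{\ln(1/\epsilon)}}\,e^{(\frac3\epsilon+\frac12)\beta\|V\|}$; 2. (commuting Hamiltonians, $[H_0,H_1]=0$) $w_*=-\|V\|$ and $Q=C\,e^{\sqrt{\ln(1/\epsilon)}}\,e^{\beta\|V\|}$;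 3. (local Hamiltonians) $w_*=-2Mv-2hgk\ln(6/\epsilon)$ and $Q=C\,e^{\sqrt{\ln(1/\epsilon)}}\,(6/\epsilon)^{\beta hgk}\,e^{(\xi+\frac12)\beta\|V\|}$. Here $\mathcal H_{\rm s}=(\mathbb C^d)^{\otimes\mathfrak n}$ with $d\ge1$, $\Lambda$ is a set of sets of qudits, each of at most $k$ qudits, each qudit being in at most $g$ sets of $\Lambda$; $H_0=\sum_{X\in\Lambda}h_{0,X}$ and $V=\sum_{X\in\Lambda}v_X$ with Hermitian terms $h_{0,X},v_X$ acting on the qudits in $X$ only, $\|h_{0,X}\|\le h$, $\|v_X\|\le v$ ($h,v\ge 0$), at most $M$ of the $v_X$ are nonzero, and $Mv\le\xi\|V\|$ with $\xi\ge0$. -/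

import Mathlib

open Matrix Filter Topology
open scoped Kronecker Matrix.Norms.L2Operator

noncomputable section

namespace ThermalPrep

/-! ### Thermal states and the work distribution

A quantum system has Hilbert space `ℂ^ι` with computational basis the finite type `ι`;
operators are matrices and `‖·‖` is the spectral norm. -/

section Thermal

variable {ι : Type} [Fintype ι] [DecidableEq ι]

/-- The unnormalized thermal state `e^{-β H}`. -/
def boltzmann (β : ℝ) (H : Matrix ι ι ℂ) : Matrix ι ι ℂ :=
  NormedSpace.exp (-(β : ℂ) • H)

/-- The partition function `𝒵 = tr e^{-β H}` (a real number, for Hermitian `H`). -/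
def partitionFn (β : ℝ) (H : Matrix ι ι ℂ) : ℝ :=
  (boltzmann β H).trace.re

/-- The thermal (Gibbs) state `ρ = e^{-β H} / 𝒵`. -/
def gibbs (β : ℝ) (H : Matrix ι ι ℂ) : Matrix ι ι ℂ :=
  ((partitionFn β H : ℂ))⁻¹ • boltzmann β H

/-- The free-energy difference `ΔA = -(1/β) ln (𝒵₁ / 𝒵₀)`. For `β = 0` this is `0`; only the
product `β ΔA` is ever used, and it is `0` for `β = 0` since then `𝒵₁ = 𝒵₀`. -/
def freeEnergyDiff (β : ℝ) (H₀ H₁ : Matrix ι ι ℂ) : ℝ :=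
  -(1 / β) * Real.log (partitionFn β H₁ / partitionFn β H₀)

/-- The trace norm `‖A‖₁ = tr √(A† A)`, the sum of the square roots of the eigenvalues of
`A† A`. -/
def traceNorm (A : Matrix ι ι ℂ) : ℝ :=
  ∑ i, √((isHermitian_conjTranspose_mul_self A).eigenvalues i)

variable {H₀ H₁ : Matrix ι ι ℂ}

/-- The amplitude `⟨φ_{1,n}| 𝒰 |φ_{0,m}⟩` between eigenvectors of `H₁` and `H₀`. -/
def transitionAmp (h₀ : H₀.IsHermitian) (h₁ : H₁.IsHermitian) (𝒰 : Matrix ι ι ℂ)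
    (m n : ι) : ℂ :=
  ((h₁.eigenvectorUnitary : Matrix ι ι ℂ)ᴴ * 𝒰 * (h₀.eigenvectorUnitary : Matrix ι ι ℂ)) n m

/-- The probability `p_{m,n} = (e^{-β ε_{0,m}} / 𝒵₀) |⟨φ_{1,n}| 𝒰 |φ_{0,m}⟩|²` of measuring first
`ε_{0,m}` and then `ε_{1,n}`. -/
def jointProb (β : ℝ) (h₀ : H₀.IsHermitian) (h₁ : H₁.IsHermitian) (𝒰 : Matrix ι ι ℂ)
    (m n : ι) : ℝ :=
  Real.exp (-β * h₀.eigenvalues m) / partitionFn β H₀ * ‖transitionAmp h₀ h₁ 𝒰 m n‖ ^ 2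

/-- The work value `w_{m,n} = ε_{1,n} - ε_{0,m}`. -/
def workValue (h₀ : H₀.IsHermitian) (h₁ : H₁.IsHermitian) (m n : ι) : ℝ :=
  h₁.eigenvalues n - h₀.eigenvalues m

open Classical in
/-- The finite set of all work values. -/
def workValues (h₀ : H₀.IsHermitian) (h₁ : H₁.IsHermitian) : Finset ℝ :=
  Finset.univ.image fun p : ι × ι => workValue h₀ h₁ p.1 p.2

open Classical in
/-- The work distribution `P(w)` of the process `𝒰`. When eigenvalues are degenerate the sum
equals the corresponding expression in the eigenprojectors, so the choice of eigenbases is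
immaterial. -/
def workProb (β : ℝ) (h₀ : H₀.IsHermitian) (h₁ : H₁.IsHermitian) (𝒰 : Matrix ι ι ℂ)
    (w : ℝ) : ℝ :=
  ∑ m, ∑ n, if workValue h₀ h₁ m n = w then jointProb β h₀ h₁ 𝒰 m n else 0

/-- `wl` is a work cutoff for the error `ε`:
`∑_{w < wl} P(w) e^{-β (w - ΔA)} ≤ (ε/6)²`. -/
def IsWorkCutoff (β ε : ℝ) (h₀ : H₀.IsHermitian) (h₁ : H₁.IsHermitian) (𝒰 : Matrix ι ι ℂ)
    (wl : ℝ) : Prop :=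
  ∑ w ∈ workValues h₀ h₁ with w < wl,
      workProb β h₀ h₁ 𝒰 w * Real.exp (-β * (w - freeEnergyDiff β H₀ H₁)) ≤ (ε / 6) ^ 2

/-- The purification `|Ψ₀⟩ = 𝒵₀^{-1/2} ∑_m e^{-β ε_{0,m}/2} |φ_{0,m}⟩ |φ_{0,m}^*⟩` of the
thermal state of `H₀`, a vector of `ℂ^ι ⊗ ℂ^ι`. -/
def purification (β : ℝ) (h₀ : H₀.IsHermitian) : ι × ι → ℂ := fun x =>
  ((√(partitionFn β H₀) : ℝ) : ℂ)⁻¹ *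
    ∑ m, (Real.exp (-β * h₀.eigenvalues m / 2) : ℂ) *
      ((h₀.eigenvectorUnitary : Matrix ι ι ℂ) x.1 m *
        star ((h₀.eigenvectorUnitary : Matrix ι ι ℂ) x.2 m))

/-- The work operator `W = H₁ ⊗ 1 - 1 ⊗ H₀^*`, where `H₀^*` is the entrywise complex conjugate. -/
def workOp (H₀ H₁ : Matrix ι ι ℂ) : Matrix (ι × ι) (ι × ι) ℂ :=
  H₁ ⊗ₖ (1 : Matrix ι ι ℂ) - (1 : Matrix ι ι ℂ) ⊗ₖ H₀.map star

end Thermal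

/-! ### The Fourier approximation `X` of `e^{-β W / 2}` -/

/-- `Δ = max {4, √(ln (6/ε))}`. -/
def fourierWidth (ε : ℝ) : ℝ := max 4 √(Real.log (6 / ε))

/-- `z = β (w_max - wl) + 2 Δ²`. -/
def fourierPeriod (β ε wl wmax : ℝ) : ℝ := β * (wmax - wl) + 2 * fourierWidth ε ^ 2

/-- `δ = 2π / z`. -/
def fourierStep (β ε wl wmax : ℝ) : ℝ := 2 * Real.pi / fourierPeriod β ε wl wmax

/-- `F(ω) = (2π)^{-1/2} e^{-ω²/4}`, the unitary Fourier transform of `π^{-1/2} e^{-x²}`. -/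
def fourierF (ω : ℝ) : ℂ := ((Real.exp (-ω ^ 2 / 4) / √(2 * Real.pi) : ℝ) : ℂ)

/-- `G(ω) = (2π)^{-1/2} e^{-1/4} e^{(1 + iω)(Δ + 1/2)} / (1 + iω)`, the unitary Fourier transform
of the function equal to `e^{-1/4} e^{-x}` for `x ≥ -Δ - 1/2` and to `0` for `x < -Δ - 1/2`. -/
def fourierG (Δ ω : ℝ) : ℂ :=
  ((Real.exp (-1 / 4) / √(2 * Real.pi) : ℝ) : ℂ) *
    (Complex.exp ((1 + Complex.I * ω) * (Δ + 1 / 2)) / (1 + Complex.I * ω))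

/-- `H(ω) = √(2π) F(ω) G(ω)`, the Fourier transform of the convolution. -/
def fourierH (Δ ω : ℝ) : ℂ := ((√(2 * Real.pi) : ℝ) : ℂ) * fourierF ω * fourierG Δ ω

/-- The coefficients `α_j = e^{-β wl/2} (δ/√(2π)) H(ω_j) e^{-i ω_j β wl/2}`, `ω_j = j δ`. -/
def fourierCoeff (β ε wl wmax : ℝ) (j : ℤ) : ℂ :=
  ((Real.exp (-β * wl / 2) * (fourierStep β ε wl wmax / √(2 * Real.pi)) : ℝ) : ℂ) *
    fourierH (fourierWidth ε) (j * fourierStep β ε wl wmax) *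
    Complex.exp (-Complex.I * (((j * fourierStep β ε wl wmax) * β * wl / 2 : ℝ) : ℂ))

/-- `α = ∑_{j=-J}^{J} |α_j|`. -/
def coeffNorm (β ε wl wmax : ℝ) (J : ℕ) : ℝ :=
  ∑ j ∈ Finset.Icc (-(J : ℤ)) J, ‖fourierCoeff β ε wl wmax j‖

/-- The truncation orders allowed in the approximation: `J ≥ ⌈z^{3/2}/3⌉ - 1`. -/
def IsTruncationOrder (β ε wl wmax : ℝ) (J : ℕ) : Prop :=
  ⌈fourierPeriod β ε wl wmax ^ (3 / 2 : ℝ) / 3⌉₊ ≤ J + 1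

section Approx

variable {ι : Type} [Fintype ι] [DecidableEq ι]

/-- The unitary `U = e^{i δ β W / 2}`. -/
def evolution (β ε wl wmax : ℝ) (H₀ H₁ : Matrix ι ι ℂ) : Matrix (ι × ι) (ι × ι) ℂ :=
  NormedSpace.exp
    ((Complex.I * ((fourierStep β ε wl wmax * β / 2 : ℝ) : ℂ)) • workOp H₀ H₁)

/-- `X = ∑_{j=-J}^{J} α_j U^j`. -/
def fourierOp (β ε wl wmax : ℝ) (J : ℕ) (H₀ H₁ : Matrix ι ι ℂ) : Matrix (ι × ι) (ι × ι) ℂ :=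
  ∑ j ∈ Finset.Icc (-(J : ℤ)) J,
    fourierCoeff β ε wl wmax j • evolution β ε wl wmax H₀ H₁ ^ j

end Approx

/-! ### Block encodings and amplitude amplification

The ancilla space is `ℂ^κ`, with the distinguished basis state `a₀ : κ` in the role of `|0⟩`. -/

section Amplification

variable {κ μ : Type} [Fintype κ] [DecidableEq κ] [Fintype μ] [DecidableEq μ]

/-- The unitary `S` on `ℂ^κ ⊗ ℂ^μ` is a block encoding of `Y`:
`S |0⟩|Ψ⟩ = |0⟩ Y|Ψ⟩ + |χ^⊥⟩` with `(|0⟩⟨0| ⊗ 1)|χ^⊥⟩ = 0`. -/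
def IsBlockEncoding (a₀ : κ) (S : Matrix (κ × μ) (κ × μ) ℂ) (Y : Matrix μ μ ℂ) : Prop :=
  S ∈ unitaryGroup (κ × μ) ℂ ∧ ∀ x y, S (a₀, x) (a₀, y) = Y x y

/-- The vector `|0⟩ ⊗ |Ψ⟩`. -/
def withAncilla (a₀ : κ) (Ψ : μ → ℂ) : κ × μ → ℂ := fun x => if x.1 = a₀ then Ψ x.2 else 0

/-- The projector `P = |0⟩⟨0| ⊗ 1`. -/
def goodProj (a₀ : κ) : Matrix (κ × μ) (κ × μ) ℂ :=
  diagonal fun x => if x.1 = a₀ then 1 else 0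

/-- The projector `|ψ⟩⟨ψ|`. -/
def pureState (ψ : κ × μ → ℂ) : Matrix (κ × μ) (κ × μ) ℂ := vecMulVec ψ (star ψ)

/-- One amplitude amplification round for the start vector `ψ`: the operator `-R' R`, made of the
reflections `R' = 1 - 2 |ψ⟩⟨ψ|` and `R = 1 - 2 P`. -/
def amplificationRound (a₀ : κ) (ψ : κ × μ → ℂ) : Matrix (κ × μ) (κ × μ) ℂ :=
  -((1 - (2 : ℂ) • pureState ψ) * (1 - (2 : ℂ) • goodProj a₀))

/-- The state after `j` amplitude amplification rounds. -/
def afterRounds (a₀ : κ) (ψ : κ × μ → ℂ) (j : ℕ) : κ × μ → ℂ :=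
  (amplificationRound a₀ ψ ^ j) *ᵥ ψ

/-- The subnormalized state left when, after `j` rounds, the measurement `{P, 1 - P}` finds the
ancilla in `|0⟩`. -/
def successState (a₀ : κ) (ψ : κ × μ → ℂ) (j : ℕ) : Matrix (κ × μ) (κ × μ) ℂ :=
  pureState (goodProj a₀ *ᵥ afterRounds a₀ ψ j)

/-- The probability `‖P (-R' R)^j ψ‖²` of that outcome. -/
def successProb (a₀ : κ) (ψ : κ × μ → ℂ) (j : ℕ) : ℝ :=
  ∑ x, ‖(goodProj a₀ *ᵥ afterRounds a₀ ψ j) x‖ ^ 2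

/-- The number `M = ⌈c^l⌉` used in stage `l` of amplitude amplification. -/
def stageBound (c : ℝ) (l : ℕ) : ℕ := ⌈c ^ l⌉₊

/-- Amplitude amplification when the success amplitude is not known. For `l = 1, 2, 3, …`, stage
`l` is as follows. (a) Prepare `ψ` and measure `{P, 1 - P}`; stop if the outcome is `P`.
(b) Prepare `ψ` afresh, draw `j` uniformly from `{1, …, M}` with `M = ⌈c^l⌉`, apply `j` rounds
`-R' R` and measure `{P, 1 - P}`; stop if the outcome is `P`. Otherwise go on to stage `l + 1`.

`truncatedRounds c a₀ ψ n l` is the average number of rounds done in the `n` stages `l`, …,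
`l + n - 1` if the procedure is started at stage `l`. -/
def truncatedRounds (c : ℝ) (a₀ : κ) (ψ : κ × μ → ℂ) : ℕ → ℕ → ℝ
  | 0, _ => 0
  | n + 1, l =>
      (1 - successProb a₀ ψ 0) *
        ((1 / (stageBound c l : ℝ)) * ∑ j ∈ Finset.Icc 1 (stageBound c l),
          ((j : ℝ) + (1 - successProb a₀ ψ j) * truncatedRounds c a₀ ψ n (l + 1)))

/-- The average number of amplitude amplification rounds of the whole procedure. -/
def averageRounds (c : ℝ) (a₀ : κ) (ψ : κ × μ → ℂ) : ENNReal :=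
  ⨆ n : ℕ, ENNReal.ofReal (truncatedRounds c a₀ ψ n 1)

/-- The (subnormalized) mixed state put out in the `n` stages `l`, …, `l + n - 1` by the procedure
described above, if it is started at stage `l`; its trace is the probability to stop there. -/
def truncatedOutput (c : ℝ) (a₀ : κ) (ψ : κ × μ → ℂ) :
    ℕ → ℕ → Matrix (κ × μ) (κ × μ) ℂ
  | 0, _ => 0
  | n + 1, l =>
      successState a₀ ψ 0 + ((1 - successProb a₀ ψ 0 : ℝ) : ℂ) •
        ((1 / (stageBound c l : ℂ)) • ∑ j ∈ Finset.Icc 1 (stageBound c l),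
          (successState a₀ ψ j +
            ((1 - successProb a₀ ψ j : ℝ) : ℂ) • truncatedOutput c a₀ ψ n (l + 1)))

end Amplification

/-! ### The quantum algorithm -/

section Algorithm

variable {ι κ : Type} [Fintype ι] [DecidableEq ι] [Fintype κ] [DecidableEq κ]
variable {H₀ H₁ : Matrix ι ι ℂ}

/-- The vector `S' |0⟩|Ψ₀⟩` with `S' = S (1 ⊗ 𝒰 ⊗ 1)`. Amplitude amplification starts from it, and
the reflection about it is `R' = 1 - 2 S' (|0⟩⟨0| ⊗ |Ψ₀⟩⟨Ψ₀|) S'†`. -/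
def startVector (β : ℝ) (h₀ : H₀.IsHermitian) (𝒰 : Matrix ι ι ℂ) (a₀ : κ)
    (S : Matrix (κ × (ι × ι)) (κ × (ι × ι)) ℂ) : κ × (ι × ι) → ℂ :=
  (S * ((1 : Matrix κ κ ℂ) ⊗ₖ (𝒰 ⊗ₖ (1 : Matrix ι ι ℂ)))) *ᵥ
    withAncilla a₀ (purification β h₀)

/-- The state of the system obtained by applying `1 ⊗ 1 ⊗ 𝒰^*` to the state `σ` of ancilla, system
and copy, and then discarding ancilla and copy. -/
def reducedState (𝒰 : Matrix ι ι ℂ) (σ : Matrix (κ × (ι × ι)) (κ × (ι × ι)) ℂ) :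
    Matrix ι ι ℂ := fun x y =>
  let T : Matrix (κ × (ι × ι)) (κ × (ι × ι)) ℂ :=
    (1 : Matrix κ κ ℂ) ⊗ₖ ((1 : Matrix ι ι ℂ) ⊗ₖ 𝒰.map star)
  ∑ a, ∑ t, (T * σ * Tᴴ) (a, (x, t)) (a, (y, t))

/-- The algorithm with process `𝒰`, ancilla and block encoding `S`, and growth parameter `c` of
amplitude amplification stops with probability one, puts out a state `τ₁` of trace distance at most
`ε` from the thermal state of `H₁`, and uses at most `Q` rounds on average. -/
def Succeeds (c β ε : ℝ) (h₀ : H₀.IsHermitian) (𝒰 : Matrix ι ι ℂ) (H₁ : Matrix ι ι ℂ)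
    (a₀ : κ) (S : Matrix (κ × (ι × ι)) (κ × (ι × ι)) ℂ) (Q : ℝ) : Prop :=
  (∃ τ₁ : Matrix ι ι ℂ,
    Tendsto (fun n => reducedState 𝒰 (truncatedOutput c a₀ (startVector β h₀ 𝒰 a₀ S) n 1))
      atTop (𝓝 τ₁) ∧
    τ₁.trace = 1 ∧ 1 / 2 * traceNorm (τ₁ - gibbs β H₁) ≤ ε) ∧
  averageRounds c a₀ (startVector β h₀ 𝒰 a₀ S) ≤ ENNReal.ofReal Q

/-- The algorithm prepares the thermal state of `H₁` with error `ε` and at most `Q` amplitude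
amplification rounds on average, with the work cutoff `w`.

In detail: `w` is a work cutoff, and for every work cutoff `wl ≥ w` (in particular for `w`
itself), every upper bound `wmax` of the work values, and every allowed truncation order `J`, the
operator `X/α` has a block encoding, and with each block encoding `S` of `X/(rα)`, `1 ≤ r ≤ 2`,
the algorithm succeeds within `Q` rounds on average. (Linear combination of unitaries gives a block
encoding with `r = 1`, quantum signal processing one with `r = 2`.) -/
def PreparesWith (c β ε : ℝ) (h₀ : H₀.IsHermitian) (h₁ : H₁.IsHermitian)
    (𝒰 : Matrix ι ι ℂ) (w Q : ℝ) : Prop :=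
  IsWorkCutoff β ε h₀ h₁ 𝒰 w ∧
  ∀ wl : ℝ, w ≤ wl → IsWorkCutoff β ε h₀ h₁ 𝒰 wl →
  ∀ wmax : ℝ, (∀ m n, workValue h₀ h₁ m n ≤ wmax) →
  ∀ J : ℕ, IsTruncationOrder β ε wl wmax J →
    (∃ (κ : Type) (_ : Fintype κ) (_ : DecidableEq κ) (a₀ : κ)
        (S : Matrix (κ × (ι × ι)) (κ × (ι × ι)) ℂ),
      IsBlockEncoding a₀ S
        (((coeffNorm β ε wl wmax J : ℝ) : ℂ)⁻¹ • fourierOp β ε wl wmax J H₀ H₁)) ∧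
    ∀ (r : ℝ), 1 ≤ r → r ≤ 2 →
    ∀ (κ : Type) [Fintype κ] [DecidableEq κ] (a₀ : κ)
        (S : Matrix (κ × (ι × ι)) (κ × (ι × ι)) ℂ),
      IsBlockEncoding a₀ S
        (((r * coeffNorm β ε wl wmax J : ℝ) : ℂ)⁻¹ • fourierOp β ε wl wmax J H₀ H₁) →
      Succeeds c β ε h₀ 𝒰 H₁ a₀ S Q

end Algorithm

/-! ### Local Hamiltonians -/

/-- The operator `A` on `𝔫` qudits of dimension `d` acts on the qudits in `X` only:
`A = B ⊗ 1` for some operator `B` on these qudits. -/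
def ActsOn {𝔫 d : ℕ} (X : Finset (Fin 𝔫)) (A : Matrix (Fin 𝔫 → Fin d) (Fin 𝔫 → Fin d) ℂ) :
    Prop :=
  ∃ B : Matrix (X → Fin d) (X → Fin d) ℂ, ∀ σ τ,
    A σ τ = if ∀ i ∉ X, σ i = τ i then B (fun i => σ i) (fun i => τ i) else 0

/-- `∑_{X ∈ Λ} t_X` is a `k`-local Hamiltonian of degree `g` with strength parameter `s`: every
term `t_X` is a Hamiltonian acting on the at most `k` qudits of `X`, `‖t_X‖ ≤ s`, and every qudit
is in at most `g` of the sets `X ∈ Λ`. -/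
structure IsLocalHamiltonian {𝔫 d : ℕ} (Λ : Finset (Finset (Fin 𝔫))) (k g : ℕ) (s : ℝ)
    (t : Finset (Fin 𝔫) → Matrix (Fin 𝔫 → Fin d) (Fin 𝔫 → Fin d) ℂ) : Prop where
  hermitian : ∀ X ∈ Λ, (t X).IsHermitian
  actsOn : ∀ X ∈ Λ, ActsOn X (t X)
  norm_le : ∀ X ∈ Λ, ‖t X‖ ≤ s
  card_le : ∀ X ∈ Λ, X.card ≤ k
  degree_le : ∀ i : Fin 𝔫, (Λ.filter fun X => i ∈ X).card ≤ g

end ThermalPrep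

end

/-! In the product eigenbasis of the work operator, the purification of `ρ₀` has coordinates
`𝒵₀^{-1/2} e^{-β ε₀ₘ/2} ⟨φ₁ₙ|φ₀ₘ⟩`, and the same formula with `𝒵₁` and `ε₁ₙ` gives a purification of
`ρ₁`. Their quotient is `√(𝒵₀/𝒵₁) e^{-β w/2}` with `w` the work value, so `e^{-βW/2}` maps the one
to the other up to normalization.

The operator `X` replaces `e^{-βw/2}` by a truncated Fourier series whose relative error is at most
`ε/4` above the cutoff and at most `1 + ε/4` below it (`norm_fourierSymbol_sub_exp_le`). This comes
from Poisson summation for a Gaussian-smoothed cutoff of `e^{-x}` (`poisson_smoothExp`,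
`tail_bound`). Relative errors are weighted with the target state, in which the part below the
cutoff has weight at most `(ε/6)²` (`cutoff_sum_eq`). The vector error is therefore at most `ε/2`,
after normalization at most `ε`, and it bounds the trace distance (`nsq_fourierOp_mulVec_sub_le`,
`traceNorm_sub_le`).

Amplitude amplification rotates in the plane of the good and the bad part of the start vector. Every
successful test leaves the same state, and the average number of rounds is `O(1/√p)` with `p` the
initial success probability (`exists_averageRounds_le`). Here `√p` is `√(𝒵₁/𝒵₀)/(rα)` up to a factor
of at least `1/2`. The Peierls inequality bounds `𝒵₀/𝒵₁` by `e^{β‖V‖}`, and `α = O(e^Δ e^{-β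
wl/2})`. Thus the cost is governed by the cutoff (`preparesWith_of_isWorkCutoff`).

The three cutoffs are tail bounds for the work in an eigenstate of `H₁`: Chebyshev's inequality with
second moment at most `‖V‖²` in general, vanishing overlaps for `|w| > ‖V‖` in the commuting case,
and a Chernoff bound in the local case. The exponential moments for the last one follow from a bound
on the numerical radius of a local operator under imaginary-time evolution
(`norm_quadForm_evolve_le`), proved by induction on the set of terms of the Hamiltonian. -/

noncomputable section

namespace ThermalPrep

/-! ### The dynamics of amplitude amplification -/

section AmplificationDynamics

variable {κ μ : Type} [Fintype κ] [DecidableEq κ] [Fintype μ] [DecidableEq μ]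

/-- The coefficients of the good and the bad part of the start vector after `j` rounds, where `p`
is the squared norm of the good part. -/
def roundCoeffs (p : ℝ) : ℕ → ℝ × ℝ
  | 0 => (1, 1)
  | j + 1 =>
      ((1 - 2 * p) * (roundCoeffs p j).1 + 2 * (1 - p) * (roundCoeffs p j).2,
        -(2 * p) * (roundCoeffs p j).1 + (1 - 2 * p) * (roundCoeffs p j).2)

/-- A round is the rotation by `2θ` in the plane of the normalized good and bad parts. The form
without quotients also covers `sin θ = 0` and `cos θ = 0`. -/
theorem roundCoeffs_sin (θ : ℝ) (j : ℕ) :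
    (roundCoeffs (Real.sin θ ^ 2) j).1 * Real.sin θ = Real.sin ((2 * j + 1) * θ) ∧
      (roundCoeffs (Real.sin θ ^ 2) j).2 * Real.cos θ = Real.cos ((2 * j + 1) * θ) := by
  induction j with
  | zero => simp [roundCoeffs]
  | succ j ih =>
    obtain ⟨h1, h2⟩ := ih
    have e : (2 * ((j + 1 : ℕ) : ℝ) + 1) * θ = (2 * j + 1) * θ + 2 * θ := by push_cast; ring
    rw [e, Real.sin_add, Real.cos_add, ← h1, ← h2, Real.cos_two_mul, Real.sin_two_mul]
    have hc : Real.cos θ ^ 2 = 1 - Real.sin θ ^ 2 := Real.cos_sq' θ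
    constructor
    · simp only [roundCoeffs]
      linear_combination (-2 * (roundCoeffs (Real.sin θ ^ 2) j).1 * Real.sin θ -
        2 * (roundCoeffs (Real.sin θ ^ 2) j).2 * Real.sin θ) * hc
    · simp only [roundCoeffs]
      linear_combination (-2 * (roundCoeffs (Real.sin θ ^ 2) j).2 * Real.cos θ) * hc

theorem goodProj_mulVec_apply (a₀ : κ) (v : κ × μ → ℂ) (x : κ × μ) :
    (goodProj a₀ *ᵥ v) x = if x.1 = a₀ then v x else 0 := by
  simp [goodProj, mulVec_diagonal]

theorem goodProj_mulVec_goodProj (a₀ : κ) (v : κ × μ → ℂ) :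
    goodProj a₀ *ᵥ (goodProj a₀ *ᵥ v) = goodProj a₀ *ᵥ v := by
  ext x; simp only [goodProj_mulVec_apply]; split_ifs <;> rfl

theorem pureState_mulVec (ψ v : κ × μ → ℂ) : pureState ψ *ᵥ v = (star ψ ⬝ᵥ v) • ψ := by
  ext x
  simp [pureState, mulVec, dotProduct, vecMulVec_apply, Finset.mul_sum, mul_comm, mul_left_comm]

theorem star_dotProduct_self_eq {n : Type} [Fintype n] (v : n → ℂ) :
    star v ⬝ᵥ v = ((∑ x, ‖v x‖ ^ 2 : ℝ) : ℂ) := by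
  simp [dotProduct, ← Complex.conj_mul']

theorem star_dotProduct_goodProj (a₀ : κ) (ψ : κ × μ → ℂ) :
    star ψ ⬝ᵥ (goodProj a₀ *ᵥ ψ) = ((∑ x, ‖(goodProj a₀ *ᵥ ψ) x‖ ^ 2 : ℝ) : ℂ) := by
  rw [← star_dotProduct_self_eq]
  simp only [dotProduct, goodProj_mulVec_apply, Pi.star_apply]
  refine Finset.sum_congr rfl fun x _ => ?_
  split_ifs <;> simp

variable {a₀ : κ} {ψ : κ × μ → ℂ} {p : ℝ}

/-- Both reflections preserve the span of the good part and the bad part of `ψ`, so only two real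
coefficients evolve. -/
theorem afterRounds_eq (hψ : ∑ x, ‖ψ x‖ ^ 2 = 1)
    (hp : ∑ x, ‖(goodProj a₀ *ᵥ ψ) x‖ ^ 2 = p) (j : ℕ) :
    afterRounds a₀ ψ j = ((roundCoeffs p j).1 : ℂ) • (goodProj a₀ *ᵥ ψ) +
      ((roundCoeffs p j).2 : ℂ) • (ψ - goodProj a₀ *ᵥ ψ) := by
  induction j with
  | zero => simp [afterRounds, roundCoeffs]
  | succ j ih =>
    have hs : afterRounds a₀ ψ (j + 1) = amplificationRound a₀ ψ *ᵥ afterRounds a₀ ψ j := by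
      rw [afterRounds, afterRounds, mulVec_mulVec, pow_succ']
    have h1 : star ψ ⬝ᵥ (goodProj a₀ *ᵥ ψ) = (p : ℂ) := by rw [star_dotProduct_goodProj, hp]
    have h2 : star ψ ⬝ᵥ ψ = 1 := by rw [star_dotProduct_self_eq, hψ]; simp
    rw [hs, ih]
    set s := (roundCoeffs p j).1
    set t := (roundCoeffs p j).2
    set g := goodProj a₀ *ᵥ ψ with hg
    have hgg : goodProj a₀ *ᵥ g = g := goodProj_mulVec_goodProj a₀ ψ
    simp only [amplificationRound, neg_mulVec, ← mulVec_mulVec, sub_mulVec, one_mulVec,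
      smul_mulVec, mulVec_add, mulVec_smul, mulVec_sub, hgg, ← hg, pureState_mulVec, h1, h2]
    ext x
    simp only [roundCoeffs, Pi.neg_apply, Pi.sub_apply, Pi.add_apply, Pi.smul_apply, smul_eq_mul]
    push_cast
    ring

theorem goodProj_afterRounds (hψ : ∑ x, ‖ψ x‖ ^ 2 = 1)
    (hp : ∑ x, ‖(goodProj a₀ *ᵥ ψ) x‖ ^ 2 = p) (j : ℕ) :
    goodProj a₀ *ᵥ afterRounds a₀ ψ j = ((roundCoeffs p j).1 : ℂ) • (goodProj a₀ *ᵥ ψ) := by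
  rw [afterRounds_eq hψ hp]
  simp only [mulVec_add, mulVec_smul, mulVec_sub, goodProj_mulVec_goodProj, sub_self, smul_zero,
    add_zero]

/-- The good part is only rescaled by the rounds. The normalized output is therefore independent of
the random `j` and of the stage in which the procedure stops. -/
theorem successState_eq (hψ : ∑ x, ‖ψ x‖ ^ 2 = 1)
    (hp : ∑ x, ‖(goodProj a₀ *ᵥ ψ) x‖ ^ 2 = p) (j : ℕ) :
    successState a₀ ψ j = (((roundCoeffs p j).1 ^ 2 : ℝ) : ℂ) • pureState (goodProj a₀ *ᵥ ψ) := by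
  rw [successState, goodProj_afterRounds hψ hp]
  ext x y
  simp only [pureState, vecMulVec_apply, Pi.smul_apply, Pi.star_apply, smul_eq_mul, star_mul',
    Matrix.smul_apply, Complex.star_def, Complex.conj_ofReal]
  push_cast
  ring

theorem successProb_eq (hψ : ∑ x, ‖ψ x‖ ^ 2 = 1)
    (hp : ∑ x, ‖(goodProj a₀ *ᵥ ψ) x‖ ^ 2 = p) (j : ℕ) :
    successProb a₀ ψ j = (roundCoeffs p j).1 ^ 2 * p := by
  rw [successProb, goodProj_afterRounds hψ hp, ← hp, Finset.mul_sum]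
  refine Finset.sum_congr rfl fun x _ => ?_
  simp [mul_pow]

theorem goodProj_norm_le (hψ : ∑ x, ‖ψ x‖ ^ 2 = 1)
    (hp : ∑ x, ‖(goodProj a₀ *ᵥ ψ) x‖ ^ 2 = p) : 0 ≤ p ∧ p ≤ 1 := by
  rw [← hp]
  refine ⟨by positivity, ?_⟩
  rw [← hψ]
  refine Finset.sum_le_sum fun x _ => ?_
  rw [goodProj_mulVec_apply]
  split_ifs <;> simp

theorem successProb_eq_sin (hψ : ∑ x, ‖ψ x‖ ^ 2 = 1)
    (hp : ∑ x, ‖(goodProj a₀ *ᵥ ψ) x‖ ^ 2 = p) (j : ℕ) :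
    successProb a₀ ψ j = Real.sin ((2 * j + 1) * Real.arcsin √p) ^ 2 := by
  obtain ⟨h0, h1⟩ := goodProj_norm_le hψ hp
  have hs : Real.sin (Real.arcsin √p) = √p :=
    Real.sin_arcsin (by linarith [Real.sqrt_nonneg p]) (Real.sqrt_le_one.mpr h1)
  have hs2 : Real.sin (Real.arcsin √p) ^ 2 = p := by rw [hs, Real.sq_sqrt h0]
  rw [successProb_eq hψ hp, ← (roundCoeffs_sin _ j).1, hs2, mul_pow, hs2]

theorem successProb_zero (hψ : ∑ x, ‖ψ x‖ ^ 2 = 1)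
    (hp : ∑ x, ‖(goodProj a₀ *ᵥ ψ) x‖ ^ 2 = p) : successProb a₀ ψ 0 = p := by
  simp [successProb_eq hψ hp, roundCoeffs]

theorem successProb_mem (hψ : ∑ x, ‖ψ x‖ ^ 2 = 1) (j : ℕ) :
    0 ≤ successProb a₀ ψ j ∧ successProb a₀ ψ j ≤ 1 := by
  rw [successProb_eq_sin hψ rfl]
  exact ⟨by positivity, Real.sin_sq_le_one _⟩

/-! ### The average number of rounds -/

/-- The probability that one stage with random `j ∈ {1, …, M}` fails. -/
def stageFail (a₀ : κ) (ψ : κ × μ → ℂ) (M : ℕ) : ℝ :=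
  (1 - successProb a₀ ψ 0) *
    ((1 / (M : ℝ)) * ∑ j ∈ Finset.Icc 1 M, (1 - successProb a₀ ψ j))

/-- Multiplying by `2 sin 2θ` turns each cosine into a difference of sines at consecutive multiples
of `4θ`. This shows that the success probabilities average to about `1/2` once `M` exceeds `1/sin
2θ`. -/
theorem sum_cos_telescope (θ : ℝ) (M : ℕ) :
    2 * Real.sin (2 * θ) * ∑ j ∈ Finset.Icc 1 M, Real.cos ((4 * j + 2) * θ) =
      Real.sin ((4 * M + 4) * θ) - Real.sin (4 * θ) := by
  induction M with
  | zero => simp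
  | succ M ih =>
    rw [Finset.sum_Icc_succ_top (by omega), mul_add, ih]
    have e1 : (4 * ((M + 1 : ℕ) : ℝ) + 4) * θ = (4 * ((M + 1 : ℕ) : ℝ) + 2) * θ + 2 * θ := by ring
    have e2 : (4 * (M : ℝ) + 4) * θ = (4 * ((M + 1 : ℕ) : ℝ) + 2) * θ - 2 * θ := by
      push_cast; ring
    rw [e1, e2, Real.sin_add, Real.sin_sub]
    ring

theorem sum_cos_sq_le {θ a : ℝ} (ha : 0 < a) (hθ : a ≤ Real.sin (2 * θ)) (M : ℕ) :
    ∑ j ∈ Finset.Icc 1 M, Real.cos ((2 * j + 1) * θ) ^ 2 ≤ M / 2 + 1 / (2 * a) := by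
  have h1 : ∀ j ∈ Finset.Icc 1 M, Real.cos ((2 * j + 1) * θ) ^ 2 =
      1 / 2 + 1 / 2 * Real.cos ((4 * j + 2) * θ) := by
    intro j _
    rw [Real.cos_sq]
    ring_nf
  rw [Finset.sum_congr rfl h1, Finset.sum_add_distrib, ← Finset.mul_sum]
  simp only [Finset.sum_const, Nat.card_Icc, add_tsub_cancel_right, nsmul_eq_mul]
  have hpos : 0 < Real.sin (2 * θ) := lt_of_lt_of_le ha hθ
  have h2 : Real.sin (2 * θ) * ∑ j ∈ Finset.Icc 1 M, Real.cos ((4 * j + 2) * θ) ≤ 1 := by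
    have := sum_cos_telescope θ M
    have h3 := Real.sin_le_one ((4 * M + 4) * θ)
    have h4 := Real.neg_one_le_sin (4 * θ)
    linarith
  have h5 : ∑ j ∈ Finset.Icc 1 M, Real.cos ((4 * j + 2) * θ) ≤ 1 / a := by
    calc _ ≤ 1 / Real.sin (2 * θ) := by rwa [le_div_iff₀' hpos]
      _ ≤ 1 / a := one_div_le_one_div_of_le ha hθ
  have : 1 / (2 * a) = 1 / 2 * (1 / a) := by field_simp
  rw [this]
  linarith

theorem stageFail_nonneg (hψ : ∑ x, ‖ψ x‖ ^ 2 = 1) (M : ℕ) : 0 ≤ stageFail a₀ ψ M := by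
  have h := successProb_mem (a₀ := a₀) hψ
  refine mul_nonneg (sub_nonneg.2 (h 0).2) (mul_nonneg (by positivity) ?_)
  exact Finset.sum_nonneg fun j _ => sub_nonneg.2 (h j).2

theorem stageFail_le_one_sub (hψ : ∑ x, ‖ψ x‖ ^ 2 = 1) (M : ℕ) :
    stageFail a₀ ψ M ≤ 1 - successProb a₀ ψ 0 := by
  have h := successProb_mem (a₀ := a₀) hψ
  refine mul_le_of_le_one_right (sub_nonneg.2 (h 0).2) ?_
  have : ∑ j ∈ Finset.Icc 1 M, (1 - successProb a₀ ψ j) ≤ M := by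
    calc _ ≤ ∑ j ∈ Finset.Icc 1 M, (1 : ℝ) :=
          Finset.sum_le_sum fun j _ => by linarith [(h j).1]
      _ = M := by simp
  rw [one_div_mul_eq_div]
  exact div_le_one_of_le₀ this (by positivity)

theorem stageFail_le (hψ : ∑ x, ‖ψ x‖ ^ 2 = 1)
    (hp : ∑ x, ‖(goodProj a₀ *ᵥ ψ) x‖ ^ 2 = p) (hp0 : 0 < p) {M : ℕ} (hM : 0 < M) :
    stageFail a₀ ψ M ≤ 1 / 2 + 1 / (2 * M * √p) := by
  have h := successProb_mem (a₀ := a₀) hψ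
  have hsp : 0 < √p := Real.sqrt_pos.2 hp0
  have hM' : (0 : ℝ) < M := by exact_mod_cast hM
  obtain ⟨h0, h1⟩ := goodProj_norm_le hψ hp
  -- For large `p` the angle `2θ` may be close to `π`, which makes the averaging useless, but then
  -- the test without rounds already succeeds with probability at least `1/2`. For small `p`, `cos θ
  -- ≥ 1/2` gives `sin 2θ ≥ sin θ = √p`.
  rcases le_total (1 / 2) p with hhalf | hhalf
  · have h2 := stageFail_le_one_sub (a₀ := a₀) hψ M
    rw [successProb_zero hψ hp] at h2
    have : 0 ≤ 1 / (2 * M * √p) := by positivity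
    linarith
  · set θ := Real.arcsin √p with hθ
    have hs : Real.sin θ = √p :=
      Real.sin_arcsin (by linarith [Real.sqrt_nonneg p]) (Real.sqrt_le_one.mpr h1)
    have hc : 1 / 2 ≤ Real.cos θ := by
      rw [hθ, Real.cos_arcsin, Real.sq_sqrt h0]
      apply Real.le_sqrt_of_sq_le
      linarith
    have h2 : √p ≤ Real.sin (2 * θ) := by
      rw [Real.sin_two_mul, hs]
      nlinarith
    have h3 := sum_cos_sq_le hsp h2 M
    have h4 : ∑ j ∈ Finset.Icc 1 M, (1 - successProb a₀ ψ j) ≤ M / 2 + 1 / (2 * √p) := by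
      refine le_trans (le_of_eq (Finset.sum_congr rfl fun j _ => ?_)) h3
      rw [successProb_eq_sin hψ hp, ← hθ, Real.cos_sq']
    have h5 : (1 / (M : ℝ)) * ∑ j ∈ Finset.Icc 1 M, (1 - successProb a₀ ψ j) ≤
        1 / 2 + 1 / (2 * M * √p) := by
      calc _ ≤ (1 / (M : ℝ)) * (M / 2 + 1 / (2 * √p)) := by gcongr
        _ = _ := by field_simp
    refine le_trans (mul_le_of_le_one_left (mul_nonneg (by positivity) ?_) ?_) h5
    · exact Finset.sum_nonneg fun j _ => sub_nonneg.2 (h j).2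
    · linarith [(h 0).1]

theorem truncatedRounds_succ_le (hψ : ∑ x, ‖ψ x‖ ^ 2 = 1) {c : ℝ} {n l : ℕ}
    (hM : 0 < stageBound c l) {B : ℝ} (hn : truncatedRounds c a₀ ψ n (l + 1) ≤ B) :
    truncatedRounds c a₀ ψ (n + 1) l ≤
      stageBound c l + stageFail a₀ ψ (stageBound c l) * B := by
  have h := successProb_mem (a₀ := a₀) hψ
  rw [truncatedRounds, stageFail]
  set M := stageBound c l
  have hM' : (0 : ℝ) < M := by exact_mod_cast hM
  have e1 : ∑ j ∈ Finset.Icc 1 M,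
      ((j : ℝ) + (1 - successProb a₀ ψ j) * truncatedRounds c a₀ ψ n (l + 1)) ≤
      M * M + (∑ j ∈ Finset.Icc 1 M, (1 - successProb a₀ ψ j)) * B := by
    rw [Finset.sum_add_distrib, Finset.sum_mul]
    apply add_le_add
    · calc ∑ j ∈ Finset.Icc 1 M, (j : ℝ) ≤ ∑ j ∈ Finset.Icc 1 M, (M : ℝ) :=
            Finset.sum_le_sum fun j hj => by exact_mod_cast (Finset.mem_Icc.1 hj).2
        _ = M * M := by simp
    · exact Finset.sum_le_sum fun j _ =>
        mul_le_mul_of_nonneg_left hn (sub_nonneg.2 (h j).2)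
  calc _ ≤ (1 - successProb a₀ ψ 0) * ((1 / (M : ℝ)) *
        (M * M + (∑ j ∈ Finset.Icc 1 M, (1 - successProb a₀ ψ j)) * B)) := by
        refine mul_le_mul_of_nonneg_left ?_ (sub_nonneg.2 (h 0).2)
        exact mul_le_mul_of_nonneg_left e1 (by positivity)
    _ = (1 - successProb a₀ ψ 0) * M + (1 - successProb a₀ ψ 0) *
        ((1 / (M : ℝ)) * ∑ j ∈ Finset.Icc 1 M, (1 - successProb a₀ ψ j)) * B := by
        field_simp
    _ ≤ _ := by
        gcongr
        have := (h 0).1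
        nlinarith

theorem stageBound_bounds {c : ℝ} (hc : 1 < c) (l : ℕ) :
    c ^ l ≤ stageBound c l ∧ (stageBound c l : ℝ) ≤ 2 * c ^ l ∧ 0 < stageBound c l := by
  have h1 : 1 ≤ c ^ l := one_le_pow₀ hc.le
  refine ⟨Nat.le_ceil _, ?_, ?_⟩
  · have := (Nat.ceil_lt_add_one (show 0 ≤ c ^ l by linarith)).le
    rw [stageBound]
    linarith
  · rw [stageBound, Nat.ceil_pos]
    linarith

/-- Amplitude amplification for an unknown success amplitude `√p` takes `O(1/√p)` rounds on
average. -/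
theorem exists_averageRounds_le {c : ℝ} (hc₁ : 1 < c) (hc₂ : c < 2) :
    ∃ C : ℝ, 0 < C ∧ ∀ {κ μ : Type} [Fintype κ] [DecidableEq κ] [Fintype μ] [DecidableEq μ]
      (a₀ : κ) (ψ : κ × μ → ℂ) (p : ℝ), ∑ x, ‖ψ x‖ ^ 2 = 1 →
      ∑ x, ‖(goodProj a₀ *ᵥ ψ) x‖ ^ 2 = p → 0 < p →
      averageRounds c a₀ ψ ≤ ENNReal.ofReal (C / √p) := by
  -- `K` is chosen so that a stage with `c^l ≥ K/√p` has failure probability `q` with `c q ≤ 1/2 +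
  -- c/4 < 1`: the costs grow by the factor `c`, but the weights shrink faster. `D` solves `2 + D
  -- (1/2 + c/4) = D`, and `F` solves `F (c - 1) = 2`, so that the cost `2 c^l` of a stage is `F
  -- c^(l+1) - F c^l`.
  set K : ℝ := 2 * c / (2 - c) with hK
  set D : ℝ := 2 / (1 / 2 - c / 4) with hD
  set F : ℝ := 2 / (c - 1) with hF
  set E : ℝ := F + 2 + D * c with hE
  have hKpos : 0 < K := div_pos (by linarith) (by linarith)
  have hDpos : 0 < D := div_pos (by linarith) (by linarith)
  have hFpos : 0 < F := div_pos (by linarith) (by linarith)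
  have hEpos : 0 < E := by positivity
  refine ⟨D * c + E * K, by positivity, ?_⟩
  intro κ μ _ _ _ _ a₀ ψ p hψ hp hp0
  have hsp : 0 < √p := Real.sqrt_pos.2 hp0
  have hsp1 : √p ≤ 1 := Real.sqrt_le_one.mpr (goodProj_norm_le hψ hp).2
  set T : ℝ := K / √p with hT
  have hTpos : 0 < T := by positivity
  -- Beyond the threshold `T` the bound `D c^l` reproduces itself from stage `l + 1` to stage `l`.
  have late : ∀ n l, T ≤ c ^ l → truncatedRounds c a₀ ψ n l ≤ D * c ^ l := by
    intro n
    induction n with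
    | zero => intro l _; rw [truncatedRounds]; positivity
    | succ n ih =>
      intro l hl
      obtain ⟨b1, b2, b3⟩ := stageBound_bounds hc₁ l
      have hcl : 0 < c ^ l := by positivity
      have h1 := ih (l + 1) (hl.trans (pow_le_pow_right₀ hc₁.le (Nat.le_succ l)))
      have h2 := truncatedRounds_succ_le hψ b3 h1
      have h3 := stageFail_le hψ hp hp0 b3
      have h4 : 1 / (2 * (stageBound c l : ℝ) * √p) ≤ 1 / (2 * K) := by
        apply one_div_le_one_div_of_le (by positivity)
        have : K ≤ stageBound c l * √p := by
          have := hl.trans b1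
          rwa [hT, div_le_iff₀ hsp] at this
        linarith
      have h5 : c * (1 / 2 + 1 / (2 * K)) = 1 / 2 + c / 4 := by
        rw [hK]
        field_simp
        ring
      have h6 : D * (1 / 2 - c / 4) = 2 := by
        rw [hD]
        exact div_mul_cancel₀ _ (by linarith)
      calc _ ≤ _ := h2
        _ ≤ 2 * c ^ l + (1 / 2 + 1 / (2 * K)) * (D * c ^ (l + 1)) := by
          gcongr
          exact h3.trans (by linarith)
        _ = 2 * c ^ l + (c * (1 / 2 + 1 / (2 * K))) * D * c ^ l := by ring
        _ = (2 + D * (1 / 2 + c / 4)) * c ^ l := by rw [h5]; ring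
        _ = (D + (2 - D * (1 / 2 - c / 4))) * c ^ l := by ring
        _ = D * c ^ l := by rw [h6]; ring
  -- Before the threshold the failure probability is only bounded by `1`, and the stage costs form a
  -- geometric sum of size `O(T)`. The term `-F c^l` makes this sum telescope, and `E` leaves room
  -- for the stage in which the threshold is crossed.
  have early : ∀ n l, c ^ l < T → truncatedRounds c a₀ ψ n l ≤ E * T - F * c ^ l := by
    intro n
    induction n with
    | zero =>
      intro l hl
      rw [truncatedRounds]
      have : F * c ^ l ≤ E * T := by
        apply mul_le_mul _ hl.le (by positivity) hEpos.le
        rw [hE]; nlinarith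
      linarith
    | succ n ih =>
      intro l hl
      obtain ⟨b1, b2, b3⟩ := stageBound_bounds hc₁ l
      have hcl : 0 < c ^ l := by positivity
      have hf1 : stageFail a₀ ψ (stageBound c l) ≤ 1 :=
        (stageFail_le_one_sub (a₀ := a₀) hψ _).trans
          (by linarith [(successProb_mem (a₀ := a₀) hψ 0).1])
      have hf0 := stageFail_nonneg (a₀ := a₀) hψ (stageBound c l)
      rcases le_or_gt T (c ^ (l + 1)) with hl' | hl'
      · have h2 := truncatedRounds_succ_le hψ b3 (late n (l + 1) hl')
        have h3 : stageFail a₀ ψ (stageBound c l) * (D * c ^ (l + 1)) ≤ D * c * c ^ l := by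
          calc _ ≤ 1 * (D * c ^ (l + 1)) := by gcongr
            _ = _ := by ring
        have h4 : (F + 2 + D * c) * c ^ l ≤ E * T := by
          rw [← hE]; gcongr
        nlinarith
      · have h1 := ih (l + 1) hl'
        have h2 := truncatedRounds_succ_le hψ b3 h1
        have hB : 0 ≤ E * T - F * c ^ (l + 1) := by
          have : F * c ^ (l + 1) ≤ E * T := by
            apply mul_le_mul _ hl'.le (by positivity) hEpos.le
            rw [hE]; nlinarith
          linarith
        have h3 : F * (c - 1) = 2 := by
          rw [hF]; exact div_mul_cancel₀ _ (by linarith)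
        have h5 : F * c ^ (l + 1) = F * c ^ l + 2 * c ^ l := by
          rw [← h3]; ring
        have h6 := mul_le_of_le_one_left hB hf1
        linarith
  refine iSup_le fun n => ENNReal.ofReal_le_ofReal ?_
  have e : (D * c + E * K) / √p = D * c / √p + E * T := by rw [hT]; ring
  rw [e]
  have hDc : D * c ≤ D * c / √p := by
    rw [le_div_iff₀ hsp]
    exact mul_le_of_le_one_right (by positivity) hsp1
  rcases le_or_gt T (c ^ 1) with h | h
  · have := late n 1 h
    rw [pow_one] at this
    have : 0 ≤ E * T := by positivity
    linarith
  · have := early n 1 h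
    have : 0 ≤ F * c ^ 1 := by positivity
    have : 0 ≤ D * c := by positivity
    linarith

/-! ### The output of amplitude amplification -/

/-- `φ` is the probability that all `n` stages fail, a product of stage failure probabilities. Each
factor is at most `1 - p`, because every stage contains a test without rounds. This gives
termination with probability one. -/
theorem exists_truncatedOutput_eq {c : ℝ} (hc : 1 < c) (hψ : ∑ x, ‖ψ x‖ ^ 2 = 1)
    (hp : ∑ x, ‖(goodProj a₀ *ᵥ ψ) x‖ ^ 2 = p) (hp0 : 0 < p) (n l : ℕ) :
    ∃ φ : ℝ, 0 ≤ φ ∧ φ ≤ (1 - p) ^ n ∧ truncatedOutput c a₀ ψ n l =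
      (((1 - φ) / p : ℝ) : ℂ) • pureState (goodProj a₀ *ᵥ ψ) := by
  induction n generalizing l with
  | zero => exact ⟨1, by simp, by simp, by simp [truncatedOutput]⟩
  | succ n ih =>
    obtain ⟨φ, h0, h1, h2⟩ := ih (l + 1)
    have hM := (stageBound_bounds hc l).2.2
    set M := stageBound c l with hMdef
    have hM' : (M : ℝ) ≠ 0 := by exact_mod_cast hM.ne'
    have hf := stageFail_le_one_sub (a₀ := a₀) hψ M
    have hf0 := stageFail_nonneg (a₀ := a₀) hψ M
    rw [successProb_zero hψ hp] at hf
    refine ⟨stageFail a₀ ψ M * φ, mul_nonneg hf0 h0, ?_, ?_⟩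
    · rw [pow_succ']
      exact mul_le_mul hf h1 h0 (hf0.trans hf)
    · have hs : ∀ j, (roundCoeffs p j).1 ^ 2 = successProb a₀ ψ j / p := by
        intro j
        rw [successProb_eq hψ hp, mul_div_cancel_right₀ _ hp0.ne']
      rw [truncatedOutput, h2, ← hMdef]
      simp only [successState_eq hψ hp, hs, successProb_zero hψ hp, smul_smul, ← add_smul,
        ← Finset.sum_smul]
      congr 1
      rw [stageFail, successProb_zero hψ hp]
      have e : ∀ j ∈ Finset.Icc 1 M, (((successProb a₀ ψ j / p : ℝ) : ℂ) +
          ((1 - successProb a₀ ψ j : ℝ) : ℂ) * (((1 - φ) / p : ℝ) : ℂ)) =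
          ((1 / p - φ / p * (1 - successProb a₀ ψ j) : ℝ) : ℂ) := by
        intro j _
        rw [← Complex.ofReal_mul, ← Complex.ofReal_add]
        congr 1
        field_simp
        ring
      rw [Finset.sum_congr rfl e, ← Complex.ofReal_sum, Finset.sum_sub_distrib, ← Finset.mul_sum]
      simp only [Finset.sum_const, Nat.card_Icc, add_tsub_cancel_right, nsmul_eq_mul]
      have e2 : (1 / (M : ℂ)) = ((1 / (M : ℝ) : ℝ) : ℂ) := by push_cast; rfl
      rw [e2, ← Complex.ofReal_mul, ← Complex.ofReal_mul, ← Complex.ofReal_add]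
      congr 1
      field_simp
      ring

theorem tendsto_truncatedOutput {c : ℝ} (hc : 1 < c) (hψ : ∑ x, ‖ψ x‖ ^ 2 = 1)
    (hp : ∑ x, ‖(goodProj a₀ *ᵥ ψ) x‖ ^ 2 = p) (hp0 : 0 < p) :
    Tendsto (fun n => truncatedOutput c a₀ ψ n 1) atTop
      (𝓝 (((1 / p : ℝ) : ℂ) • pureState (goodProj a₀ *ᵥ ψ))) := by
  choose φ h0 h1 h2 using fun n => exists_truncatedOutput_eq hc hψ hp hp0 n 1
  obtain ⟨_, hp1⟩ := goodProj_norm_le hψ hp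
  have hφ : Tendsto φ atTop (𝓝 0) :=
    squeeze_zero h0 h1 (tendsto_pow_atTop_nhds_zero_of_lt_one (by linarith) (by linarith))
  simp only [h2]
  refine Tendsto.smul_const ?_ _
  have : Tendsto (fun n => (1 - φ n) / p) atTop (𝓝 ((1 - 0) / p)) :=
    (tendsto_const_nhds.sub hφ).div_const p
  rw [sub_zero] at this
  exact (Complex.continuous_ofReal.tendsto _).comp this

end AmplificationDynamics

/-! ### The smoothly truncated exponential -/

section SmoothExp

open MeasureTheory Set Real
open scoped FourierTransform

/-- The distribution function of the Gaussian density `π^{-1/2} e^{-s²}`. -/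
def gaussCdf (t : ℝ) : ℝ := 1 / √π * ∫ s in Iic t, Real.exp (-s ^ 2)

theorem integrable_exp_neg_sq : Integrable fun s : ℝ => Real.exp (-s ^ 2) := by
  simpa using integrable_exp_neg_mul_sq (b := 1) one_pos

theorem integral_exp_neg_sq : ∫ s : ℝ, Real.exp (-s ^ 2) = √π := by
  simpa using integral_gaussian 1

theorem gaussCdf_nonneg (t : ℝ) : 0 ≤ gaussCdf t :=
  mul_nonneg (by positivity) (integral_nonneg fun s => (Real.exp_pos _).le)

theorem gaussCdf_le_one (t : ℝ) : gaussCdf t ≤ 1 := by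
  have h : ∫ s in Iic t, Real.exp (-s ^ 2) ≤ √π := by
    rw [← integral_exp_neg_sq]
    exact setIntegral_le_integral integrable_exp_neg_sq (ae_of_all _ fun s => (Real.exp_pos _).le)
  rw [gaussCdf, one_div_mul_eq_div]
  exact div_le_one_of_le₀ h (by positivity)

theorem gaussCdf_neg (t : ℝ) : gaussCdf (-t) = 1 - gaussCdf t := by
  have h1 : ∫ s in Iic (-t), Real.exp (-s ^ 2) = ∫ s in Ioi t, Real.exp (-s ^ 2) := by
    have := integral_comp_neg_Iic (-t) fun s : ℝ => Real.exp (-s ^ 2)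
    simpa using this
  have h2 : (∫ s in Iic t, Real.exp (-s ^ 2)) + ∫ s in Ioi t, Real.exp (-s ^ 2) = √π := by
    rw [← integral_exp_neg_sq]
    exact intervalIntegral.integral_Iic_add_Ioi integrable_exp_neg_sq.integrableOn
      integrable_exp_neg_sq.integrableOn
  have h3 : √π ≠ 0 := by positivity
  rw [gaussCdf, gaussCdf, h1]
  field_simp
  linarith

/-- After the shift `s ↦ s + t`, the cross term `2 s t` in the exponent is nonnegative on the half
line and can be dropped. Half of the Gaussian integral remains. -/
theorem gaussCdf_le {t : ℝ} (ht : t ≤ 0) : gaussCdf t ≤ 1 / 2 * Real.exp (-t ^ 2) := by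
  have e : ∫ s in Iic t, Real.exp (-s ^ 2) = ∫ s in Iic (0 : ℝ), Real.exp (-(s + t) ^ 2) := by
    have := (measurePreserving_add_right volume t).setIntegral_preimage_emb
      (measurableEmbedding_addRight t) (fun s : ℝ => Real.exp (-s ^ 2)) (Iic t)
    simpa using this.symm
  have h0 : ∫ s in Iic (0 : ℝ), Real.exp (-s ^ 2) = √π / 2 := by
    have h := gaussCdf_neg 0
    rw [neg_zero, gaussCdf] at h
    have h3 : √π ≠ 0 := by positivity
    field_simp at h
    linarith
  have h1 : ∫ s in Iic (0 : ℝ), Real.exp (-(s + t) ^ 2) ≤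
      ∫ s in Iic (0 : ℝ), Real.exp (-t ^ 2) * Real.exp (-s ^ 2) := by
    refine setIntegral_mono_on ?_ (integrable_exp_neg_sq.integrableOn.const_mul _)
      measurableSet_Iic ?_
    · exact (integrable_exp_neg_sq.comp_add_right t).integrableOn
    · intro s hs
      rw [← Real.exp_add]
      apply Real.exp_le_exp.2
      nlinarith [mul_nonneg_of_nonpos_of_nonpos (show s ≤ 0 from hs) ht]
  rw [integral_const_mul, h0] at h1
  rw [gaussCdf, e]
  calc _ ≤ 1 / √π * (Real.exp (-t ^ 2) * (√π / 2)) := by gcongr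
    _ = _ := by
      have h3 : √π ≠ 0 := by positivity
      field_simp

theorem one_sub_gaussCdf_le {t : ℝ} (ht : 0 ≤ t) :
    1 - gaussCdf t ≤ 1 / 2 * Real.exp (-t ^ 2) := by
  rw [← gaussCdf_neg]
  simpa using gaussCdf_le (neg_nonpos.2 ht)

theorem hasDerivAt_gaussCdf (t : ℝ) :
    HasDerivAt gaussCdf (1 / √π * Real.exp (-t ^ 2)) t := by
  have hc : Continuous fun s : ℝ => Real.exp (-s ^ 2) := by fun_prop
  have e : gaussCdf = fun t => 1 / √π *
      ((∫ s in Iic (0 : ℝ), Real.exp (-s ^ 2)) + ∫ s in (0 : ℝ)..t, Real.exp (-s ^ 2)) := by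
    ext t
    rw [gaussCdf, intervalIntegral.integral_Iic_sub_Iic
      integrable_exp_neg_sq.integrableOn integrable_exp_neg_sq.integrableOn |>.symm]
    ring
  rw [e]
  exact ((intervalIntegral.integral_hasDerivAt_right (hc.intervalIntegrable _ _)
    (hc.stronglyMeasurableAtFilter _ _) hc.continuousAt).const_add _).const_mul _

/-- The function `e^{-x}` smoothly cut off to the left of `-D`. -/
def smoothExp (D x : ℝ) : ℝ := Real.exp (-x) * gaussCdf (x + D)

theorem smoothExp_nonneg (D x : ℝ) : 0 ≤ smoothExp D x :=
  mul_nonneg (Real.exp_pos _).le (gaussCdf_nonneg _)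

theorem smoothExp_le (D x : ℝ) : smoothExp D x ≤ Real.exp (-x) :=
  mul_le_of_le_one_right (Real.exp_pos _).le (gaussCdf_le_one _)

theorem smoothExp_le_of_le {D x : ℝ} (h : x ≤ -D) :
    smoothExp D x ≤ 1 / 2 * Real.exp (-x - (x + D) ^ 2) := by
  have := gaussCdf_le (show x + D ≤ 0 by linarith)
  rw [sub_eq_add_neg, Real.exp_add, smoothExp]
  nlinarith [Real.exp_pos (-x)]

theorem exp_neg_sub_smoothExp_le {D x : ℝ} (hD : 0 ≤ D) (hx : 0 ≤ x) :
    Real.exp (-x) - smoothExp D x ≤ 1 / 2 * Real.exp (-D ^ 2) * Real.exp (-x) := by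
  have h1 := one_sub_gaussCdf_le (show 0 ≤ x + D by linarith)
  have h2 : Real.exp (-(x + D) ^ 2) ≤ Real.exp (-D ^ 2) := by
    apply Real.exp_le_exp.2; nlinarith
  have h3 : Real.exp (-x) - smoothExp D x = (1 - gaussCdf (x + D)) * Real.exp (-x) := by
    rw [smoothExp]; ring
  rw [h3]
  gcongr
  linarith

/-- Far to the left the Gaussian tail beats the growth of `e^{-x}`: the required inequality of
exponents is `(x + D + 1)² ≥ 0`. -/
theorem smoothExp_le_decay {D : ℝ} (hD : 0 ≤ D) (x : ℝ) :
    smoothExp D x ≤ Real.exp (1 + 2 * D) * Real.exp (-|x|) := by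
  rw [← Real.exp_add]
  rcases le_total 0 x with h | h
  · rw [abs_of_nonneg h]
    exact (smoothExp_le D x).trans (Real.exp_le_exp.2 (by linarith))
  · rw [abs_of_nonpos h]
    rcases le_total x (-D) with h' | h'
    · refine (smoothExp_le_of_le h').trans ?_
      have : Real.exp (-x - (x + D) ^ 2) ≤ Real.exp (1 + 2 * D + - -x) := by
        apply Real.exp_le_exp.2; nlinarith [sq_nonneg (x + D + 1)]
      linarith [Real.exp_pos (-x - (x + D) ^ 2)]
    · exact (smoothExp_le D x).trans (Real.exp_le_exp.2 (by linarith))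

/-- The function satisfies `f' = -f + Gaussian`, a differential equation that determines its Fourier
transform. -/
theorem hasDerivAt_smoothExp (D x : ℝ) :
    HasDerivAt (smoothExp D)
      (-smoothExp D x + 1 / √π * Real.exp (-x - (x + D) ^ 2)) x := by
  have h1 : HasDerivAt (fun x => Real.exp (-x)) (-Real.exp (-x)) x := by
    simpa using (hasDerivAt_neg x).exp
  have h2 : HasDerivAt (fun x => gaussCdf (x + D)) (1 / √π * Real.exp (-(x + D) ^ 2)) x :=
    (hasDerivAt_gaussCdf (x + D)).comp_add_const x D
  refine (h1.mul h2).congr_deriv ?_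
  rw [sub_eq_add_neg, Real.exp_add, smoothExp]
  ring

/-- The values of the Fourier transform of `x ↦ smoothExp D (z x)`. -/
def smoothExpFourier (D z ω : ℝ) : ℂ :=
  Complex.exp (1 / 4 + D + Complex.I * ω * (1 / 2 + D) - ω ^ 2 / 4) / (z * (1 + Complex.I * ω))

theorem one_add_I_mul_ne_zero (ω : ℝ) : (1 : ℂ) + Complex.I * ω ≠ 0 := by
  intro h
  have := congrArg Complex.re h
  simp at this

theorem one_le_norm_one_add_I_mul (ω : ℝ) : 1 ≤ ‖(1 : ℂ) + Complex.I * ω‖ := by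
  have := Complex.abs_re_le_norm ((1 : ℂ) + Complex.I * ω)
  simpa using this

theorem norm_smoothExpFourier_le (D ω : ℝ) {z : ℝ} (hz : 0 < z) :
    ‖smoothExpFourier D z ω‖ ≤ Real.exp (1 / 4 + D) / z * Real.exp (-ω ^ 2 / 4) := by
  rw [smoothExpFourier, norm_div, Complex.norm_exp, norm_mul, Complex.norm_of_nonneg hz.le]
  have h := one_le_norm_one_add_I_mul ω
  have e : (1 / 4 + (D : ℂ) + Complex.I * ω * (1 / 2 + D) - (ω : ℂ) ^ 2 / 4).re =
      1 / 4 + D + -ω ^ 2 / 4 := by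
    have : (1 / 4 + (D : ℂ) + Complex.I * ω * (1 / 2 + D) - (ω : ℂ) ^ 2 / 4) =
      ((1 / 4 + D + -ω ^ 2 / 4 : ℝ) : ℂ) + ((ω * (1 / 2 + D) : ℝ) : ℂ) * Complex.I := by
        push_cast; ring
    rw [this, Complex.add_re, Complex.ofReal_re, Complex.re_ofReal_mul, Complex.I_re, mul_zero,
      add_zero]
  rw [e, Real.exp_add, div_mul_eq_mul_div]
  apply div_le_div_of_nonneg_left (by positivity) hz
  nlinarith

/-- Quadratic decay suffices both for integrability and for Poisson summation. -/
theorem norm_smoothExp_comp_mul_le {D z : ℝ} (hD : 0 ≤ D) (hz : 2 ≤ z) (y : ℝ) :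
    ‖((smoothExp D (z * y) : ℝ) : ℂ)‖ ≤ Real.exp (1 + 2 * D) * (1 + y ^ 2)⁻¹ := by
  rw [Complex.norm_of_nonneg (smoothExp_nonneg _ _)]
  refine (smoothExp_le_decay hD _).trans ?_
  gcongr
  rw [Real.exp_neg]
  apply inv_anti₀ (by positivity)
  have h := Real.quadratic_le_exp_of_nonneg (abs_nonneg (z * y))
  have h2 : |z * y| ^ 2 = z ^ 2 * y ^ 2 := by rw [sq_abs]; ring
  rw [h2] at h
  have h3 : 4 * y ^ 2 ≤ z ^ 2 * y ^ 2 := by gcongr; nlinarith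
  nlinarith [abs_nonneg (z * y), sq_nonneg y]

/-- The differential equation of `smoothExp` becomes `2πiξ 𝓕f = -z 𝓕f + (z/√π) 𝓕φ` with a Gaussian
`φ`, and this is solved for `𝓕f`. The result corresponds to the coefficient function of the
algorithm, since `smoothExp` is a closed form of the convolution of `π^{-1/2} e^{-x²}` with the
truncated exponential `e^{-1/4} e^{-x}`, `x ≥ -D - 1/2`. The scaling by `z` turns period `z` into
period one. -/
theorem fourier_smoothExp {D z : ℝ} (hD : 0 ≤ D) (hz : 2 ≤ z) (ξ : ℝ) :
    𝓕 (fun y : ℝ => ((smoothExp D (z * y) : ℝ) : ℂ)) ξ =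
      smoothExpFourier D z (2 * π * ξ / z) := by
  set f : ℝ → ℂ := fun y => ((smoothExp D (z * y) : ℝ) : ℂ) with hf
  set φ : ℝ → ℂ := fun y => Complex.exp (-(z ^ 2 : ℂ) * y ^ 2 + (-(z + 2 * z * D) : ℂ) * y +
    (-D ^ 2 : ℂ)) with hφ
  have hzpos : 0 < z := by linarith
  have hzc : (z : ℂ) ≠ 0 := by exact_mod_cast hzpos.ne'
  have hder : ∀ y, HasDerivAt f (-(z : ℂ) * f y + (z / √π : ℝ) * φ y) y := by
    intro y
    have h1 : HasDerivAt (fun y => smoothExp D (z * y))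
        ((-smoothExp D (z * y) + 1 / √π * Real.exp (-(z * y) - (z * y + D) ^ 2)) * z) y := by
      have := (hasDerivAt_smoothExp D (z * y)).comp y ((hasDerivAt_id y).const_mul z)
      simpa [Function.comp_def] using this
    convert h1.ofReal_comp using 1
    have e : φ y = ((Real.exp (-(z * y) - (z * y + D) ^ 2) : ℝ) : ℂ) := by
      simp only [hφ, Complex.ofReal_exp]
      congr 1
      push_cast
      ring
    rw [e]
    simp only [hf]
    push_cast
    ring
  have hdiff : Differentiable ℝ f := fun y => (hder y).differentiableAt
  have hint : Integrable f := by
    refine Integrable.mono' (integrable_inv_one_add_sq.const_mul (Real.exp (1 + 2 * D)))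
      hdiff.continuous.aestronglyMeasurable (ae_of_all _ fun y => ?_)
    exact norm_smoothExp_comp_mul_le hD hz y
  have hre : 0 < ((z : ℂ) ^ 2).re := by
    rw [← Complex.ofReal_pow, Complex.ofReal_re]; positivity
  have hφint : Integrable φ := integrable_cexp_quadratic hre _ _
  have hderiv : deriv f = fun y => -(z : ℂ) * f y + (z / √π : ℝ) * φ y :=
    funext fun y => (hder y).deriv
  have hint' : Integrable (deriv f) := by
    rw [hderiv]
    exact (hint.const_mul _).add (hφint.const_mul _)
  have key := congrFun (fourier_deriv hint hdiff hint') ξ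
  have hI : ∀ g : ℝ → ℂ, Integrable g →
      Integrable fun y : ℝ => Complex.exp (((-2 * π * inner ℝ y ξ : ℝ) : ℂ) * Complex.I) • g y := by
    intro g hg
    have hc : Continuous fun y : ℝ =>
        Complex.exp (((-2 * π * inner ℝ y ξ : ℝ) : ℂ) * Complex.I) := by
      simp only [RCLike.inner_apply, conj_trivial]
      fun_prop
    refine hg.mono (hc.aestronglyMeasurable.smul hg.1) (ae_of_all _ fun y => ?_)
    rw [norm_smul, Complex.norm_exp_ofReal_mul_I, one_mul]
  have hlin : 𝓕 (deriv f) ξ = -(z : ℂ) * 𝓕 f ξ + (z / √π : ℝ) * 𝓕 φ ξ := by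
    rw [hderiv]
    simp only [Real.fourier_eq']
    rw [← integral_const_mul, ← integral_const_mul, ← integral_add]
    · congr 1
      ext y
      simp only [smul_eq_mul]
      ring
    · exact (hI f hint).const_mul _
    · exact (hI φ hφint).const_mul _
  have hφF : 𝓕 φ ξ = (√π / z : ℝ) *
      Complex.exp (1 / 4 + D + Complex.I * (2 * π * ξ / z : ℝ) * (1 / 2 + D) -
        (2 * π * ξ / z : ℝ) ^ 2 / 4) := by
    rw [Real.fourier_eq']
    have e : ∀ y : ℝ, Complex.exp (((-2 * π * inner ℝ y ξ : ℝ) : ℂ) * Complex.I) • φ y =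
        Complex.exp (-(z ^ 2 : ℂ) * y ^ 2 + (-(z + 2 * z * D) - 2 * π * Complex.I * ξ : ℂ) * y +
          (-D ^ 2 : ℂ)) := by
      intro y
      rw [smul_eq_mul, hφ, ← Complex.exp_add]
      congr 1
      simp only [RCLike.inner_apply, conj_trivial]
      push_cast
      ring
    simp_rw [e]
    rw [integral_cexp_quadratic (by simpa using hre)]
    congr 1
    · have : (π : ℂ) / -(-(z : ℂ) ^ 2) = ((π / z ^ 2 : ℝ) : ℂ) := by push_cast; ring
      rw [this, show (1 / 2 : ℂ) = ((1 / 2 : ℝ) : ℂ) by push_cast; ring,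
        ← Complex.ofReal_cpow (by positivity), ← Real.sqrt_eq_rpow, Real.sqrt_div pi_pos.le,
        Real.sqrt_sq hzpos.le]
    · congr 1
      push_cast
      field_simp
      ring_nf
      simp only [Complex.I_sq]
      ring
  rw [hlin, hφF, smul_eq_mul] at key
  rw [smoothExpFourier, eq_div_iff (mul_ne_zero hzc (one_add_I_mul_ne_zero _))]
  have hsp : (√π : ℂ) ≠ 0 := by
    have : √π ≠ 0 := by positivity
    exact_mod_cast this
  have e2 : ((z / √π : ℝ) : ℂ) * ((√π / z : ℝ) * Complex.exp (1 / 4 + D + Complex.I *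
      (2 * π * ξ / z : ℝ) * (1 / 2 + D) - (2 * π * ξ / z : ℝ) ^ 2 / 4)) =
      Complex.exp (1 / 4 + D + Complex.I * (2 * π * ξ / z : ℝ) * (1 / 2 + D) -
        (2 * π * ξ / z : ℝ) ^ 2 / 4) := by
    push_cast
    field_simp
  rw [e2] at key
  have e3 : (z : ℂ) * (1 + Complex.I * ((2 * π * ξ / z : ℝ) : ℂ)) =
      z + 2 * π * Complex.I * ξ := by
    push_cast
    field_simp
  rw [e3]
  linear_combination -key

/-! ### Geometric and Gaussian sums over the integers -/

theorem hasSum_pow_natAbs {r : ℝ} (h0 : 0 ≤ r) (h1 : r < 1) :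
    HasSum (fun n : ℤ => r ^ n.natAbs) (1 / (1 - r) + r / (1 - r)) := by
  apply HasSum.of_nat_of_neg_add_one
  · simpa using hasSum_geometric_of_lt_one h0 h1
  · have := (hasSum_geometric_of_lt_one h0 h1).mul_left r
    have e : (fun n : ℕ => r ^ (-((n : ℤ) + 1)).natAbs) = fun n => r * r ^ n := by
      ext n
      have : (-((n : ℤ) + 1)).natAbs = n + 1 := by omega
      rw [this, pow_succ']
    rw [e, div_eq_mul_inv]
    exact this

theorem cast_natAbs_eq_abs (n : ℤ) : ((n.natAbs : ℕ) : ℝ) = |(n : ℝ)| := by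
  rw [Nat.cast_natAbs, Int.cast_abs]

/-- The tangent bound `y² ≥ 2y - 1` at `y = |n| d` replaces the Gaussian by a geometric sequence. -/
theorem exp_neg_mul_sq_le {b : ℝ} (hb : 0 ≤ b) (d : ℝ) (n : ℤ) :
    Real.exp (-b * (n * d) ^ 2) ≤ Real.exp b * Real.exp (-2 * b * d) ^ n.natAbs := by
  rw [← Real.exp_nat_mul, ← Real.exp_add]
  apply Real.exp_le_exp.2
  have h : ((n.natAbs : ℕ) : ℝ) = |(n : ℝ)| := cast_natAbs_eq_abs n
  rw [h, mul_pow, ← sq_abs (n : ℝ)]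
  nlinarith [mul_nonneg hb (sq_nonneg (|(n : ℝ)| * d - 1))]

theorem summable_exp_neg_mul_sq {b d : ℝ} (hb : 0 < b) (hd : 0 < d) :
    Summable fun n : ℤ => Real.exp (-b * (n * d) ^ 2) := by
  refine Summable.of_nonneg_of_le (fun n => (Real.exp_pos _).le)
    (fun n => exp_neg_mul_sq_le hb.le d n) ?_
  refine (hasSum_pow_natAbs (Real.exp_pos _).le ?_).summable.mul_left _
  rw [Real.exp_lt_one_iff]
  nlinarith [mul_pos hb hd]

theorem tsum_exp_neg_mul_sq_le {b d : ℝ} (hb : 0 < b) (hd : 0 < d) :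
    ∑' n : ℤ, Real.exp (-b * (n * d) ^ 2) ≤ Real.exp b * (1 + 1 / (b * d)) := by
  have hbd := mul_pos hb hd
  set r := Real.exp (-2 * b * d) with hr
  have hr1 : r < 1 := by rw [hr, Real.exp_lt_one_iff]; nlinarith
  have hr0 : 0 < r := Real.exp_pos _
  have hs := hasSum_pow_natAbs hr0.le hr1
  calc _ ≤ ∑' n : ℤ, Real.exp b * r ^ n.natAbs :=
        (summable_exp_neg_mul_sq hb hd).tsum_le_tsum (fun n => exp_neg_mul_sq_le hb.le d n)
          (hs.summable.mul_left _)
    _ = Real.exp b * (1 / (1 - r) + r / (1 - r)) := by rw [tsum_mul_left, hs.tsum_eq]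
    _ ≤ _ := by
      have h1 : 1 / (1 - r) + r / (1 - r) = 1 + 2 * (r / (1 - r)) := by
        have : 1 - r ≠ 0 := by linarith
        field_simp
        ring
      have h2 : r / (1 - r) ≤ 1 / (2 * b * d) := by
        rw [div_le_div_iff₀ (by linarith) (by positivity)]
        have h3 : 1 + 2 * b * d ≤ r⁻¹ := by
          rw [hr, ← Real.exp_neg]
          have := Real.add_one_le_exp (-(-2 * b * d))
          linarith
        have h4 : r * r⁻¹ = 1 := mul_inv_cancel₀ hr0.ne'
        nlinarith
      have h3 : 1 / (b * d) = 2 * (1 / (2 * b * d)) := by field_simp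
      rw [h1, h3]
      gcongr

/-! ### The truncated Fourier series -/

/-- For `n > 0` the exponential itself is small. For `n = -k < 0` the shifted point lies so far to
the left of `-D` that the Gaussian tail must absorb a growth of `e^{kz}` twice over: `(kz - x - D)²
≥ 2kz`, which holds because `kz - x - D ≥ kz/2 + 12`. -/
theorem smoothExp_shift_le {D z x : ℝ} (hD : 4 ≤ D) (hz : 2 * D ^ 2 ≤ z) (hx : x ≤ z / 2 - D ^ 2)
    {n : ℤ} (hn : n ≠ 0) :
    smoothExp D (x + n * z) ≤ Real.exp (-x) * Real.exp (-z) ^ n.natAbs := by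
  rw [← Real.exp_nat_mul, ← Real.exp_add]
  have hz0 : 32 ≤ z := by nlinarith
  rcases lt_or_gt_of_ne hn with h | h
  · have h1 : ((n.natAbs : ℕ) : ℝ) = -(n : ℝ) := by
      rw [cast_natAbs_eq_abs, abs_of_neg (by exact_mod_cast h)]
    have hn1 : (n : ℝ) ≤ -1 := by exact_mod_cast (show n ≤ -1 by omega)
    set k : ℝ := -(n : ℝ) with hk
    have hnk : (n : ℝ) = -k := by rw [hk, neg_neg]
    have hk1 : 1 ≤ k := by linarith
    have hkz : z ≤ k * z := by nlinarith
    have h2 : k * z / 2 + (D ^ 2 - D) ≤ k * z - x - D := by linarith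
    have h3 : 12 ≤ D ^ 2 - D := by nlinarith
    have hle : x + n * z ≤ -D := by rw [hnk]; nlinarith
    refine (smoothExp_le_of_le hle).trans ?_
    have h4 : 2 * (k * z) ≤ (x + n * z + D) ^ 2 := by
      have e : (x + n * z + D) ^ 2 = (k * z - x - D) ^ 2 := by rw [hnk]; ring
      rw [e]
      nlinarith
    have h5 : Real.exp (-(x + n * z) - (x + n * z + D) ^ 2) ≤
        Real.exp (-x + (n.natAbs : ℕ) * -z) := by
      apply Real.exp_le_exp.2
      rw [h1]
      nlinarith
    linarith [Real.exp_pos (-(x + n * z) - (x + n * z + D) ^ 2)]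
  · have h1 : ((n.natAbs : ℕ) : ℝ) = (n : ℝ) := by
      rw [cast_natAbs_eq_abs, abs_of_pos (by exact_mod_cast h)]
    refine (smoothExp_le _ _).trans (Real.exp_le_exp.2 ?_)
    rw [h1]
    linarith

/-- The periodization error is at most `e^{-x} · 2r/(1 - r)` with `r = e^{-z} ≤ e^{-2D²}`. One
factor `e^{-D²}` is kept, and the other absorbs the constants. -/
theorem aliasing_bound {D z x : ℝ} (hD : 4 ≤ D) (hz : 2 * D ^ 2 ≤ z) (hx : x ≤ z / 2 - D ^ 2) :
    |∑' n : ℤ, smoothExp D (x + n * z) - smoothExp D x| ≤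
      1 / 2 * Real.exp (-D ^ 2) * Real.exp (-x) := by
  have hz0 : 32 ≤ z := by nlinarith
  set r := Real.exp (-z) with hr
  have hr0 : 0 < r := Real.exp_pos _
  have hr1 : r < 1 := by rw [hr, Real.exp_lt_one_iff]; linarith
  have hs := hasSum_pow_natAbs hr0.le hr1
  have hb : ∀ n : ℤ, (if n = 0 then 0 else smoothExp D (x + n * z)) ≤
      Real.exp (-x) * (if n = 0 then 0 else r ^ n.natAbs) := by
    intro n
    split_ifs with h
    · simp
    · exact smoothExp_shift_le hD hz hx h
  have hb0 : ∀ n : ℤ, 0 ≤ (if n = 0 then 0 else smoothExp D (x + n * z)) := by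
    intro n
    split_ifs
    · exact le_rfl
    · exact smoothExp_nonneg _ _
  have hs' : HasSum (fun n : ℤ => if n = 0 then 0 else r ^ n.natAbs)
      (1 / (1 - r) + r / (1 - r) - 1) := by
    have h := hs.update 0 0
    have e : (fun n : ℤ => if n = 0 then 0 else r ^ n.natAbs) =
        Function.update (fun n : ℤ => r ^ n.natAbs) 0 0 := by
      ext n
      by_cases hn : n = 0 <;> simp [hn]
    rw [e]
    have e2 : 1 / (1 - r) + r / (1 - r) - 1 =
        0 - r ^ Int.natAbs 0 + (1 / (1 - r) + r / (1 - r)) := by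
      rw [Int.natAbs_zero, pow_zero]
      ring
    rw [e2]
    exact h
  have hsum : Summable fun n : ℤ => if n = 0 then 0 else smoothExp D (x + n * z) :=
    Summable.of_nonneg_of_le hb0 hb (hs'.summable.mul_left _)
  have hsum' : Summable fun n : ℤ => smoothExp D (x + n * z) := by
    refine (hsum.update 0 (smoothExp D x)).congr fun n => ?_
    by_cases h : n = 0
    · subst h; simp
    · simp [h]
  rw [hsum'.tsum_eq_add_tsum_ite 0]
  simp only [Int.cast_zero, zero_mul, add_zero, add_sub_cancel_left]
  rw [abs_of_nonneg (tsum_nonneg hb0)]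
  calc _ ≤ ∑' n : ℤ, Real.exp (-x) * (if n = 0 then 0 else r ^ n.natAbs) :=
        hsum.tsum_le_tsum hb (hs'.summable.mul_left _)
    _ = Real.exp (-x) * (1 / (1 - r) + r / (1 - r) - 1) := by
        rw [tsum_mul_left, hs'.tsum_eq]
    _ ≤ _ := by
      have hr2 : r ≤ Real.exp (-D ^ 2) * Real.exp (-D ^ 2) := by
        rw [hr, ← Real.exp_add]; apply Real.exp_le_exp.2; linarith
      have hE : Real.exp (-D ^ 2) ≤ 1 / 8 := by
        have h7 : Real.exp (-D ^ 2) ≤ Real.exp (-7) := Real.exp_le_exp.2 (by nlinarith)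
        have h8 : (8 : ℝ) ≤ Real.exp 7 := by
          have := Real.add_one_le_exp (7 : ℝ); linarith
        refine h7.trans ?_
        rw [Real.exp_neg, inv_eq_one_div]
        exact one_div_le_one_div_of_le (by norm_num) h8
      set E := Real.exp (-D ^ 2) with hEdef
      have hE0 : 0 < E := Real.exp_pos _
      have hr3 : r ≤ 1 / 64 := hr2.trans (by nlinarith)
      have e : 1 / (1 - r) + r / (1 - r) - 1 = 2 * r / (1 - r) := by
        have : 1 - r ≠ 0 := by linarith
        field_simp
        ring
      have h9 : 2 * r / (1 - r) ≤ 1 / 2 * E := by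
        rw [div_le_iff₀ (by linarith)]
        nlinarith
      rw [e, mul_comm]
      gcongr

/-- This is Poisson summation at the point `x/z`: the Fourier series with frequencies `2πn/z`
represents the `z`-periodization of `smoothExp`. -/
theorem poisson_smoothExp {D z : ℝ} (hD : 0 ≤ D) (hz : 2 ≤ z) (x : ℝ) :
    HasSum (fun n : ℤ => smoothExpFourier D z (n * (2 * π / z)) *
        Complex.exp (Complex.I * (n * (2 * π / z) * x : ℝ)))
      ((∑' n : ℤ, smoothExp D (x + n * z) : ℝ) : ℂ) := by
  have hzpos : 0 < z := by linarith
  have hd : 0 < 2 * π / z := by positivity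
  set f : ℝ → ℂ := fun y => ((smoothExp D (z * y) : ℝ) : ℂ) with hf
  have hcont : Continuous f := by
    refine Complex.continuous_ofReal.comp ?_
    have : Continuous (smoothExp D) :=
      continuous_iff_continuousAt.2 fun x => (hasDerivAt_smoothExp D x).continuousAt
    exact this.comp (continuous_const.mul continuous_id)
  have hF : ∀ n : ℤ, 𝓕 f n = smoothExpFourier D z (n * (2 * π / z)) := by
    intro n
    rw [hf, fourier_smoothExp hD hz]
    congr 1
    ring
  have hFn : ∀ n : ℤ, ‖smoothExpFourier D z (n * (2 * π / z))‖ ≤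
      Real.exp (1 / 4 + D) / z * Real.exp (-(1 / 4) * (n * (2 * π / z)) ^ 2) := by
    intro n
    refine (norm_smoothExpFourier_le D _ hzpos).trans (le_of_eq ?_)
    congr 2
    ring
  have hsummable := (summable_exp_neg_mul_sq (b := 1 / 4) (by norm_num) hd).mul_left
    (Real.exp (1 / 4 + D) / z)
  have hFs : Summable fun n : ℤ => 𝓕 f n := by
    simp only [hF]
    exact Summable.of_norm_bounded hsummable hFn
  have hO : f =O[cocompact ℝ] fun x : ℝ => |x| ^ (-2 : ℝ) := by
    refine Asymptotics.IsBigO.of_bound (Real.exp (1 + 2 * D)) ?_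
    have hne : ∀ᶠ y : ℝ in cocompact ℝ, y ≠ 0 := by
      have := (isCompact_singleton (x := (0 : ℝ))).compl_mem_cocompact
      filter_upwards [this] with y hy using hy
    filter_upwards [hne] with y hy
    refine (norm_smoothExp_comp_mul_le hD hz y).trans ?_
    gcongr
    rw [Real.norm_of_nonneg (by positivity), Real.rpow_neg (abs_nonneg _)]
    have h2 : |y| ^ (2 : ℝ) = y ^ 2 := by
      rw [show (2 : ℝ) = ((2 : ℕ) : ℝ) by norm_num, Real.rpow_natCast, sq_abs]
    rw [h2]
    apply inv_anti₀ (by positivity)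
    linarith
  have key := Real.tsum_eq_tsum_fourier_of_rpow_decay_of_summable hcont (b := 2) (by norm_num)
    hO hFs (x / z)
  have hfo : ∀ n : ℤ, fourier n ((x / z : ℝ) : UnitAddCircle) =
      Complex.exp (Complex.I * (n * (2 * π / z) * x : ℝ)) := by
    intro n
    rw [fourier_coe_apply]
    congr 1
    push_cast
    field_simp
  have hterm : ∀ n : ℤ, 𝓕 f n * fourier n ((x / z : ℝ) : UnitAddCircle) =
      smoothExpFourier D z (n * (2 * π / z)) *
        Complex.exp (Complex.I * (n * (2 * π / z) * x : ℝ)) := by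
    intro n
    rw [hF, hfo]
  simp only [hterm] at key
  have hl : ∑' n : ℤ, f (x / z + n) = ((∑' n : ℤ, smoothExp D (x + n * z) : ℝ) : ℂ) := by
    rw [Complex.ofReal_tsum]
    congr 1
    ext n
    simp only [hf]
    congr 2
    field_simp
  rw [← hl, key]
  refine (Summable.of_norm_bounded hsummable fun n => ?_).hasSum
  rw [norm_mul, mul_comm Complex.I, Complex.norm_exp_ofReal_mul_I, mul_one]
  exact hFn n

theorem tail_bound {D z x : ℝ} (hD : 4 ≤ D) (hz : 2 * D ^ 2 ≤ z) (hx : x ≤ z / 2 - D ^ 2)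
    {J : ℕ} (hJ : z ^ (3 / 2 : ℝ) / 3 ≤ J + 1) :
    ‖((∑' n : ℤ, smoothExp D (x + n * z) : ℝ) : ℂ) -
      ∑ n ∈ Finset.Icc (-(J : ℤ)) J, smoothExpFourier D z (n * (2 * π / z)) *
        Complex.exp (Complex.I * (n * (2 * π / z) * x : ℝ))‖ ≤
      1 / 2 * Real.exp (-D ^ 2) * Real.exp (-x) := by
  have hz0 : 32 ≤ z := by nlinarith
  have hzpos : 0 < z := by linarith
  have hd : 0 < 2 * π / z := by positivity
  set d := 2 * π / z with hddef
  set g : ℤ → ℂ := fun n => smoothExpFourier D z (n * d) *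
        Complex.exp (Complex.I * (n * d * x : ℝ)) with hg
  set s := Finset.Icc (-(J : ℤ)) J with hs
  have hP : HasSum g ((∑' n : ℤ, smoothExp D (x + n * z) : ℝ) : ℂ) :=
    poisson_smoothExp (by linarith) (by linarith) x
  -- For `|n| ≥ J + 1 ≥ z^{3/2}/3` the frequency `ω` satisfies `|ω| ≥ (2π/3)√z ≥ 2√z`. The exponent
  -- `ω²/4` is split into `ω²/5`, which gives the factor `e^{-4z/5}`, and `ω²/20`, which keeps the
  -- sum over `n` convergent.
  set A : ℝ := Real.exp (1 / 4 + D) / z * Real.exp (-(4 / 5) * z) with hA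
  have hgauss := summable_exp_neg_mul_sq (b := 1 / 20) (by norm_num) hd
  have hout : ∀ n : ℤ, n ∉ s → ‖g n‖ ≤ A * Real.exp (-(1 / 20) * (n * d) ^ 2) := by
    intro n hn
    rw [hg, norm_mul, mul_comm Complex.I, Complex.norm_exp_ofReal_mul_I, mul_one]
    refine (norm_smoothExpFourier_le D _ hzpos).trans ?_
    rw [hA, mul_assoc, ← Real.exp_add]
    gcongr
    have hn' : (J : ℝ) + 1 ≤ |(n : ℝ)| := by
      have : (J : ℤ) + 1 ≤ |n| := by
        rw [hs, Finset.mem_Icc, not_and_or] at hn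
        rcases hn with h | h
        · rw [abs_of_neg (by omega)]; omega
        · rw [abs_of_pos (by omega)]; omega
      exact_mod_cast this
    have h1 : z ^ (3 / 2 : ℝ) / 3 * d ≤ |(n : ℝ)| * d := by
      gcongr; exact hJ.trans hn'
    have h2 : z ^ (3 / 2 : ℝ) = z * √z := by
      rw [show (3 / 2 : ℝ) = 1 + 1 / 2 by norm_num, Real.rpow_add hzpos, Real.rpow_one,
        Real.sqrt_eq_rpow]
    have h3 : z ^ (3 / 2 : ℝ) / 3 * d = 2 * π / 3 * √z := by
      rw [h2, hddef]; field_simp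
    rw [h3] at h1
    have h4 : 2 * √z ≤ |(n : ℝ)| * d := by
      refine le_trans ?_ h1
      have := Real.pi_gt_three
      gcongr
      linarith
    have h5 : 4 * z ≤ (n * d) ^ 2 := by
      have e : (n * d) ^ 2 = (|(n : ℝ)| * d) ^ 2 := by
        rw [mul_pow, mul_pow, sq_abs]
      rw [e]
      have h6 : (2 * √z) ^ 2 = 4 * z := by
        rw [mul_pow, Real.sq_sqrt hzpos.le]; norm_num
      rw [← h6]
      gcongr
    linarith
  have hsub : HasSum (fun n => if n ∈ s then 0 else g n)
      (((∑' n : ℤ, smoothExp D (x + n * z) : ℝ) : ℂ) - ∑ n ∈ s, g n) := by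
    have h1 : HasSum (fun n => if n ∈ s then g n else 0) (∑ n ∈ s, g n) := by
      have h2 : HasSum (fun n => if n ∈ s then g n else 0) (∑ n ∈ s, if n ∈ s then g n else 0) :=
        hasSum_sum_of_ne_finset_zero fun b hb => by simp [hb]
      rwa [Finset.sum_congr rfl fun n (hn : n ∈ s) => if_pos hn] at h2
    have e : (fun n => if n ∈ s then 0 else g n) = fun n => g n - if n ∈ s then g n else 0 := by
      ext n
      by_cases h : n ∈ s <;> simp only [h, if_true, if_false, sub_self, sub_zero]
    rw [e]
    exact hP.sub h1
  have hbd : ∀ n : ℤ, ‖(if n ∈ s then 0 else g n)‖ ≤ A * Real.exp (-(1 / 20) * (n * d) ^ 2) := by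
    intro n
    split_ifs with h
    · rw [norm_zero]; positivity
    · exact hout n h
  rw [← hsub.tsum_eq]
  refine (tsum_of_norm_bounded (hgauss.mul_left A).hasSum hbd).trans ?_
  rw [tsum_mul_left]
  have h20 := tsum_exp_neg_mul_sq_le (b := 1 / 20) (by norm_num) hd
  have e1 : Real.exp (1 / 20) ≤ 2 := by
    have : Real.exp (1 / 20) ≤ Real.exp (1 / 2) := Real.exp_le_exp.2 (by norm_num)
    have h2 : Real.exp (1 / 2) ^ 2 < 4 := by
      rw [← Real.exp_nat_mul]
      have := Real.exp_one_lt_d9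
      norm_num at this ⊢
      linarith
    nlinarith [Real.exp_pos (1 / 2)]
  have hpi := Real.pi_gt_three
  have h21 : 1 + 1 / (1 / 20 * d) ≤ 5 * z := by
    rw [hddef]
    have e : 1 / (1 / 20 * (2 * π / z)) = 10 * z / π := by field_simp; norm_num
    have : 10 * z / π ≤ 10 * z / 3 := by gcongr
    rw [e]
    linarith
  calc A * ∑' n : ℤ, Real.exp (-(1 / 20) * (n * d) ^ 2)
      ≤ A * (2 * (5 * z)) := by
        have hA0 : 0 ≤ A := by positivity
        refine mul_le_mul_of_nonneg_left (h20.trans ?_) hA0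
        gcongr
    _ = 10 * Real.exp (1 / 4 + D + -(4 / 5) * z) := by
        rw [hA, Real.exp_add (1 / 4 + D)]; field_simp; norm_num
    _ ≤ 1 / 2 * Real.exp (5 + (1 / 4 + D + -(4 / 5) * z)) := by
        rw [Real.exp_add 5]
        have : (20 : ℝ) ≤ Real.exp 5 := by
          have h := Real.quadratic_le_exp_of_nonneg (show (0 : ℝ) ≤ 5 / 2 by norm_num)
          have e : Real.exp 5 = Real.exp (5 / 2) * Real.exp (5 / 2) := by
            rw [← Real.exp_add]; norm_num
          rw [e]; nlinarith
        nlinarith [Real.exp_pos (1 / 4 + D + -(4 / 5) * z)]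
    -- Since `-D² - x ≥ -z/2`, it suffices that `21/4 + D ≤ 3z/10`, which follows from `z ≥ 2D²` and
    -- `D ≥ 4`.
    _ ≤ 1 / 2 * Real.exp (-D ^ 2 + -x) := by
        refine mul_le_mul_of_nonneg_left (Real.exp_le_exp.2 ?_) (by norm_num)
        nlinarith
    _ = _ := by rw [Real.exp_add]; ring

/-- The truncated Fourier series approximates `e^{-x}` on the relevant part of the half line
`x ≥ 0`, and does not exceed it much for `x < 0`. -/
theorem norm_fourierSum_sub_exp_le {D z x : ℝ} (hD : 4 ≤ D) (hz : 2 * D ^ 2 ≤ z)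
    (hx : x ≤ z / 2 - D ^ 2) {J : ℕ} (hJ : z ^ (3 / 2 : ℝ) / 3 ≤ J + 1) :
    ‖∑ n ∈ Finset.Icc (-(J : ℤ)) J, smoothExpFourier D z (n * (2 * π / z)) *
        Complex.exp (Complex.I * (n * (2 * π / z) * x : ℝ)) - (Real.exp (-x) : ℂ)‖ ≤
      (3 / 2 * Real.exp (-D ^ 2) + if x < 0 then 1 else 0) * Real.exp (-x) := by
  have h1 := tail_bound hD hz hx hJ
  have h2 := aliasing_bound hD hz hx
  set p := ∑' n : ℤ, smoothExp D (x + n * z)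
  set S := ∑ n ∈ Finset.Icc (-(J : ℤ)) J, smoothExpFourier D z (n * (2 * π / z)) *
        Complex.exp (Complex.I * (n * (2 * π / z) * x : ℝ))
  -- For `x < 0` only `0 ≤ smoothExp ≤ e^{-x}` is used, which costs a relative error of `1`.
  -- Truncation, aliasing and smoothing contribute `1/2` each to the factor `3/2`.
  have h3 : |smoothExp D x - Real.exp (-x)| ≤
      (1 / 2 * Real.exp (-D ^ 2) + if x < 0 then 1 else 0) * Real.exp (-x) := by
    rw [abs_sub_comm, abs_of_nonneg (sub_nonneg.2 (smoothExp_le D x))]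
    split_ifs with h
    · have := smoothExp_nonneg D x
      have : 0 ≤ 1 / 2 * Real.exp (-D ^ 2) * Real.exp (-x) := by positivity
      linarith
    · rw [add_zero]
      exact exp_neg_sub_smoothExp_le (by linarith) (not_lt.1 h)
  have e : S - (Real.exp (-x) : ℂ) = -((p : ℂ) - S) + (((p - smoothExp D x : ℝ) : ℂ) +
      ((smoothExp D x - Real.exp (-x) : ℝ) : ℂ)) := by
    push_cast; ring
  rw [e]
  calc _ ≤ ‖(p : ℂ) - S‖ + (|p - smoothExp D x| + |smoothExp D x - Real.exp (-x)|) := by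
        refine (norm_add_le _ _).trans ?_
        rw [norm_neg]
        gcongr
        refine (norm_add_le _ _).trans ?_
        rw [Complex.norm_real, Complex.norm_real, Real.norm_eq_abs, Real.norm_eq_abs]
    _ ≤ _ := by
        refine (add_le_add h1 (add_le_add h2 h3)).trans (le_of_eq ?_)
        ring

/-- The sum of the absolute values of the Fourier coefficients is `O(e^D)`. -/
theorem sum_norm_smoothExpFourier_le {D z : ℝ} (hz : 32 ≤ z) (J : ℕ) :
    ∑ n ∈ Finset.Icc (-(J : ℤ)) J, ‖smoothExpFourier D z (n * (2 * π / z))‖ ≤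
      4 * Real.exp D := by
  have hzpos : 0 < z := by linarith
  have hd : 0 < 2 * π / z := by positivity
  have hs := summable_exp_neg_mul_sq (b := 1 / 4) (by norm_num) hd
  have hpi := Real.pi_gt_three
  have e1 : Real.exp (1 / 4) ≤ 2 := by
    have : Real.exp (1 / 4) ≤ Real.exp (1 / 2) := Real.exp_le_exp.2 (by norm_num)
    have h2 : Real.exp (1 / 2) ^ 2 < 4 := by
      rw [← Real.exp_nat_mul]
      have := Real.exp_one_lt_d9
      norm_num at this ⊢
      linarith
    nlinarith [Real.exp_pos (1 / 2)]
  calc _ ≤ ∑ n ∈ Finset.Icc (-(J : ℤ)) J, Real.exp (1 / 4 + D) / z *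
        Real.exp (-(1 / 4) * (n * (2 * π / z)) ^ 2) := by
        refine Finset.sum_le_sum fun n _ => (norm_smoothExpFourier_le D _ hzpos).trans ?_
        apply le_of_eq
        congr 2
        ring
    _ ≤ Real.exp (1 / 4 + D) / z * ∑' n : ℤ, Real.exp (-(1 / 4) * (n * (2 * π / z)) ^ 2) := by
        rw [← Finset.mul_sum]
        gcongr
        exact hs.sum_le_tsum _ fun n _ => (Real.exp_pos _).le
    _ ≤ Real.exp (1 / 4 + D) / z * (Real.exp (1 / 4) * (1 + 1 / (1 / 4 * (2 * π / z)))) := by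
        gcongr
        exact tsum_exp_neg_mul_sq_le (by norm_num) hd
    _ ≤ Real.exp (1 / 4 + D) / z * (Real.exp (1 / 4) * z) := by
        gcongr
        have e : 1 / (1 / 4 * (2 * π / z)) = 2 * z / π := by field_simp; norm_num
        have : 2 * z / π ≤ 2 * z / 3 := by gcongr
        rw [e]
        linarith
    _ = Real.exp (1 / 4) * Real.exp (1 / 4) * Real.exp D := by
        rw [Real.exp_add]; field_simp
    _ ≤ 2 * 2 * Real.exp D := by gcongr
    _ = _ := by ring

end SmoothExp

/-! ### Squared norms of vectors -/

section SquaredNorm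

variable {n : Type} [Fintype n]

/-- The squared Euclidean norm of a vector. -/
def nsq (v : n → ℂ) : ℝ := ∑ i, ‖v i‖ ^ 2

theorem nsq_nonneg (v : n → ℂ) : 0 ≤ nsq v := Finset.sum_nonneg fun _ _ => by positivity

theorem nsq_eq_norm_sq (v : n → ℂ) : nsq v = ‖WithLp.toLp 2 v‖ ^ 2 := by
  rw [EuclideanSpace.norm_sq_eq]; rfl

theorem sqrt_nsq (v : n → ℂ) : √(nsq v) = ‖WithLp.toLp 2 v‖ := by
  rw [nsq_eq_norm_sq, Real.sqrt_sq (norm_nonneg _)]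

theorem star_dotProduct_self (v : n → ℂ) : star v ⬝ᵥ v = (nsq v : ℂ) := by
  simp [dotProduct, nsq, ← Complex.conj_mul']

theorem star_dotProduct_eq_inner (u v : n → ℂ) :
    star u ⬝ᵥ v = inner ℂ (WithLp.toLp 2 u) (WithLp.toLp 2 v) := by
  rw [EuclideanSpace.inner_eq_star_dotProduct, dotProduct_comm]

theorem norm_star_dotProduct_le (u v : n → ℂ) : ‖star u ⬝ᵥ v‖ ≤ √(nsq u) * √(nsq v) := by
  rw [star_dotProduct_eq_inner, sqrt_nsq, sqrt_nsq]
  exact norm_inner_le_norm _ _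

theorem nsq_smul (c : ℂ) (v : n → ℂ) : nsq (c • v) = ‖c‖ ^ 2 * nsq v := by
  simp [nsq, mul_pow, Finset.mul_sum]

theorem star_dotProduct_mulVec (u v : n → ℂ) (A : Matrix n n ℂ) :
    star u ⬝ᵥ (A *ᵥ v) = star (Aᴴ *ᵥ u) ⬝ᵥ v := by
  rw [star_mulVec, conjTranspose_conjTranspose, dotProduct_mulVec]

variable [DecidableEq n]

theorem sqrt_nsq_mulVec_le (A : Matrix n n ℂ) (v : n → ℂ) :
    √(nsq (A *ᵥ v)) ≤ ‖A‖ * √(nsq v) := by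
  rw [sqrt_nsq, sqrt_nsq]
  exact l2_opNorm_mulVec A (WithLp.toLp 2 v)

theorem nsq_mulVec_of_unitary {U : Matrix n n ℂ} (hU : Uᴴ * U = 1) (v : n → ℂ) :
    nsq (U *ᵥ v) = nsq v := by
  have h := star_dotProduct_mulVec (U *ᵥ v) v U
  rw [star_dotProduct_self, mulVec_mulVec, hU, one_mulVec, star_dotProduct_self] at h
  exact_mod_cast h

theorem norm_star_dotProduct_mulVec_le (A : Matrix n n ℂ) (u v : n → ℂ) :
    ‖star u ⬝ᵥ (A *ᵥ v)‖ ≤ ‖A‖ * (√(nsq u) * √(nsq v)) := by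
  calc _ ≤ √(nsq u) * √(nsq (A *ᵥ v)) := norm_star_dotProduct_le _ _
    _ ≤ √(nsq u) * (‖A‖ * √(nsq v)) := by gcongr; exact sqrt_nsq_mulVec_le A v
    _ = _ := by ring

end SquaredNorm

/-! ### Diagonalization -/

section Diagonalization

variable {ι : Type} [Fintype ι] [DecidableEq ι]

theorem exp_conj_diagonal {U : Matrix ι ι ℂ} (hU : Uᴴ * U = 1) (v : ι → ℂ) :
    NormedSpace.exp (U * diagonal v * Uᴴ) =
      U * diagonal (fun i => Complex.exp (v i)) * Uᴴ := by
  have hU' : U * Uᴴ = 1 := mul_eq_one_comm.1 hU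
  have hinv : U⁻¹ = Uᴴ := inv_eq_right_inv hU'
  have hunit : IsUnit U := ⟨⟨U, Uᴴ, hU', hU⟩, rfl⟩
  rw [← hinv, exp_conj U _ hunit, exp_diagonal]
  congr 3
  ext i
  rw [Pi.coe_exp, Complex.exp_eq_exp_ℂ]

variable {H : Matrix ι ι ℂ}

theorem eigenvectorUnitary_conjTranspose_mul (h : H.IsHermitian) :
    (h.eigenvectorUnitary : Matrix ι ι ℂ)ᴴ * (h.eigenvectorUnitary : Matrix ι ι ℂ) = 1 :=
  Unitary.coe_star_mul_self h.eigenvectorUnitary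

theorem eigenvectorUnitary_mul_conjTranspose (h : H.IsHermitian) :
    (h.eigenvectorUnitary : Matrix ι ι ℂ) * (h.eigenvectorUnitary : Matrix ι ι ℂ)ᴴ = 1 :=
  Unitary.coe_mul_star_self h.eigenvectorUnitary

theorem eq_conj_diagonal (h : H.IsHermitian) :
    H = (h.eigenvectorUnitary : Matrix ι ι ℂ) * diagonal (fun i => (h.eigenvalues i : ℂ)) *
      (h.eigenvectorUnitary : Matrix ι ι ℂ)ᴴ := by
  conv_lhs => rw [h.spectral_theorem, Unitary.conjStarAlgAut_apply]
  rfl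

theorem exp_smul_eq (h : H.IsHermitian) (c : ℂ) :
    NormedSpace.exp (c • H) = (h.eigenvectorUnitary : Matrix ι ι ℂ) *
      diagonal (fun i => Complex.exp (c * h.eigenvalues i)) *
      (h.eigenvectorUnitary : Matrix ι ι ℂ)ᴴ := by
  rw [← exp_conj_diagonal (eigenvectorUnitary_conjTranspose_mul h)]
  congr 1
  conv_lhs => rw [eq_conj_diagonal h]
  rw [← Matrix.smul_mul, ← Matrix.mul_smul, ← diagonal_smul]
  rfl

theorem boltzmann_eq (β : ℝ) (h : H.IsHermitian) :
    boltzmann β H = (h.eigenvectorUnitary : Matrix ι ι ℂ) *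
      diagonal (fun i => (Real.exp (-β * h.eigenvalues i) : ℂ)) *
      (h.eigenvectorUnitary : Matrix ι ι ℂ)ᴴ := by
  rw [boltzmann, exp_smul_eq h]
  congr 3
  ext i
  push_cast
  rfl

theorem partitionFn_eq (β : ℝ) (h : H.IsHermitian) :
    partitionFn β H = ∑ i, Real.exp (-β * h.eigenvalues i) := by
  rw [partitionFn, boltzmann_eq β h, trace_mul_comm, ← Matrix.mul_assoc,
    eigenvectorUnitary_conjTranspose_mul, Matrix.one_mul, trace_diagonal, Complex.re_sum]
  simp only [Complex.ofReal_re]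

theorem partitionFn_pos [Nonempty ι] (β : ℝ) (h : H.IsHermitian) : 0 < partitionFn β H := by
  rw [partitionFn_eq β h]
  exact Finset.sum_pos (fun i _ => Real.exp_pos _) Finset.univ_nonempty

end Diagonalization

/-! ### Transition amplitudes for the trivial process -/

section Transition

variable {ι : Type} [Fintype ι] [DecidableEq ι] {H₀ H₁ : Matrix ι ι ℂ}

/-- The overlap matrix `⟨φ_{1,n}|φ_{0,m}⟩`. -/
def overlap (h₀ : H₀.IsHermitian) (h₁ : H₁.IsHermitian) : Matrix ι ι ℂ :=
  (h₁.eigenvectorUnitary : Matrix ι ι ℂ)ᴴ * (h₀.eigenvectorUnitary : Matrix ι ι ℂ)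

variable (h₀ : H₀.IsHermitian) (h₁ : H₁.IsHermitian)

theorem transitionAmp_one (m n : ι) : transitionAmp h₀ h₁ 1 m n = overlap h₀ h₁ n m := by
  rw [transitionAmp, Matrix.mul_one]
  rfl

theorem overlap_conjTranspose_mul : (overlap h₀ h₁)ᴴ * overlap h₀ h₁ = 1 := by
  rw [overlap, conjTranspose_mul, conjTranspose_conjTranspose, Matrix.mul_assoc,
    ← Matrix.mul_assoc (h₁.eigenvectorUnitary : Matrix ι ι ℂ),
    eigenvectorUnitary_mul_conjTranspose, Matrix.one_mul, eigenvectorUnitary_conjTranspose_mul]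

theorem overlap_mul_conjTranspose : overlap h₀ h₁ * (overlap h₀ h₁)ᴴ = 1 :=
  mul_eq_one_comm.1 (overlap_conjTranspose_mul h₀ h₁)

theorem sum_norm_sq_col {A : Matrix ι ι ℂ} (hA : Aᴴ * A = 1) (m : ι) :
    ∑ n, ‖A n m‖ ^ 2 = 1 := by
  have h := congrFun (congrFun hA m) m
  simp only [Matrix.mul_apply, conjTranspose_apply, one_apply_eq, Complex.star_def,
    Complex.conj_mul'] at h
  exact_mod_cast h

theorem sum_norm_sq_row {A : Matrix ι ι ℂ} (hA : A * Aᴴ = 1) (n : ι) :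
    ∑ m, ‖A n m‖ ^ 2 = 1 := by
  have h := congrFun (congrFun hA n) n
  simp only [Matrix.mul_apply, conjTranspose_apply, one_apply_eq, Complex.star_def,
    Complex.mul_conj'] at h
  exact_mod_cast h

/-- In the eigenbases of `H₁` and `H₀`, the map `A ↦ H₁ A - A H₀` multiplies with the work
values. -/
theorem work_mul_apply (A : Matrix ι ι ℂ) (n m : ι) :
    ((h₁.eigenvectorUnitary : Matrix ι ι ℂ)ᴴ * (H₁ * A - A * H₀) *
      (h₀.eigenvectorUnitary : Matrix ι ι ℂ)) n m =
    workValue h₀ h₁ m n * ((h₁.eigenvectorUnitary : Matrix ι ι ℂ)ᴴ * A *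
      (h₀.eigenvectorUnitary : Matrix ι ι ℂ)) n m := by
  set U₁ := (h₁.eigenvectorUnitary : Matrix ι ι ℂ) with hU₁
  set U₀ := (h₀.eigenvectorUnitary : Matrix ι ι ℂ) with hU₀
  have e1 : U₁ᴴ * H₁ = diagonal (fun i => (h₁.eigenvalues i : ℂ)) * U₁ᴴ := by
    conv_lhs => rw [eq_conj_diagonal h₁]
    rw [← hU₁, ← Matrix.mul_assoc, ← Matrix.mul_assoc, hU₁,
      eigenvectorUnitary_conjTranspose_mul, Matrix.one_mul]
  have e0 : H₀ * U₀ = U₀ * diagonal (fun i => (h₀.eigenvalues i : ℂ)) := by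
    conv_lhs => rw [eq_conj_diagonal h₀]
    rw [← hU₀, Matrix.mul_assoc, hU₀, eigenvectorUnitary_conjTranspose_mul, Matrix.mul_one]
  have e : U₁ᴴ * (H₁ * A - A * H₀) * U₀ =
      diagonal (fun i => (h₁.eigenvalues i : ℂ)) * (U₁ᴴ * A * U₀) -
        (U₁ᴴ * A * U₀) * diagonal (fun i => (h₀.eigenvalues i : ℂ)) := by
    rw [Matrix.mul_sub, Matrix.sub_mul, ← Matrix.mul_assoc U₁ᴴ H₁, e1, ← Matrix.mul_assoc U₁ᴴ A,
      Matrix.mul_assoc _ H₀, e0]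
    simp only [Matrix.mul_assoc]
  rw [e, Matrix.sub_apply, diagonal_mul, mul_diagonal, workValue]
  push_cast
  ring

end Transition

/-! ### Norm growth under imaginary-time evolution -/

section ImaginaryTime

variable {n : Type} [Fintype n] [DecidableEq n]

theorem exp_smul_mul_exp_smul_neg (t : ℝ) (H : Matrix n n ℂ) :
    NormedSpace.exp (t • H) * NormedSpace.exp (t • -H) = 1 := by
  have hc : Commute (t • H) (t • -H) := by
    rw [smul_neg]
    exact (Commute.refl _).neg_right
  rw [← Matrix.exp_add_of_commute _ _ hc, smul_neg, add_neg_cancel, NormedSpace.exp_zero]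

theorem exp_smul_neg_mul_exp_smul (t : ℝ) (H : Matrix n n ℂ) :
    NormedSpace.exp (t • -H) * NormedSpace.exp (t • H) = 1 :=
  mul_eq_one_comm.1 (exp_smul_mul_exp_smul_neg t H)

theorem conjTranspose_exp_smul {H : Matrix n n ℂ} (h : H.IsHermitian) (t : ℝ) :
    (NormedSpace.exp (t • H))ᴴ = NormedSpace.exp (t • H) := by
  rw [← Matrix.exp_conjTranspose, conjTranspose_smul, h.eq, star_trivial]

theorem hasDerivAt_nsq_mulVec {F : ℝ → Matrix n n ℂ} {F' : Matrix n n ℂ} {s : ℝ}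
    (hF : HasDerivAt F F' s) (ψ : n → ℂ) :
    HasDerivAt (fun s => nsq (F s *ᵥ ψ)) (2 * (star (F s *ᵥ ψ) ⬝ᵥ (F' *ᵥ ψ)).re) s := by
  have hi : ∀ i, HasDerivAt (fun s => (F s *ᵥ ψ) i) ((F' *ᵥ ψ) i) s := by
    intro i
    let L : Matrix n n ℂ →ₗ[ℝ] ℂ :=
      { toFun := fun A => (A *ᵥ ψ) i
        map_add' := fun A B => by rw [add_mulVec]; rfl
        map_smul' := fun c A => by rw [smul_mulVec]; rfl }
    exact (LinearMap.toContinuousLinearMap L).hasFDerivAt.comp_hasDerivAt s hF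
  have h := HasDerivAt.fun_sum fun i (_ : i ∈ Finset.univ) => (hi i).norm_sq
  refine h.congr_deriv ?_
  rw [← Finset.mul_sum, dotProduct, Complex.re_sum]
  congr 1
  refine Finset.sum_congr rfl fun i _ => ?_
  rw [Complex.inner, Pi.star_apply, Complex.star_def, mul_comm]

/-- The squared norm along `e^{-sK} e^{sH} ψ` changes at the rate given by the conjugate of
`H - K` under imaginary-time evolution. -/
theorem hasDerivAt_nsq_exp_mul_exp (H K : Matrix n n ℂ) (ψ : n → ℂ) (s : ℝ) :
    HasDerivAt (fun s : ℝ => nsq ((NormedSpace.exp (s • -K) * NormedSpace.exp (s • H)) *ᵥ ψ))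
      (2 * (star ((NormedSpace.exp (s • -K) * NormedSpace.exp (s • H)) *ᵥ ψ) ⬝ᵥ
        ((NormedSpace.exp (s • -K) * (H - K) * NormedSpace.exp (s • K)) *ᵥ
          ((NormedSpace.exp (s • -K) * NormedSpace.exp (s • H)) *ᵥ ψ))).re) s := by
  have h1 := hasDerivAt_exp_smul_const (𝕂 := ℝ) (-K) s
  have h2 := hasDerivAt_exp_smul_const' (𝕂 := ℝ) H s
  have h3 := hasDerivAt_nsq_mulVec (h1.mul h2) ψ
  refine h3.congr_deriv ?_
  congr 3
  rw [mulVec_mulVec]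
  congr 1
  calc _ = NormedSpace.exp (s • -K) * (H - K) * NormedSpace.exp (s • H) := by
        rw [Matrix.mul_sub, Matrix.sub_mul]
        simp only [Matrix.mul_neg, Matrix.neg_mul, Matrix.mul_assoc]
        abel
    _ = NormedSpace.exp (s • -K) * (H - K) *
          (NormedSpace.exp (s • K) * NormedSpace.exp (s • -K)) * NormedSpace.exp (s • H) := by
        rw [exp_smul_mul_exp_smul_neg, Matrix.mul_one]
    _ = _ := by simp only [Matrix.mul_assoc]

/-- Gronwall's inequality with an integrating factor `w`. -/
theorem mul_le_of_hasDerivAt {f f' w w' : ℝ → ℝ} {t : ℝ} (ht : 0 ≤ t)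
    (hf : ∀ s ∈ Set.Icc 0 t, HasDerivAt f (f' s) s)
    (hw : ∀ s ∈ Set.Icc 0 t, HasDerivAt w (w' s) s)
    (hle : ∀ s ∈ Set.Icc 0 t, f' s * w s + f s * w' s ≤ 0) :
    f t * w t ≤ f 0 * w 0 := by
  have hd : ∀ s ∈ Set.Icc 0 t, HasDerivAt (fun s => f s * w s) (f' s * w s + f s * w' s) s :=
    fun s hs => (hf s hs).mul (hw s hs)
  have hanti : AntitoneOn (fun s => f s * w s) (Set.Icc 0 t) := by
    refine antitoneOn_of_deriv_nonpos (convex_Icc 0 t)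
      (fun s hs => (hd s hs).continuousAt.continuousWithinAt) ?_ ?_
    · intro s hs
      rw [interior_Icc] at hs
      exact (hd s (Set.Ioo_subset_Icc_self hs)).differentiableAt.differentiableWithinAt
    · intro s hs
      rw [interior_Icc] at hs
      rw [(hd s (Set.Ioo_subset_Icc_self hs)).deriv]
      exact hle s (Set.Ioo_subset_Icc_self hs)
  exact hanti ⟨le_rfl, ht⟩ ⟨ht, le_rfl⟩ ht

theorem cos_pos_of_le_one {x : ℝ} (h0 : 0 ≤ x) (h1 : x ≤ 1) : 1 / 2 ≤ Real.cos x := by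
  have h := Real.one_sub_sq_div_two_le_cos (x := x)
  nlinarith

theorem sin_nonneg_of_le_one {x : ℝ} (h0 : 0 ≤ x) (h1 : x ≤ 1) : 0 ≤ Real.sin x :=
  Real.sin_nonneg_of_nonneg_of_le_pi h0 (by linarith [Real.pi_gt_three])

/-- If `f' ≤ b sec(b s) f` then `f` grows at most by the factor `sec + tan`. -/
theorem le_sec_add_tan_mul {f f' : ℝ → ℝ} {b t : ℝ} (hb : 0 ≤ b) (ht : 0 ≤ t) (hbt : b * t ≤ 1)
    (hf : ∀ s ∈ Set.Icc 0 t, HasDerivAt f (f' s) s)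
    (hle : ∀ s ∈ Set.Icc 0 t, f' s ≤ b / Real.cos (b * s) * f s) :
    f t ≤ (1 + Real.sin (b * t)) / Real.cos (b * t) * f 0 := by
  have hbs : ∀ s ∈ Set.Icc 0 t, 0 ≤ b * s ∧ b * s ≤ 1 := fun s hs =>
    ⟨mul_nonneg hb hs.1, (mul_le_mul_of_nonneg_left hs.2 hb).trans hbt⟩
  -- The integrating factor is the reciprocal of `sec + tan`, whose logarithmic derivative is `sec`.
  have hw : ∀ s ∈ Set.Icc 0 t,
      HasDerivAt (fun s => Real.cos (b * s) / (1 + Real.sin (b * s)))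
        (-b / (1 + Real.sin (b * s))) s := by
    intro s hs
    have hs0 := sin_nonneg_of_le_one (hbs s hs).1 (hbs s hs).2
    have hlin : HasDerivAt (fun s => b * s) b s := by
      simpa using (hasDerivAt_id s).const_mul b
    have h := (hlin.cos).div (hlin.sin.const_add 1) (by linarith)
    refine h.congr_deriv ?_
    have hsc := Real.sin_sq_add_cos_sq (b * s)
    have hne : 1 + Real.sin (b * s) ≠ 0 := by linarith
    field_simp
    linear_combination (-b) * hsc
  have key := mul_le_of_hasDerivAt ht hf hw ?_
  · have h0 := sin_nonneg_of_le_one (hbs t ⟨ht, le_rfl⟩).1 (hbs t ⟨ht, le_rfl⟩).2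
    have hc := cos_pos_of_le_one (hbs t ⟨ht, le_rfl⟩).1 (hbs t ⟨ht, le_rfl⟩).2
    have hc' : 0 < Real.cos (b * t) := by linarith
    simp only [mul_zero, Real.cos_zero, Real.sin_zero, add_zero, div_one, mul_one] at key
    have hne : 1 + Real.sin (b * t) ≠ 0 := by linarith
    have e : f t = (1 + Real.sin (b * t)) / Real.cos (b * t) *
        (f t * (Real.cos (b * t) / (1 + Real.sin (b * t)))) := by field_simp
    rw [e]
    gcongr
  · intro s hs
    have h0 := sin_nonneg_of_le_one (hbs s hs).1 (hbs s hs).2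
    have hc := cos_pos_of_le_one (hbs s hs).1 (hbs s hs).2
    have hc' : 0 < Real.cos (b * s) := by linarith
    have h1 := mul_le_mul_of_nonneg_right (hle s hs)
      (show 0 ≤ Real.cos (b * s) / (1 + Real.sin (b * s)) by positivity)
    have e : b / Real.cos (b * s) * f s * (Real.cos (b * s) / (1 + Real.sin (b * s))) =
        -(f s * (-b / (1 + Real.sin (b * s)))) := by
      field_simp
    linarith

theorem le_exp_mul {f f' : ℝ → ℝ} {c t : ℝ} (ht : 0 ≤ t)
    (hf : ∀ s ∈ Set.Icc 0 t, HasDerivAt f (f' s) s)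
    (hle : ∀ s ∈ Set.Icc 0 t, f' s ≤ c * f s) :
    f t ≤ Real.exp (c * t) * f 0 := by
  have hw : ∀ s ∈ Set.Icc 0 t,
      HasDerivAt (fun s => Real.exp (-(c * s))) (Real.exp (-(c * s)) * -c) s := by
    intro s _
    have hlin : HasDerivAt (fun s => -(c * s)) (-c) s := by
      simpa using (hasDerivAt_id s).const_mul (-c)
    exact hlin.exp
  have key := mul_le_of_hasDerivAt ht hf hw ?_
  · simp only [mul_zero, neg_zero, Real.exp_zero, mul_one] at key
    have e : f t = Real.exp (c * t) * (f t * Real.exp (-(c * t))) := by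
      rw [Real.exp_neg]
      field_simp
    rw [e]
    gcongr
  · intro s hs
    have h1 := mul_le_mul_of_nonneg_right (hle s hs) (Real.exp_pos (-(c * s))).le
    linarith

open scoped MatrixOrder ComplexOrder in
/-- If `T = G G†` satisfies `T ≤ E` and `T⁻¹ ≤ E`, then `T + T⁻¹ ≤ E + E⁻¹`. -/
theorem nsq_add_nsq_inv_le {G G' : Matrix n n ℂ} (hG : G * G' = 1) {E : ℝ} (hE : 0 < E)
    (h1 : ∀ ψ, nsq (Gᴴ *ᵥ ψ) ≤ E * nsq ψ) (h2 : ∀ ψ, nsq (G' *ᵥ ψ) ≤ E * nsq ψ) (ψ : n → ℂ) :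
    nsq (Gᴴ *ᵥ ψ) + nsq (G' *ᵥ ψ) ≤ (E + E⁻¹) * nsq ψ := by
  have hG' : G' * G = 1 := mul_eq_one_comm.1 hG
  have quad : ∀ (B : Matrix n n ℂ) (φ : n → ℂ),
      star φ ⬝ᵥ ((Bᴴ * B) *ᵥ φ) = (nsq (B *ᵥ φ) : ℂ) := by
    intro B φ
    rw [← mulVec_mulVec, star_dotProduct_mulVec, conjTranspose_conjTranspose,
      star_dotProduct_self]
  have pos : ∀ B : Matrix n n ℂ, (∀ φ, nsq (B *ᵥ φ) ≤ E * nsq φ) →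
      0 ≤ (E : ℂ) • (1 : Matrix n n ℂ) - Bᴴ * B := by
    intro B hB
    rw [nonneg_iff_posSemidef]
    refine PosSemidef.of_dotProduct_mulVec_nonneg ?_ fun φ => ?_
    · refine IsHermitian.sub ?_ (isHermitian_conjTranspose_mul_self B)
      rw [IsHermitian, conjTranspose_smul, conjTranspose_one, Complex.star_def, Complex.conj_ofReal]
    · rw [sub_mulVec, smul_mulVec, one_mulVec, dotProduct_sub, dotProduct_smul, quad,
        star_dotProduct_self, smul_eq_mul, ← Complex.ofReal_mul, ← Complex.ofReal_sub]
      exact_mod_cast sub_nonneg.2 (hB φ)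
  have p1 := pos Gᴴ h1
  have p2 := pos G' h2
  rw [conjTranspose_conjTranspose] at p1
  have hT1 : (G * Gᴴ) * (G'ᴴ * G') = 1 := by
    calc _ = G * (G' * G)ᴴ * G' := by rw [conjTranspose_mul]; simp only [Matrix.mul_assoc]
      _ = 1 := by rw [hG', conjTranspose_one, Matrix.mul_one, hG]
  have hT2 : (G'ᴴ * G') * (G * Gᴴ) = 1 := mul_eq_one_comm.1 hT1
  have hcomm : Commute ((E : ℂ) • (1 : Matrix n n ℂ) - G * Gᴴ)
      ((E : ℂ) • (1 : Matrix n n ℂ) - G'ᴴ * G') := by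
    have c1 : Commute (G * Gᴴ) (G'ᴴ * G') := by rw [Commute, SemiconjBy, hT1, hT2]
    have c2 : ∀ B : Matrix n n ℂ, Commute ((E : ℂ) • (1 : Matrix n n ℂ)) B := fun B =>
      (Commute.one_left B).smul_left _
    exact ((c2 _).sub_right (c2 _)).sub_left (((c2 _).symm).sub_right c1)
  -- The commuting operators `E - T` and `E - T⁻¹` are nonnegative, hence so is their product `E² +
  -- 1 - E (T + T⁻¹)`.
  have p3 := hcomm.mul_nonneg p1 p2
  rw [nonneg_iff_posSemidef] at p3
  have p4 := p3.dotProduct_mulVec_nonneg ψ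
  have q1 := quad Gᴴ ψ
  rw [conjTranspose_conjTranspose] at q1
  have e : ((E : ℂ) • (1 : Matrix n n ℂ) - G * Gᴴ) * ((E : ℂ) • (1 : Matrix n n ℂ) - G'ᴴ * G') =
      ((E : ℂ) ^ 2 + 1) • (1 : Matrix n n ℂ) - (E : ℂ) • (G * Gᴴ) - (E : ℂ) • (G'ᴴ * G') := by
    rw [Matrix.sub_mul, Matrix.mul_sub, Matrix.mul_sub, hT1]
    simp only [Matrix.smul_mul, Matrix.mul_smul, Matrix.one_mul, Matrix.mul_one, smul_smul,
      add_smul, one_smul, pow_two]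
    abel
  rw [e, sub_mulVec, sub_mulVec, smul_mulVec, smul_mulVec, smul_mulVec, one_mulVec,
    dotProduct_sub, dotProduct_sub, dotProduct_smul, dotProduct_smul, dotProduct_smul, q1,
    quad, star_dotProduct_self] at p4
  have p5 : 0 ≤ (E ^ 2 + 1) * nsq ψ - E * nsq (Gᴴ *ᵥ ψ) - E * nsq (G' *ᵥ ψ) := by
    simp only [smul_eq_mul] at p4
    exact_mod_cast p4
  have p6 : (E + E⁻¹) * nsq ψ - (nsq (Gᴴ *ᵥ ψ) + nsq (G' *ᵥ ψ)) =
      E⁻¹ * ((E ^ 2 + 1) * nsq ψ - E * nsq (Gᴴ *ᵥ ψ) - E * nsq (G' *ᵥ ψ)) := by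
    field_simp
    ring
  have p7 := mul_nonneg (inv_pos.2 hE).le p5
  linarith

end ImaginaryTime

/-! ### Local operators -/

section LocalOperators

variable {𝔫 d : ℕ}

theorem ActsOn.neg {X : Finset (Fin 𝔫)} {A : Matrix (Fin 𝔫 → Fin d) (Fin 𝔫 → Fin d) ℂ}
    (hA : ActsOn X A) : ActsOn X (-A) := by
  obtain ⟨B, hB⟩ := hA
  refine ⟨-B, fun σ τ => ?_⟩
  rw [Matrix.neg_apply, hB]
  split_ifs <;> simp

theorem ActsOn.commute {X Y : Finset (Fin 𝔫)} {A B : Matrix (Fin 𝔫 → Fin d) (Fin 𝔫 → Fin d) ℂ}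
    (hA : ActsOn X A) (hB : ActsOn Y B) (hXY : Disjoint X Y) : Commute A B := by
  obtain ⟨a, ha⟩ := hA
  obtain ⟨b, hb⟩ := hB
  have hY : ∀ i ∈ X, i ∉ Y := fun i hi => Finset.disjoint_left.1 hXY hi
  have hX : ∀ i ∈ Y, i ∉ X := fun i hi => Finset.disjoint_right.1 hXY hi
  have key : ∀ {X Y : Finset (Fin 𝔫)} {A B : Matrix (Fin 𝔫 → Fin d) (Fin 𝔫 → Fin d) ℂ}
      {a : Matrix (X → Fin d) (X → Fin d) ℂ} {b : Matrix (Y → Fin d) (Y → Fin d) ℂ},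
      (∀ σ τ, A σ τ = if ∀ i ∉ X, σ i = τ i then a (fun i => σ i) (fun i => τ i) else 0) →
      (∀ σ τ, B σ τ = if ∀ i ∉ Y, σ i = τ i then b (fun i => σ i) (fun i => τ i) else 0) →
      (∀ i ∈ X, i ∉ Y) → ∀ σ τ, (A * B) σ τ = if ∀ i, i ∉ X → i ∉ Y → σ i = τ i then
        a (fun i => σ i) (fun i => τ i) * b (fun i => σ i) (fun i => τ i) else 0 := by
    intro X Y A B a b ha hb hY σ τ
    -- Only one intermediate configuration contributes to the product: `A` may change only the
    -- qudits in `X` and `B` only those in `Y`, so it equals `τ` on `X` and `σ` elsewhere. The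
    -- resulting entry is symmetric in the two factors.
    set ρ : Fin 𝔫 → Fin d := fun i => if i ∈ X then τ i else σ i with hρ
    rw [Matrix.mul_apply, Finset.sum_eq_single ρ]
    · have e1 : A σ ρ = a (fun i => σ i) (fun i => τ i) := by
        rw [ha, if_pos]
        · congr 1
          ext i
          simp [hρ]
        · intro i hi
          simp [hρ, hi]
      have e2 : B ρ τ = if ∀ i, i ∉ X → i ∉ Y → σ i = τ i then
          b (fun i => σ i) (fun i => τ i) else 0 := by
        rw [hb]
        have hiff : (∀ i ∉ Y, ρ i = τ i) ↔ ∀ i, i ∉ X → i ∉ Y → σ i = τ i := by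
          refine forall_congr' fun i => ?_
          by_cases hi : i ∈ X <;> simp [hρ, hi]
        have hr : (fun i : Y => ρ i) = fun i : Y => σ i := by
          ext i
          have : (i : Fin 𝔫) ∉ X := fun h => hY i h i.2
          simp [hρ, this]
        simp only [hiff, hr]
      rw [e1, e2, mul_ite, mul_zero]
    · intro ρ' _ hne
      rw [ha, hb]
      split_ifs with h1 h2
      · exfalso
        apply hne
        ext i
        by_cases hi : i ∈ X
        · simp only [hρ, hi, if_true]
          rw [h2 i (hY i hi)]
        · simp only [hρ, hi, if_false]
          rw [h1 i hi]
      all_goals simp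
    · intro h
      exact absurd (Finset.mem_univ _) h
  ext σ τ
  rw [key ha hb hY, key hb ha hX]
  have : (∀ i, i ∉ X → i ∉ Y → σ i = τ i) ↔ ∀ i, i ∉ Y → i ∉ X → σ i = τ i :=
    forall_congr' fun i => ⟨fun h a b => h b a, fun h a b => h b a⟩
  simp only [this, mul_comm]

theorem IsLocalHamiltonian.neg {Λ : Finset (Finset (Fin 𝔫))} {k g : ℕ} {s : ℝ}
    {t : Finset (Fin 𝔫) → Matrix (Fin 𝔫 → Fin d) (Fin 𝔫 → Fin d) ℂ}
    (h : IsLocalHamiltonian Λ k g s t) : IsLocalHamiltonian Λ k g s fun X => -t X where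
  hermitian X hX := (h.hermitian X hX).neg
  actsOn X hX := (h.actsOn X hX).neg
  norm_le X hX := by rw [norm_neg]; exact h.norm_le X hX
  card_le := h.card_le
  degree_le := h.degree_le

theorem card_not_disjoint_le {Λ : Finset (Finset (Fin 𝔫))} {g : ℕ}
    (hg : ∀ i : Fin 𝔫, (Λ.filter fun X => i ∈ X).card ≤ g) (Y : Finset (Fin 𝔫)) :
    (Λ.filter fun X => ¬Disjoint X Y).card ≤ Y.card * g := by
  have hsub : (Λ.filter fun X => ¬Disjoint X Y) ⊆ Y.biUnion fun i => Λ.filter fun X => i ∈ X := by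
    intro X hX
    rw [Finset.mem_filter, Finset.not_disjoint_iff] at hX
    obtain ⟨hX, i, hiX, hiY⟩ := hX
    exact Finset.mem_biUnion.2 ⟨i, hiY, Finset.mem_filter.2 ⟨hX, hiX⟩⟩
  exact (Finset.card_le_card hsub).trans (Finset.card_biUnion_le_card_mul _ _ _ fun i _ => hg i)

end LocalOperators

/-! ### Imaginary-time evolution of local operators -/

section LocalEvolution

variable {𝔫 d : ℕ}

/-- If every term of `∑_{X ∈ N} v_X` has small numerical radius after conjugation, so has the
sum. -/
theorem norm_quadForm_sum_le {n : Type} [Fintype n] [DecidableEq n] {α : Type} {N : Finset α}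
    {v : α → Matrix n n ℂ} {P R : Matrix n n ℂ} {y : n → ℂ} {r : ℝ}
    (h : ∀ X ∈ N, ‖star y ⬝ᵥ ((P * v X * R) *ᵥ y)‖ ≤ r) :
    ‖star y ⬝ᵥ ((P * (∑ X ∈ N, v X) * R) *ᵥ y)‖ ≤ N.card * r := by
  rw [Finset.mul_sum, Finset.sum_mul, Matrix.sum_mulVec, dotProduct_sum, ← nsmul_eq_mul]
  exact norm_sum_le_of_le _ h |>.trans (by rw [Finset.sum_const])

/-- The numerical radius of `e^{tH} A e^{-tH}` for local `H` and `A` is at most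
`‖A‖ sec (2 h g k t)`. -/
theorem norm_quadForm_evolve_le {Λ : Finset (Finset (Fin 𝔫))} {k g : ℕ} {h b : ℝ}
    (hh : 0 ≤ h) (hb : 2 * h * g * k ≤ b) (S : Finset (Finset (Fin 𝔫))) :
    S ⊆ Λ → ∀ {t₀ : Finset (Fin 𝔫) → Matrix (Fin 𝔫 → Fin d) (Fin 𝔫 → Fin d) ℂ},
    IsLocalHamiltonian Λ k g h t₀ → ∀ {Y : Finset (Fin 𝔫)}, Y.card ≤ k →
    ∀ {A : Matrix (Fin 𝔫 → Fin d) (Fin 𝔫 → Fin d) ℂ}, ActsOn Y A →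
    ∀ {t : ℝ}, 0 ≤ t → b * t ≤ 1 → ∀ ψ : (Fin 𝔫 → Fin d) → ℂ,
    ‖star ψ ⬝ᵥ ((NormedSpace.exp (t • ∑ X ∈ S, t₀ X) * A *
      NormedSpace.exp (t • -∑ X ∈ S, t₀ X)) *ᵥ ψ)‖ ≤ ‖A‖ / Real.cos (b * t) * nsq ψ := by
  have hb0 : 0 ≤ b := le_trans (by positivity) hb
  -- The terms that commute with `A` by locality are split off into `K`. Then `e^{tH} A e^{-tH} = G
  -- A G⁻¹` with `G = e^{tH} e^{-tK}`, and the growth of `G` is controlled by the at most `gk`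
  -- remaining terms, each evolved under `K` alone. To these evolved terms the induction hypothesis
  -- applies.
  induction S using Finset.strongInduction with
  | H S ih =>
  intro hS t₀ hloc Y hY A hA t ht hbt ψ
  have hbs : ∀ s ∈ Set.Icc 0 t, 0 ≤ b * s ∧ b * s ≤ 1 := fun s hs =>
    ⟨mul_nonneg hb0 hs.1, (mul_le_mul_of_nonneg_left hs.2 hb0).trans hbt⟩
  set S' := S.filter fun X => Disjoint X Y with hS'
  set N := S.filter fun X => ¬Disjoint X Y with hN
  set H := ∑ X ∈ S, t₀ X with hH
  set K := ∑ X ∈ S', t₀ X with hK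
  have hHK : H - K = ∑ X ∈ N, t₀ X := by
    rw [hH, ← Finset.sum_filter_add_sum_filter_not S (fun X => Disjoint X Y), ← hS', ← hN, ← hK]
    abel
  have hKcomm : Commute K A := by
    refine Commute.sum_left _ _ _ fun X hX => ?_
    rw [hS', Finset.mem_filter] at hX
    exact (hloc.actsOn X (hS hX.1)).commute hA hX.2
  have hHherm : H.IsHermitian := by
    rw [IsHermitian, hH, conjTranspose_sum]
    exact Finset.sum_congr rfl fun X hX => (hloc.hermitian X (hS hX)).eq
  have hKherm : K.IsHermitian := by
    rw [IsHermitian, hK, conjTranspose_sum]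
    exact Finset.sum_congr rfl fun X hX =>
      (hloc.hermitian X (hS (Finset.mem_filter.1 hX).1)).eq
  have hct : 1 / 2 ≤ Real.cos (b * t) :=
    cos_pos_of_le_one (hbs t ⟨ht, le_rfl⟩).1 (hbs t ⟨ht, le_rfl⟩).2
  have hct0 : 0 < Real.cos (b * t) := by linarith
  -- the growth of `e^{-tK} e^{tH}` and of `e^{tK} e^{-tH}`
  have growth : ∀ {t₁ : Finset (Fin 𝔫) → Matrix (Fin 𝔫 → Fin d) (Fin 𝔫 → Fin d) ℂ},
      IsLocalHamiltonian Λ k g h t₁ → ∀ φ : (Fin 𝔫 → Fin d) → ℂ,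
      nsq ((NormedSpace.exp (t • -∑ X ∈ S', t₁ X) * NormedSpace.exp (t • ∑ X ∈ S, t₁ X)) *ᵥ φ) ≤
        (1 + Real.sin (b * t)) / Real.cos (b * t) * nsq φ := by
    intro t₁ hloc₁ φ
    set H₁ := ∑ X ∈ S, t₁ X with hH₁
    set K₁ := ∑ X ∈ S', t₁ X with hK₁
    have hdiff : H₁ - K₁ = ∑ X ∈ N, t₁ X := by
      rw [hH₁, ← Finset.sum_filter_add_sum_filter_not S (fun X => Disjoint X Y), ← hS', ← hN,
        ← hK₁]
      abel
    have key := le_sec_add_tan_mul hb0 ht hbt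
      (fun s _ => hasDerivAt_nsq_exp_mul_exp H₁ K₁ φ s) ?_
    · simpa [NormedSpace.exp_zero] using key
    · intro s hs
      have hcs : 0 < Real.cos (b * s) := by
        linarith [cos_pos_of_le_one (hbs s hs).1 (hbs s hs).2]
      set y := (NormedSpace.exp (s • -K₁) * NormedSpace.exp (s • H₁)) *ᵥ φ with hy
      have hterm : ∀ X ∈ N, ‖star y ⬝ᵥ ((NormedSpace.exp (s • -K₁) * t₁ X *
          NormedSpace.exp (s • K₁)) *ᵥ y)‖ ≤ h / Real.cos (b * s) * nsq y := by
        intro X hX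
        have hXS : X ∈ S := (Finset.mem_filter.1 hX).1
        -- The inclusion is strict because the term `X` itself is missing from `S'`: it meets `Y`.
        have hlt : S' ⊂ S := by
          refine Finset.filter_ssubset.2 ⟨X, hXS, (Finset.mem_filter.1 hX).2⟩
        -- The evolution here is generated by `-K₁`, so the induction hypothesis is used for the
        -- negated terms.
        have h1 := ih S' hlt ((Finset.filter_subset _ _).trans hS) hloc₁.neg
          (hloc₁.card_le X (hS hXS)) (hloc₁.actsOn X (hS hXS)) hs.1 (hbs s hs).2 y
        rw [Finset.sum_neg_distrib, neg_neg, ← hK₁] at h1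
        refine h1.trans ?_
        gcongr
        · exact nsq_nonneg y
        · exact hloc₁.norm_le X (hS hXS)
      have hsum := norm_quadForm_sum_le hterm
      rw [← hdiff] at hsum
      have hcard : (N.card : ℝ) ≤ k * g := by
        have h1 : N.card ≤ Y.card * g :=
          (Finset.card_le_card (Finset.filter_subset_filter _ hS)).trans
            (card_not_disjoint_le hloc₁.degree_le Y)
        exact_mod_cast h1.trans (Nat.mul_le_mul_right g hY)
      have hny := nsq_nonneg y
      calc _ ≤ 2 * (N.card * (h / Real.cos (b * s) * nsq y)) := by
            gcongr
            exact (Complex.re_le_norm _).trans hsum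
        _ ≤ 2 * ((k * g) * (h / Real.cos (b * s) * nsq y)) := by
            gcongr
        _ = (2 * h * g * k) / Real.cos (b * s) * nsq y := by ring
        _ ≤ b / Real.cos (b * s) * nsq y := by gcongr
  set G := NormedSpace.exp (t • H) * NormedSpace.exp (t • -K) with hG
  set G' := NormedSpace.exp (t • K) * NormedSpace.exp (t • -H) with hG'
  have hGG : G * G' = 1 := by
    calc G * G' = NormedSpace.exp (t • H) *
          (NormedSpace.exp (t • -K) * NormedSpace.exp (t • K)) * NormedSpace.exp (t • -H) := by
          rw [hG, hG']; simp only [Matrix.mul_assoc]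
      _ = 1 := by
          rw [exp_smul_neg_mul_exp_smul, Matrix.mul_one, exp_smul_mul_exp_smul_neg]
  have hconj : NormedSpace.exp (t • H) * A * NormedSpace.exp (t • -H) = G * A * G' := by
    have hc : NormedSpace.exp (t • -K) * A = A * NormedSpace.exp (t • -K) :=
      ((hKcomm.neg_left.smul_left t).exp_left).eq
    calc _ = NormedSpace.exp (t • H) * A *
          (NormedSpace.exp (t • -K) * NormedSpace.exp (t • K)) * NormedSpace.exp (t • -H) := by
          rw [exp_smul_neg_mul_exp_smul, Matrix.mul_one]
      _ = NormedSpace.exp (t • H) * (A * NormedSpace.exp (t • -K)) * NormedSpace.exp (t • K) *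
          NormedSpace.exp (t • -H) := by simp only [Matrix.mul_assoc]
      _ = _ := by rw [← hc, hG, hG']; simp only [Matrix.mul_assoc]
  have hGadj : Gᴴ = NormedSpace.exp (t • -K) * NormedSpace.exp (t • H) := by
    rw [hG, conjTranspose_mul, conjTranspose_exp_smul hHherm, conjTranspose_exp_smul hKherm.neg]
  have g1 : ∀ φ, nsq (Gᴴ *ᵥ φ) ≤ (1 + Real.sin (b * t)) / Real.cos (b * t) * nsq φ := by
    intro φ
    rw [hGadj]
    exact growth hloc φ
  have g2 : ∀ φ, nsq (G' *ᵥ φ) ≤ (1 + Real.sin (b * t)) / Real.cos (b * t) * nsq φ := by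
    intro φ
    have := growth hloc.neg φ
    rwa [Finset.sum_neg_distrib, Finset.sum_neg_distrib, neg_neg] at this
  have hst := sin_nonneg_of_le_one (hbs t ⟨ht, le_rfl⟩).1 (hbs t ⟨ht, le_rfl⟩).2
  have h3 := nsq_add_nsq_inv_le hGG (by positivity) g1 g2 ψ
  -- Since `(sec + tan)⁻¹ = sec - tan`, the sum is `2 sec`. The combined bound on `G G†` and its
  -- inverse thus returns exactly the secant assumed in the growth estimate, so the induction closes
  -- without loss.
  have hE : (1 + Real.sin (b * t)) / Real.cos (b * t) +
      ((1 + Real.sin (b * t)) / Real.cos (b * t))⁻¹ = 2 / Real.cos (b * t) := by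
    have hsc := Real.sin_sq_add_cos_sq (b * t)
    have hne : 1 + Real.sin (b * t) ≠ 0 := by linarith
    field_simp
    linear_combination hsc
  rw [hE] at h3
  rw [hconj, ← mulVec_mulVec, ← mulVec_mulVec, star_dotProduct_mulVec]
  refine (norm_star_dotProduct_mulVec_le A _ _).trans ?_
  have hamgm : √(nsq (Gᴴ *ᵥ ψ)) * √(nsq (G' *ᵥ ψ)) ≤ 1 / Real.cos (b * t) * nsq ψ := by
    have e1 := Real.sq_sqrt (nsq_nonneg (Gᴴ *ᵥ ψ))
    have e2 := Real.sq_sqrt (nsq_nonneg (G' *ᵥ ψ))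
    have e3 : 2 / Real.cos (b * t) * nsq ψ = 2 * (1 / Real.cos (b * t) * nsq ψ) := by ring
    nlinarith [sq_nonneg (√(nsq (Gᴴ *ᵥ ψ)) - √(nsq (G' *ᵥ ψ)))]
  calc _ ≤ ‖A‖ * (1 / Real.cos (b * t) * nsq ψ) := by gcongr
    _ = _ := by ring

/-- The relative imaginary-time evolution of two local Hamiltonians that differ by `M` terms of
norm at most `v`. -/
theorem nsq_exp_mul_exp_le {Λ : Finset (Finset (Fin 𝔫))} {k g M : ℕ} {h v b : ℝ}
    (hh : 0 ≤ h) (hv : 0 ≤ v) (hb : 2 * h * g * k ≤ b)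
    {t₀ tV : Finset (Fin 𝔫) → Matrix (Fin 𝔫 → Fin d) (Fin 𝔫 → Fin d) ℂ}
    (h₀ : IsLocalHamiltonian Λ k g h t₀) (hV : IsLocalHamiltonian Λ k g v tV)
    (hM : (Λ.filter fun X => tV X ≠ 0).card ≤ M) {t : ℝ} (ht : 0 ≤ t) (hbt : b * t ≤ 1)
    (ψ : (Fin 𝔫 → Fin d) → ℂ) :
    nsq ((NormedSpace.exp (t • ∑ X ∈ Λ, t₀ X) *
      NormedSpace.exp (t • -(∑ X ∈ Λ, t₀ X + ∑ X ∈ Λ, tV X))) *ᵥ ψ) ≤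
      Real.exp (4 * M * v * t) * nsq ψ := by
  have hb0 : 0 ≤ b := le_trans (by positivity) hb
  have hbs : ∀ s ∈ Set.Icc 0 t, 0 ≤ b * s ∧ b * s ≤ 1 := fun s hs =>
    ⟨mul_nonneg hb0 hs.1, (mul_le_mul_of_nonneg_left hs.2 hb0).trans hbt⟩
  set H := ∑ X ∈ Λ, t₀ X with hH
  set V := ∑ X ∈ Λ, tV X with hVdef
  have key := le_exp_mul ht (fun s _ => hasDerivAt_nsq_exp_mul_exp (-(H + V)) (-H) ψ s)
    (c := 4 * M * v) ?_
  · simpa [NormedSpace.exp_zero] using key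
  · intro s hs
    have hcs := cos_pos_of_le_one (hbs s hs).1 (hbs s hs).2
    set y := (NormedSpace.exp (s • - -H) * NormedSpace.exp (s • -(H + V))) *ᵥ ψ with hy
    have hny := nsq_nonneg y
    have hdiff : -(H + V) - -H = ∑ X ∈ Λ with tV X ≠ 0, -tV X := by
      rw [Finset.sum_neg_distrib, Finset.sum_filter_ne_zero, ← hVdef]
      abel
    have hterm : ∀ X ∈ Λ.filter fun X => tV X ≠ 0, ‖star y ⬝ᵥ ((NormedSpace.exp (s • - -H) *
        -tV X * NormedSpace.exp (s • -H)) *ᵥ y)‖ ≤ v * 2 * nsq y := by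
      intro X hX
      have hXΛ := (Finset.mem_filter.1 hX).1
      have h1 := norm_quadForm_evolve_le hh hb Λ Finset.Subset.rfl h₀ (hV.card_le X hXΛ)
        (hV.actsOn X hXΛ).neg hs.1 (hbs s hs).2 y
      rw [← hH] at h1
      rw [neg_neg]
      refine h1.trans ?_
      -- For `b s ≤ 1` the secant is at most `2`. With the factor `2` from differentiating a square,
      -- the `M` terms give the rate `4 M v`.
      have h2 : ‖-tV X‖ / Real.cos (b * s) ≤ v * 2 := by
        rw [norm_neg, div_le_iff₀ (by linarith)]
        have := hV.norm_le X hXΛ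
        nlinarith
      gcongr
    have hsum := norm_quadForm_sum_le hterm
    rw [← hdiff] at hsum
    have hcard : ((Λ.filter fun X => tV X ≠ 0).card : ℝ) ≤ M := by exact_mod_cast hM
    calc _ ≤ 2 * ((Λ.filter fun X => tV X ≠ 0).card * (v * 2 * nsq y)) := by
          gcongr
          exact (Complex.re_le_norm _).trans hsum
      _ ≤ 2 * (M * (v * 2 * nsq y)) := by gcongr
      _ = _ := by ring

end LocalEvolution

/-! ### Exponential moments of the work -/

section Moments

variable {ι : Type} [Fintype ι] [DecidableEq ι] {H₀ H₁ : Matrix ι ι ℂ}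

/-- The exponential moments of the work in the eigenstate `n` of `H₁`. -/
theorem sum_exp_work_eq (h₀ : H₀.IsHermitian) (h₁ : H₁.IsHermitian) (t : ℝ) (n : ι) :
    ∑ m, ‖overlap h₀ h₁ n m‖ ^ 2 * Real.exp (-(2 * t * workValue h₀ h₁ m n)) =
      nsq ((NormedSpace.exp (t • H₀) * NormedSpace.exp (t • -H₁)) *ᵥ
        ((h₁.eigenvectorUnitary : Matrix ι ι ℂ) *ᵥ Pi.single n 1)) := by
  set U₁ := (h₁.eigenvectorUnitary : Matrix ι ι ℂ) with hU₁
  set U₀ := (h₀.eigenvectorUnitary : Matrix ι ι ℂ) with hU₀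
  have u₁ : U₁ᴴ * U₁ = 1 := eigenvectorUnitary_conjTranspose_mul h₁
  have u₀ : U₀ᴴ * U₀ = 1 := eigenvectorUnitary_conjTranspose_mul h₀
  have e₀ : NormedSpace.exp (t • H₀) =
      U₀ * diagonal (fun i => Complex.exp ((t : ℂ) * h₀.eigenvalues i)) * U₀ᴴ := by
    rw [← exp_smul_eq h₀ t]
    rfl
  have e₁ : NormedSpace.exp (t • -H₁) =
      U₁ * diagonal (fun i => Complex.exp ((-t : ℂ) * h₁.eigenvalues i)) * U₁ᴴ := by
    rw [← exp_smul_eq h₁ (-t), smul_neg, neg_smul]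
    rfl
  have e : (NormedSpace.exp (t • H₀) * NormedSpace.exp (t • -H₁)) *ᵥ (U₁ *ᵥ Pi.single n 1) =
      U₀ *ᵥ ((diagonal (fun i => Complex.exp ((t : ℂ) * h₀.eigenvalues i)) * (overlap h₀ h₁)ᴴ *
        diagonal (fun i => Complex.exp ((-t : ℂ) * h₁.eigenvalues i))) *ᵥ Pi.single n 1) := by
    rw [mulVec_mulVec, mulVec_mulVec]
    congr 1
    rw [e₀, e₁, overlap, conjTranspose_mul, conjTranspose_conjTranspose, ← hU₁, ← hU₀]
    simp only [Matrix.mul_assoc]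
    rw [u₁, Matrix.mul_one]
  rw [e, nsq_mulVec_of_unitary u₀, nsq]
  refine Finset.sum_congr rfl fun m _ => ?_
  rw [mulVec_single_one, col_apply, mul_diagonal, diagonal_mul, conjTranspose_apply, norm_mul,
    norm_mul, norm_star, Complex.norm_exp, Complex.norm_exp]
  have r1 : ((t : ℂ) * h₀.eigenvalues m).re = t * h₀.eigenvalues m := by
    rw [← Complex.ofReal_mul, Complex.ofReal_re]
  have r2 : ((-t : ℂ) * h₁.eigenvalues n).re = -t * h₁.eigenvalues n := by
    rw [← Complex.ofReal_neg, ← Complex.ofReal_mul, Complex.ofReal_re]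
  rw [r1, r2, mul_pow, mul_pow, ← Real.exp_nat_mul, ← Real.exp_nat_mul, workValue]
  have : -(2 * t * (h₁.eigenvalues n - h₀.eigenvalues m)) =
      ((2 : ℕ) : ℝ) * (t * h₀.eigenvalues m) + ((2 : ℕ) : ℝ) * (-t * h₁.eigenvalues n) := by
    push_cast; ring
  rw [this, Real.exp_add]
  ring

end Moments

/-! ### Work cutoffs -/

section Cutoffs

variable {ι : Type} [Fintype ι] [DecidableEq ι] {H₀ H₁ : Matrix ι ι ℂ}

theorem exp_freeEnergyDiff [Nonempty ι] (β : ℝ) (h₀ : H₀.IsHermitian) (h₁ : H₁.IsHermitian)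
    (w : ℝ) : Real.exp (-β * (w - freeEnergyDiff β H₀ H₁)) =
      Real.exp (-β * w) * (partitionFn β H₀ / partitionFn β H₁) := by
  have z₀ := partitionFn_pos β h₀
  have z₁ := partitionFn_pos β h₁
  rcases eq_or_ne β 0 with rfl | hβ
  · have e : ∀ {H : Matrix ι ι ℂ}, H.IsHermitian → partitionFn 0 H = Fintype.card ι := by
      intro H h
      simp [partitionFn_eq 0 h]
    have hc : (Fintype.card ι : ℝ) ≠ 0 := by exact_mod_cast Fintype.card_ne_zero
    simp [e h₀, e h₁]
  · have e : -β * (w - freeEnergyDiff β H₀ H₁) =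
        -β * w + Real.log (partitionFn β H₀ / partitionFn β H₁) := by
      rw [freeEnergyDiff, Real.log_div z₀.ne' z₁.ne', Real.log_div z₁.ne' z₀.ne']
      field_simp
      ring
    rw [e, Real.exp_add, Real.exp_log (div_pos z₀ z₁)]

theorem sum_boltzmann_weights [Nonempty ι] (β : ℝ) (h₁ : H₁.IsHermitian) :
    ∑ n, Real.exp (-β * h₁.eigenvalues n) / partitionFn β H₁ = 1 := by
  rw [← Finset.sum_div, ← partitionFn_eq β h₁, div_self (partitionFn_pos β h₁).ne']

/-- The factor `e^{-β(w - ΔA)}` turns the thermal weights of `H₀` into those of `H₁`, as in the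
Jarzynski and Crooks relations. The cutoff condition thus bounds the probability of small work
values when `H₁` starts in equilibrium. -/
theorem cutoff_sum_eq [Nonempty ι] (β wl : ℝ) (h₀ : H₀.IsHermitian) (h₁ : H₁.IsHermitian) :
    ∑ w ∈ workValues h₀ h₁ with w < wl,
      workProb β h₀ h₁ 1 w * Real.exp (-β * (w - freeEnergyDiff β H₀ H₁)) =
    ∑ n, Real.exp (-β * h₁.eigenvalues n) / partitionFn β H₁ *
      ∑ m, if workValue h₀ h₁ m n < wl then ‖overlap h₀ h₁ n m‖ ^ 2 else 0 := by
  classical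
  have z₀ := partitionFn_pos β h₀
  have z₁ := partitionFn_pos β h₁
  simp only [workProb, Finset.sum_mul]
  rw [Finset.sum_comm]
  conv_lhs =>
    enter [2, m]
    rw [Finset.sum_comm]
  rw [Finset.sum_comm]
  refine Finset.sum_congr rfl fun n _ => ?_
  rw [Finset.mul_sum]
  refine Finset.sum_congr rfl fun m _ => ?_
  simp only [ite_mul, zero_mul]
  rw [Finset.sum_ite_eq]
  have hmem : workValue h₀ h₁ m n ∈ (workValues h₀ h₁).filter (fun w => w < wl) ↔
      workValue h₀ h₁ m n < wl := by
    rw [Finset.mem_filter, and_iff_right_iff_imp]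
    intro _
    exact Finset.mem_image.2 ⟨(m, n), Finset.mem_univ _, rfl⟩
  simp only [hmem, mul_ite, mul_zero]
  split_ifs
  · rw [exp_freeEnergyDiff β h₀ h₁, jointProb, transitionAmp_one, workValue]
    have e : -β * h₁.eigenvalues n =
        -β * h₀.eigenvalues m + -β * (h₁.eigenvalues n - h₀.eigenvalues m) := by ring
    rw [e, Real.exp_add]
    field_simp
  · rfl

/-- A bound for every eigenstate of `H₁` survives averaging with the thermal weights. The remaining
condition does not involve `β`. -/
theorem isWorkCutoff_of_forall [Nonempty ι] {β ε w : ℝ} {h₀ : H₀.IsHermitian}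
    {h₁ : H₁.IsHermitian}
    (h : ∀ n, (∑ m, if workValue h₀ h₁ m n < w then ‖overlap h₀ h₁ n m‖ ^ 2 else 0) ≤
      (ε / 6) ^ 2) :
    IsWorkCutoff β ε h₀ h₁ 1 w := by
  rw [IsWorkCutoff, cutoff_sum_eq]
  have z₁ := partitionFn_pos β h₁
  calc _ ≤ ∑ n, Real.exp (-β * h₁.eigenvalues n) / partitionFn β H₁ * (ε / 6) ^ 2 := by
        gcongr with n
        exact h n
    _ = _ := by rw [← Finset.sum_mul, sum_boltzmann_weights, one_mul]

/-- A work cutoff does not exceed all work values. -/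
theorem IsWorkCutoff.le_of_forall_le [Nonempty ι] {β ε wl wmax : ℝ} {h₀ : H₀.IsHermitian}
    {h₁ : H₁.IsHermitian} (hε : 0 < ε) (hε1 : ε ≤ 1) (h : IsWorkCutoff β ε h₀ h₁ 1 wl)
    (hmax : ∀ m n, workValue h₀ h₁ m n ≤ wmax) : wl ≤ wmax := by
  by_contra hlt
  rw [not_le] at hlt
  rw [IsWorkCutoff, cutoff_sum_eq] at h
  have e : ∀ n, (∑ m, if workValue h₀ h₁ m n < wl then ‖overlap h₀ h₁ n m‖ ^ 2 else 0) = 1 := by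
    intro n
    rw [← sum_norm_sq_row (overlap_mul_conjTranspose h₀ h₁) n]
    exact Finset.sum_congr rfl fun m _ => if_pos ((hmax m n).trans_lt hlt)
  simp only [e, mul_one, sum_boltzmann_weights] at h
  nlinarith

variable {V : Matrix ι ι ℂ}

theorem nsq_single (i : ι) : nsq (Pi.single i 1 : ι → ℂ) = 1 := by
  rw [nsq, Finset.sum_eq_single i] <;> simp +contextual

/-- This is Chebyshev's inequality. Since `⟨φ₁ₙ|V|φ₀ₘ⟩ = wₘₙ ⟨φ₁ₙ|φ₀ₘ⟩`, the second moment of the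
work in the eigenstate `n` is `‖V φ₁ₙ‖² ≤ ‖V‖²`. -/
theorem isWorkCutoff_general [Nonempty ι] (h₀ : H₀.IsHermitian) (hV : V.IsHermitian) (β : ℝ)
    {ε : ℝ} (hε : 0 < ε) :
    IsWorkCutoff β ε h₀ (h₀.add hV) 1 (-(6 * ‖V‖ / ε)) := by
  set h₁ := h₀.add hV
  refine isWorkCutoff_of_forall fun n => ?_
  have hmom : ∑ m, workValue h₀ h₁ m n ^ 2 * ‖overlap h₀ h₁ n m‖ ^ 2 ≤ ‖V‖ ^ 2 := by
    set B := (h₁.eigenvectorUnitary : Matrix ι ι ℂ)ᴴ * V *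
      (h₀.eigenvectorUnitary : Matrix ι ι ℂ) with hB
    have hw : ∀ m, B n m = workValue h₀ h₁ m n * overlap h₀ h₁ n m := by
      intro m
      have := work_mul_apply h₀ h₁ 1 n m
      rw [Matrix.mul_one, Matrix.one_mul, add_sub_cancel_left, Matrix.mul_one] at this
      exact this
    have hs : ∑ m, workValue h₀ h₁ m n ^ 2 * ‖overlap h₀ h₁ n m‖ ^ 2 =
        nsq (Bᴴ *ᵥ Pi.single n 1) := by
      refine Finset.sum_congr rfl fun m _ => ?_
      rw [mulVec_single_one, col_apply, conjTranspose_apply, norm_star, hw, norm_mul, mul_pow,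
        Complex.norm_real, Real.norm_eq_abs, sq_abs]
    have hBV : Bᴴ *ᵥ Pi.single n 1 = (h₀.eigenvectorUnitary : Matrix ι ι ℂ)ᴴ *ᵥ (V *ᵥ
        ((h₁.eigenvectorUnitary : Matrix ι ι ℂ) *ᵥ Pi.single n 1)) := by
      rw [hB, conjTranspose_mul, conjTranspose_mul, conjTranspose_conjTranspose, hV.eq,
        mulVec_mulVec, mulVec_mulVec, Matrix.mul_assoc]
    have h2 := sqrt_nsq_mulVec_le V ((h₁.eigenvectorUnitary : Matrix ι ι ℂ) *ᵥ Pi.single n 1)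
    rw [nsq_mulVec_of_unitary (eigenvectorUnitary_conjTranspose_mul h₁), nsq_single, Real.sqrt_one,
      mul_one, Real.sqrt_le_left (norm_nonneg V)] at h2
    rw [hs, hBV, nsq_mulVec_of_unitary]
    · exact h2
    · rw [conjTranspose_conjTranspose, eigenvectorUnitary_mul_conjTranspose]
  have hterm : ∀ m, (if workValue h₀ h₁ m n < -(6 * ‖V‖ / ε) then ‖overlap h₀ h₁ n m‖ ^ 2 else 0) *
      ‖V‖ ^ 2 ≤ (ε / 6) ^ 2 * (workValue h₀ h₁ m n ^ 2 * ‖overlap h₀ h₁ n m‖ ^ 2) := by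
    intro m
    split_ifs with h
    · have h1 : 6 * ‖V‖ / ε ≤ -workValue h₀ h₁ m n := by linarith
      rw [div_le_iff₀ hε] at h1
      have h2 : ‖V‖ ^ 2 ≤ (ε / 6) ^ 2 * workValue h₀ h₁ m n ^ 2 := by
        have := norm_nonneg V
        rw [← mul_pow, ← sq_abs (ε / 6 * _)]
        apply pow_le_pow_left₀ this
        refine le_trans ?_ (neg_le_abs _)
        linarith
      nlinarith [sq_nonneg ‖overlap h₀ h₁ n m‖]
    · rw [zero_mul]
      positivity
  -- For `V = 0` the division by `‖V‖²` is impossible, but the second moment vanishes and with it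
  -- every overlap at a nonzero work value.
  rcases (norm_nonneg V).eq_or_lt' with h0 | hpos
  · have hz : ∀ m, (if workValue h₀ h₁ m n < -(6 * ‖V‖ / ε) then ‖overlap h₀ h₁ n m‖ ^ 2
        else 0) = 0 := by
      intro m
      split_ifs with h
      · rw [h0] at h hmom
        have h1 := Finset.single_le_sum
          (f := fun m => workValue h₀ h₁ m n ^ 2 * ‖overlap h₀ h₁ n m‖ ^ 2)
          (fun m _ => by positivity) (Finset.mem_univ m)
        have h2 : 0 < workValue h₀ h₁ m n ^ 2 := by
          have : workValue h₀ h₁ m n ≠ 0 := by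
            intro h'; rw [h'] at h; simp at h
          positivity
        have h3 : workValue h₀ h₁ m n ^ 2 * ‖overlap h₀ h₁ n m‖ ^ 2 ≤ 0 ^ 2 := h1.trans hmom
        nlinarith [sq_nonneg ‖overlap h₀ h₁ n m‖]
      · rfl
    simp only [hz, Finset.sum_const_zero]
    positivity
  · have h1 := Finset.sum_le_sum fun m (_ : m ∈ Finset.univ) => hterm m
    rw [← Finset.sum_mul, ← Finset.mul_sum] at h1
    have h2 : 0 < ‖V‖ ^ 2 := by positivity
    refine le_of_mul_le_mul_right (h1.trans ?_) h2
    gcongr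

/-- When `V` commutes with `H₁`, the identity `⟨φ₁ₙ|V|φ₀ₘ⟩ = w ⟨φ₁ₙ|φ₀ₘ⟩` iterates to all powers of
`V`. -/
theorem norm_overlap_mul_work_pow_le (h₀ : H₀.IsHermitian) (hV : V.IsHermitian)
    (hc : Commute H₀ (H₀ + V)) (m n : ι) (p : ℕ) :
    |workValue h₀ (h₀.add hV) m n| ^ p * ‖overlap h₀ (h₀.add hV) n m‖ ≤ ‖V‖ ^ p := by
  set h₁ := h₀.add hV
  have hVc : Commute V (H₀ + V) := by
    have := (Commute.refl (H₀ + V)).sub_left hc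
    rwa [add_sub_cancel_left] at this
  have key : ∀ p : ℕ, ((h₁.eigenvectorUnitary : Matrix ι ι ℂ)ᴴ * V ^ p *
      (h₀.eigenvectorUnitary : Matrix ι ι ℂ)) n m =
      (workValue h₀ h₁ m n : ℂ) ^ p * overlap h₀ h₁ n m := by
    intro p
    induction p with
    | zero => rw [pow_zero, pow_zero, Matrix.mul_one, one_mul, overlap]
    | succ p ih =>
      have h1 := work_mul_apply h₀ h₁ (V ^ p) n m
      have h2 : (H₀ + V) * V ^ p - V ^ p * H₀ = V ^ (p + 1) := by
        rw [← (hVc.pow_left p).eq, ← Matrix.mul_sub, add_sub_cancel_left, pow_succ]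
      rw [h2, ih] at h1
      rw [h1, pow_succ']
      ring
  have hentry : ((h₁.eigenvectorUnitary : Matrix ι ι ℂ)ᴴ * V ^ p *
      (h₀.eigenvectorUnitary : Matrix ι ι ℂ)) n m =
      star ((h₁.eigenvectorUnitary : Matrix ι ι ℂ) *ᵥ Pi.single n 1) ⬝ᵥ
        (V ^ p *ᵥ ((h₀.eigenvectorUnitary : Matrix ι ι ℂ) *ᵥ Pi.single m 1)) := by
    have h1 := star_dotProduct_mulVec (Pi.single n 1)
      (V ^ p *ᵥ ((h₀.eigenvectorUnitary : Matrix ι ι ℂ) *ᵥ Pi.single m 1))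
      (h₁.eigenvectorUnitary : Matrix ι ι ℂ)ᴴ
    rw [conjTranspose_conjTranspose] at h1
    rw [← h1, mulVec_mulVec, mulVec_mulVec, ← Pi.single_star, star_one,
      single_one_dotProduct, mulVec_single_one, col_apply, Matrix.mul_assoc]
  have h2 := norm_star_dotProduct_mulVec_le (V ^ p)
    ((h₁.eigenvectorUnitary : Matrix ι ι ℂ) *ᵥ Pi.single n 1)
    ((h₀.eigenvectorUnitary : Matrix ι ι ℂ) *ᵥ Pi.single m 1)
  rw [← hentry, key, nsq_mulVec_of_unitary (eigenvectorUnitary_conjTranspose_mul h₁),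
    nsq_mulVec_of_unitary (eigenvectorUnitary_conjTranspose_mul h₀), nsq_single, nsq_single,
    Real.sqrt_one,
    mul_one, mul_one, norm_mul, norm_pow, Complex.norm_real, Real.norm_eq_abs] at h2
  refine h2.trans ?_
  have : Nonempty ι := ⟨n⟩
  rcases p.eq_zero_or_pos with rfl | hp
  · rw [pow_zero, pow_zero]
    exact (CStarRing.norm_one (E := Matrix ι ι ℂ)).le
  · exact norm_pow_le' V hp

/-- Letting the power tend to infinity shows that overlaps vanish for `|w| > ‖V‖`. The argument
works for the given eigenbases, which need not coincide when eigenvalues are degenerate. -/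
theorem isWorkCutoff_commuting [Nonempty ι] (h₀ : H₀.IsHermitian) (hV : V.IsHermitian) (β ε : ℝ)
    (hc : Commute H₀ (H₀ + V)) :
    IsWorkCutoff β ε h₀ (h₀.add hV) 1 (-‖V‖) := by
  refine isWorkCutoff_of_forall fun n => ?_
  refine (Finset.sum_nonpos fun m _ => ?_).trans (sq_nonneg _)
  split_ifs with h
  swap
  · exact le_rfl
  have hp := norm_overlap_mul_work_pow_le h₀ hV hc m n
  set x := ‖overlap h₀ (h₀.add hV) n m‖
  set w := |workValue h₀ (h₀.add hV) m n| with hw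
  have hlt : ‖V‖ < w := by
    rw [hw]
    exact lt_of_lt_of_le (by linarith) (neg_le_abs _)
  have hx : x = 0 := by
    by_contra hne
    have hx0 : 0 < x := lt_of_le_of_ne (norm_nonneg _) (Ne.symm hne)
    rcases (norm_nonneg V).eq_or_lt' with h0 | hpos
    · have := hp 1
      rw [h0, pow_one, pow_one] at this
      have : 0 < w * x := mul_pos (by linarith [norm_nonneg V]) hx0
      linarith
    · obtain ⟨p, hp'⟩ := pow_unbounded_of_one_lt (1 / x) ((one_lt_div hpos).2 hlt)
      rw [div_pow, div_lt_div_iff₀ hx0 (by positivity)] at hp'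
      have := hp p
      linarith
  rw [hx]
  simp

/-- This is a Chernoff bound: with `b = 2hgk`, the moments `E[e^{-2tw}] ≤ e^{4Mvt}` are available
for `b t ≤ 1`. -/
theorem isWorkCutoff_local {𝔫 d : ℕ} (hd : 0 < d) {Λ : Finset (Finset (Fin 𝔫))} {k g M : ℕ}
    {h v ε : ℝ} (β : ℝ) {t₀ tV : Finset (Fin 𝔫) → Matrix (Fin 𝔫 → Fin d) (Fin 𝔫 → Fin d) ℂ}
    {H₀ V : Matrix (Fin 𝔫 → Fin d) (Fin 𝔫 → Fin d) ℂ}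
    (h₀ : H₀.IsHermitian) (hV : V.IsHermitian) (hε : 0 < ε) (hh : 0 ≤ h) (hv : 0 ≤ v)
    (hH₀ : H₀ = ∑ X ∈ Λ, t₀ X) (hVs : V = ∑ X ∈ Λ, tV X)
    (hl₀ : IsLocalHamiltonian Λ k g h t₀) (hlV : IsLocalHamiltonian Λ k g v tV)
    (hM : (Λ.filter fun X => tV X ≠ 0).card ≤ M) :
    IsWorkCutoff β ε h₀ (h₀.add hV) 1 (-(2 * M * v) - 2 * h * g * k * Real.log (6 / ε)) := by
  have : Nonempty (Fin d) := ⟨⟨0, hd⟩⟩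
  set h₁ := h₀.add hV
  set b : ℝ := 2 * h * g * k with hb
  have hb0 : 0 ≤ b := by positivity
  refine isWorkCutoff_of_forall fun n => ?_
  have moment : ∀ t : ℝ, 0 ≤ t → b * t ≤ 1 →
      ∑ m, ‖overlap h₀ h₁ n m‖ ^ 2 * Real.exp (-(2 * t * workValue h₀ h₁ m n)) ≤
        Real.exp (4 * M * v * t) := by
    intro t ht hbt
    rw [sum_exp_work_eq]
    have h1 := nsq_exp_mul_exp_le hh hv hb.symm.le hl₀ hlV hM ht hbt
      ((h₁.eigenvectorUnitary : Matrix (Fin 𝔫 → Fin d) (Fin 𝔫 → Fin d) ℂ) *ᵥ Pi.single n 1)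
    rw [← hH₀, ← hVs, nsq_mulVec_of_unitary (eigenvectorUnitary_conjTranspose_mul h₁)] at h1
    rwa [nsq_single, mul_one] at h1
  rcases hb0.eq_or_lt' with hbz | hbpos
  · refine (Finset.sum_nonpos fun m _ => ?_).trans (sq_nonneg _)
    rw [hbz, zero_mul, sub_zero]
    split_ifs with hw
    swap
    · exact le_rfl
    set a := -(2 * M * v) - workValue h₀ h₁ m n with ha
    have ha0 : 0 < a := by linarith
    set x := ‖overlap h₀ h₁ n m‖ ^ 2 with hx
    have hx0 : 0 ≤ x := by positivity
    have hle : ∀ t : ℝ, 0 ≤ t → x * Real.exp (2 * t * a) ≤ 1 := by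
      intro t ht
      have h1 := moment t ht (by rw [hbz]; linarith)
      have h2 := Finset.single_le_sum
        (f := fun m => ‖overlap h₀ h₁ n m‖ ^ 2 * Real.exp (-(2 * t * workValue h₀ h₁ m n)))
        (fun m _ => by positivity) (Finset.mem_univ m)
      have h3 := h2.trans h1
      simp only [← hx] at h3
      have e : -(2 * t * workValue h₀ h₁ m n) = 2 * t * a + 4 * M * v * t := by
        rw [ha]; ring
      rw [e, Real.exp_add, ← mul_assoc] at h3
      exact le_of_mul_le_mul_right (by rwa [one_mul]) (Real.exp_pos _)
    by_contra hpos
    rw [not_le] at hpos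
    -- For `b = 0` all `t ≥ 0` are allowed. This choice gives `x e^{1/x} ≤ 1`, which contradicts `x
    -- (1 + 1/x) = 1 + x > 1`.
    have h4 := hle (1 / (2 * a * x)) (by positivity)
    have e : 2 * (1 / (2 * a * x)) * a = 1 / x := by field_simp
    rw [e] at h4
    have h5 := Real.add_one_le_exp (1 / x)
    have h6 : x * (1 / x) = 1 := mul_one_div_cancel hpos.ne'
    nlinarith
  -- At the largest admissible time `t = 1/b` the logarithmic part of the cutoff produces exactly
  -- the factor `(ε/6)²`, and `2Mv` cancels the growth of the moment.
  · have h1 := moment (1 / b) (by positivity) (by rw [mul_one_div_cancel hbpos.ne'])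
    have hterm : ∀ m, (if workValue h₀ h₁ m n < -(2 * M * v) - b * Real.log (6 / ε) then
        ‖overlap h₀ h₁ n m‖ ^ 2 else 0) * Real.exp (4 * M * v * (1 / b) + 2 * Real.log (6 / ε)) ≤
        ‖overlap h₀ h₁ n m‖ ^ 2 * Real.exp (-(2 * (1 / b) * workValue h₀ h₁ m n)) := by
      intro m
      split_ifs with hw
      · gcongr
        have h2 : 0 ≤ (2 / b) * (-(2 * M * v) - b * Real.log (6 / ε) - workValue h₀ h₁ m n) :=
          mul_nonneg (by positivity) (by linarith)
        have e : (2 / b) * (-(2 * M * v) - b * Real.log (6 / ε) - workValue h₀ h₁ m n) =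
            -(2 * (1 / b) * workValue h₀ h₁ m n) -
              (4 * M * v * (1 / b) + 2 * Real.log (6 / ε)) := by
          field_simp
          ring
        linarith
      · rw [zero_mul]
        positivity
    have h2 := (Finset.sum_le_sum fun m (_ : m ∈ Finset.univ) => hterm m).trans h1
    rw [← Finset.sum_mul, Real.exp_add] at h2
    have h3 : Real.exp (2 * Real.log (6 / ε)) = ((ε / 6) ^ 2)⁻¹ := by
      rw [show (2 : ℝ) = ((2 : ℕ) : ℝ) by norm_num, Real.exp_nat_mul,
        Real.exp_log (by positivity), ← inv_pow, inv_div]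
    rw [h3] at h2
    have h4 := Real.exp_pos (4 * M * v * (1 / b))
    have h5 : 0 < (ε / 6) ^ 2 := by positivity
    refine le_of_mul_le_mul_right ?_ (mul_pos h4 (inv_pos.2 h5))
    refine h2.trans (le_of_eq ?_)
    field_simp

end Cutoffs

/-! ### The trace norm -/

section TraceNorm

variable {ι : Type} [Fintype ι] [DecidableEq ι]

theorem norm_le_one_of_conjTranspose_mul {U : Matrix ι ι ℂ} (hU : Uᴴ * U = 1) : ‖U‖ ≤ 1 := by
  have h := l2_opNorm_conjTranspose_mul_self U
  rw [hU] at h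
  rcases isEmpty_or_nonempty ι with hι | hι
  · rw [Subsingleton.elim U 0, norm_zero]
    exact zero_le_one
  · rw [CStarRing.norm_one] at h
    nlinarith [norm_nonneg U]

-- `W` is the adjoint of the partial isometry in the polar decomposition of `A`, namely `|A|⁻¹ A†`
-- with the pseudoinverse of `|A|`. It reduces trace norm bounds to bounds on traces.
open scoped ComplexOrder in
theorem exists_traceNorm_eq (A : Matrix ι ι ℂ) :
    ∃ W : Matrix ι ι ℂ, ‖W‖ ≤ 1 ∧ (W * A).trace = (traceNorm A : ℂ) := by
  set h := isHermitian_conjTranspose_mul_self A with hh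
  set T := (h.eigenvectorUnitary : Matrix ι ι ℂ) with hT
  set μ := h.eigenvalues with hμ
  have hμ0 : ∀ i, 0 ≤ μ i := (posSemidef_conjTranspose_mul_self A).eigenvalues_nonneg
  have hTT : Tᴴ * T = 1 := eigenvectorUnitary_conjTranspose_mul h
  -- The convention `0⁻¹ = 0` makes this the pseudoinverse on the kernel of `A`.
  set D : Matrix ι ι ℂ := diagonal fun i => (((√(μ i))⁻¹ : ℝ) : ℂ) with hD
  have hAA : Aᴴ * A = T * diagonal (fun i => (μ i : ℂ)) * Tᴴ := eq_conj_diagonal h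
  have hDH : Dᴴ = D := by
    rw [hD, diagonal_conjTranspose]
    congr 1
    ext i
    simp
  have hsq : ∀ i, (√(μ i))⁻¹ * μ i = √(μ i) := by
    intro i
    rcases (hμ0 i).eq_or_lt' with h0 | hpos
    · rw [h0]; simp
    · have : √(μ i) ≠ 0 := (Real.sqrt_pos.2 hpos).ne'
      rw [inv_mul_eq_div, div_eq_iff this, Real.mul_self_sqrt (hμ0 i)]
  refine ⟨T * D * Tᴴ * Aᴴ, ?_, ?_⟩
  · have hW : (T * D * Tᴴ * Aᴴ) * (T * D * Tᴴ * Aᴴ)ᴴ =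
        T * diagonal (fun i => (((√(μ i) * (√(μ i))⁻¹ : ℝ)) : ℂ)) * Tᴴ := by
      calc _ = T * D * Tᴴ * (Aᴴ * A) * (T * D * Tᴴ) := by
            simp only [conjTranspose_mul, conjTranspose_conjTranspose, hDH, Matrix.mul_assoc]
        _ = T * D * (Tᴴ * T) * diagonal (fun i => (μ i : ℂ)) * (Tᴴ * T) * D * Tᴴ := by
            rw [hAA]; simp only [Matrix.mul_assoc]
        _ = T * (D * diagonal (fun i => (μ i : ℂ)) * D) * Tᴴ := by
            rw [hTT]; simp only [Matrix.mul_one, Matrix.mul_assoc]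
        _ = _ := by
            rw [hD, diagonal_mul_diagonal, diagonal_mul_diagonal]
            congr 3
            ext i
            rw [← Complex.ofReal_mul, ← Complex.ofReal_mul, hsq]
    have hn := l2_opNorm_conjTranspose_mul_self (T * D * Tᴴ * Aᴴ)ᴴ
    rw [conjTranspose_conjTranspose, hW, l2_opNorm_conjTranspose] at hn
    have hT1 := norm_le_one_of_conjTranspose_mul hTT
    have hd : ‖(diagonal (fun i => (((√(μ i) * (√(μ i))⁻¹ : ℝ)) : ℂ)) : Matrix ι ι ℂ)‖ ≤ 1 := by
      rw [l2_opNorm_diagonal, pi_norm_le_iff_of_nonneg zero_le_one]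
      intro i
      rw [Complex.norm_real, Real.norm_eq_abs, abs_of_nonneg (by positivity)]
      exact mul_inv_le_one
    have h1 : ‖T * diagonal (fun i => (((√(μ i) * (√(μ i))⁻¹ : ℝ)) : ℂ)) * Tᴴ‖ ≤ 1 := by
      refine (l2_opNorm_mul _ _).trans ?_
      rw [l2_opNorm_conjTranspose]
      refine mul_le_one₀ ((l2_opNorm_mul _ _).trans (mul_le_one₀ hT1 (norm_nonneg _) hd))
        (norm_nonneg _) hT1
    rw [hn] at h1
    nlinarith [norm_nonneg (T * D * Tᴴ * Aᴴ)]
  · have e : T * D * Tᴴ * Aᴴ * A = T * (D * diagonal fun i => (μ i : ℂ)) * Tᴴ := by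
      calc _ = T * D * Tᴴ * (Aᴴ * A) := by simp only [Matrix.mul_assoc]
        _ = T * D * (Tᴴ * T) * diagonal (fun i => (μ i : ℂ)) * Tᴴ := by
            rw [hAA]; simp only [Matrix.mul_assoc]
        _ = _ := by rw [hTT]; simp only [Matrix.mul_one, Matrix.mul_assoc]
    rw [e, trace_mul_comm, ← Matrix.mul_assoc, hTT, Matrix.one_mul, hD, diagonal_mul_diagonal,
      trace_diagonal, traceNorm, Complex.ofReal_sum]
    refine Finset.sum_congr rfl fun i _ => ?_
    rw [← Complex.ofReal_mul, hsq]

/-- The vector of the entries of a matrix. -/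
def entries (M : Matrix ι ι ℂ) : ι × ι → ℂ := fun x => M x.1 x.2

theorem nsq_entries_mul_le (W M : Matrix ι ι ℂ) (hW : ‖W‖ ≤ 1) :
    nsq (entries (W * M)) ≤ nsq (entries M) := by
  have e : ∀ B : Matrix ι ι ℂ, nsq (entries B) = ∑ t, nsq fun x => B x t := by
    intro B
    simp only [nsq, entries]
    rw [Fintype.sum_prod_type, Finset.sum_comm]
  rw [e, e]
  refine Finset.sum_le_sum fun t _ => ?_
  have h1 : (fun x => (W * M) x t) = W *ᵥ fun x => M x t := rfl
  rw [h1]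
  have h2 := sqrt_nsq_mulVec_le W fun x => M x t
  have h3 := h2.trans (mul_le_of_le_one_left (Real.sqrt_nonneg _) hW)
  exact (Real.sqrt_le_sqrt_iff (nsq_nonneg _)).1 h3

/-- This is the Cauchy–Schwarz inequality for the Hilbert–Schmidt inner product, in which left
multiplication by a contraction does not increase the norm. -/
theorem norm_trace_mul_le (W M N : Matrix ι ι ℂ) (hW : ‖W‖ ≤ 1) :
    ‖(W * (M * Nᴴ)).trace‖ ≤ √(nsq (entries M)) * √(nsq (entries N)) := by
  have e : (W * (M * Nᴴ)).trace = star (entries N) ⬝ᵥ entries (W * M) := by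
    rw [← Matrix.mul_assoc, trace, dotProduct, Fintype.sum_prod_type]
    refine Finset.sum_congr rfl fun x _ => ?_
    rw [diag_apply, Matrix.mul_apply]
    refine Finset.sum_congr rfl fun t _ => ?_
    rw [conjTranspose_apply, mul_comm]
    rfl
  rw [e, mul_comm]
  refine (norm_star_dotProduct_le _ _).trans ?_
  gcongr
  exact nsq_entries_mul_le W M hW

/-- `M` and `N` are the matrices of two purifications. The difference of the reduced states is `(M -
N) M† + N (M - N)†`, and each summand costs one distance of the vectors. -/
theorem traceNorm_sub_le {M N : Matrix ι ι ℂ} (hM : nsq (entries M) = 1)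
    (hN : nsq (entries N) = 1) :
    traceNorm (M * Mᴴ - N * Nᴴ) ≤ 2 * √(nsq (entries M - entries N)) := by
  obtain ⟨W, hW, htr⟩ := exists_traceNorm_eq (M * Mᴴ - N * Nᴴ)
  have e : M * Mᴴ - N * Nᴴ = (M - N) * Mᴴ + N * (M - N)ᴴ := by
    rw [conjTranspose_sub, Matrix.sub_mul, Matrix.mul_sub]
    abel
  have h1 := norm_trace_mul_le W (M - N) M hW
  have h2 := norm_trace_mul_le W N (M - N) hW
  rw [hM, Real.sqrt_one, mul_one] at h1
  rw [hN, Real.sqrt_one, one_mul] at h2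
  have h3 : (traceNorm (M * Mᴴ - N * Nᴴ) : ℂ) =
      (W * ((M - N) * Mᴴ)).trace + (W * (N * (M - N)ᴴ)).trace := by
    rw [← htr, ← trace_add, ← Matrix.mul_add, ← e]
  have h4 : entries M - entries N = entries (M - N) := rfl
  rw [h4]
  calc _ ≤ ‖(traceNorm (M * Mᴴ - N * Nᴴ) : ℂ)‖ := by
        rw [Complex.norm_real]; exact le_abs_self _
    _ ≤ _ := by
        rw [h3]
        refine (norm_add_le _ _).trans ?_
        linarith

end TraceNorm

/-! ### Diagonalization of the work operator -/

section Frame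

variable {ι : Type} [Fintype ι] [DecidableEq ι] {H₀ H₁ : Matrix ι ι ℂ}

theorem exp_smul_conj_diagonal {U : Matrix ι ι ℂ} (hU : Uᴴ * U = 1) (v : ι → ℂ) (c : ℂ) :
    NormedSpace.exp (c • (U * diagonal v * Uᴴ)) =
      U * diagonal (fun i => Complex.exp (c * v i)) * Uᴴ := by
  have e : c • (U * diagonal v * Uᴴ) = U * diagonal (fun i => c * v i) * Uᴴ := by
    rw [← Matrix.smul_mul, ← Matrix.mul_smul, ← diagonal_smul]
    rfl
  rw [e, exp_conj_diagonal hU]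

variable (h₀ : H₀.IsHermitian) (h₁ : H₁.IsHermitian)

/-- The eigenbasis `|φ_{1,n}⟩ |φ_{0,m}^*⟩` of the work operator. -/
def workFrame : Matrix (ι × ι) (ι × ι) ℂ :=
  (h₁.eigenvectorUnitary : Matrix ι ι ℂ) ⊗ₖ (h₀.eigenvectorUnitary : Matrix ι ι ℂ).map star

theorem map_star_mul (A B : Matrix ι ι ℂ) : (A * B).map star = A.map star * B.map star := by
  ext i j
  simp [Matrix.mul_apply]

theorem one_map_star : (1 : Matrix ι ι ℂ).map star = 1 :=
  Matrix.map_one _ (star_zero _) (star_one _)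

theorem conjTranspose_map_star (A : Matrix ι ι ℂ) : (A.map star)ᴴ = Aᴴ.map star := rfl

theorem workFrame_conjTranspose_mul : (workFrame h₀ h₁)ᴴ * workFrame h₀ h₁ = 1 := by
  rw [workFrame, conjTranspose_kronecker, ← mul_kronecker_mul,
    eigenvectorUnitary_conjTranspose_mul, conjTranspose_map_star, ← map_star_mul,
    eigenvectorUnitary_conjTranspose_mul, one_map_star, one_kronecker_one]

theorem workOp_eq : workOp H₀ H₁ = workFrame h₀ h₁ *
    diagonal (fun x => (workValue h₀ h₁ x.2 x.1 : ℂ)) * (workFrame h₀ h₁)ᴴ := by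
  set U₁ := (h₁.eigenvectorUnitary : Matrix ι ι ℂ) with hU₁
  set U₀ := (h₀.eigenvectorUnitary : Matrix ι ι ℂ) with hU₀
  set D₁ : Matrix ι ι ℂ := diagonal fun i => (h₁.eigenvalues i : ℂ) with hD₁
  set D₀ : Matrix ι ι ℂ := diagonal fun i => (h₀.eigenvalues i : ℂ) with hD₀
  have e : (diagonal (fun x : ι × ι => (workValue h₀ h₁ x.2 x.1 : ℂ)) : Matrix _ _ ℂ) =
      D₁ ⊗ₖ (1 : Matrix ι ι ℂ) - (1 : Matrix ι ι ℂ) ⊗ₖ D₀ := by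
    rw [hD₁, hD₀, ← diagonal_one, diagonal_kronecker_diagonal, diagonal_kronecker_diagonal,
      diagonal_sub]
    congr 1
    ext x
    simp [workValue]
  have hD₀s : D₀.map star = D₀ := by
    rw [hD₀, diagonal_map (star_zero _)]
    congr 1
    ext i
    simp
  have a1 : H₁ = U₁ * D₁ * U₁ᴴ := eq_conj_diagonal h₁
  have a0 : H₀.map star = U₀.map star * D₀ * (U₀.map star)ᴴ := by
    conv_lhs => rw [eq_conj_diagonal h₀]
    rw [map_star_mul, map_star_mul, ← hU₀, ← hD₀, hD₀s, conjTranspose_map_star]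
  have b1 : (1 : Matrix ι ι ℂ) = U₁ * 1 * U₁ᴴ := by
    rw [Matrix.mul_one]; exact (eigenvectorUnitary_mul_conjTranspose h₁).symm
  have b0 : (1 : Matrix ι ι ℂ) = U₀.map star * 1 * (U₀.map star)ᴴ := by
    rw [Matrix.mul_one, conjTranspose_map_star, ← map_star_mul,
      eigenvectorUnitary_mul_conjTranspose, one_map_star]
  have c1 : H₁ ⊗ₖ (1 : Matrix ι ι ℂ) = (U₁ ⊗ₖ U₀.map star) * (D₁ ⊗ₖ (1 : Matrix ι ι ℂ)) *
      (U₁ ⊗ₖ U₀.map star)ᴴ := by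
    rw [conjTranspose_kronecker, ← mul_kronecker_mul, ← mul_kronecker_mul, ← a1, ← b0]
  have c0 : (1 : Matrix ι ι ℂ) ⊗ₖ H₀.map star = (U₁ ⊗ₖ U₀.map star) *
      ((1 : Matrix ι ι ℂ) ⊗ₖ D₀) * (U₁ ⊗ₖ U₀.map star)ᴴ := by
    rw [conjTranspose_kronecker, ← mul_kronecker_mul, ← mul_kronecker_mul, ← a0, ← b1]
  rw [workOp, e, c1, c0, workFrame, Matrix.mul_sub, Matrix.sub_mul]

/-- Vectorization: `A ⊗ B^*` acts on the entries of `C` as `C ↦ A C B†`. -/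
theorem workFrame_mulVec_entries (C : Matrix ι ι ℂ) :
    workFrame h₀ h₁ *ᵥ entries C = entries ((h₁.eigenvectorUnitary : Matrix ι ι ℂ) * C *
      (h₀.eigenvectorUnitary : Matrix ι ι ℂ)ᴴ) := by
  ext ⟨x, y⟩
  simp only [workFrame, mulVec, dotProduct, entries, Matrix.mul_apply, kroneckerMap_apply,
    map_apply, conjTranspose_apply, Fintype.sum_prod_type, Finset.sum_mul]
  rw [Finset.sum_comm]
  refine Finset.sum_congr rfl fun m _ => Finset.sum_congr rfl fun n _ => ?_
  ring

/-- The coordinates of the purification of the thermal state of `H₀`. -/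
theorem purification_eq (β : ℝ) :
    purification β h₀ = workFrame h₀ h₁ *ᵥ entries (overlap h₀ h₁ *
      diagonal fun m =>
        (((√(partitionFn β H₀))⁻¹ * Real.exp (-β * h₀.eigenvalues m / 2) : ℝ) : ℂ)) := by
  rw [workFrame_mulVec_entries, overlap]
  have e : ∀ D : Matrix ι ι ℂ, (h₁.eigenvectorUnitary : Matrix ι ι ℂ) *
      ((h₁.eigenvectorUnitary : Matrix ι ι ℂ)ᴴ * (h₀.eigenvectorUnitary : Matrix ι ι ℂ) * D) *
      (h₀.eigenvectorUnitary : Matrix ι ι ℂ)ᴴ = (h₀.eigenvectorUnitary : Matrix ι ι ℂ) * D *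
      (h₀.eigenvectorUnitary : Matrix ι ι ℂ)ᴴ := by
    intro D
    rw [← Matrix.mul_assoc, ← Matrix.mul_assoc, eigenvectorUnitary_mul_conjTranspose,
      Matrix.one_mul]
  rw [e]
  ext ⟨x, y⟩
  simp only [purification, entries, Matrix.mul_apply (M := _ * _), mul_diagonal,
    conjTranspose_apply, Finset.mul_sum]
  refine Finset.sum_congr rfl fun m _ => ?_
  push_cast
  ring

/-- The square root of the thermal state of `H₁`. -/
def sqrtGibbs (β : ℝ) : Matrix ι ι ℂ :=
  (h₁.eigenvectorUnitary : Matrix ι ι ℂ) *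
    diagonal (fun n => (((√(partitionFn β H₁))⁻¹ * Real.exp (-β * h₁.eigenvalues n / 2) : ℝ) : ℂ)) *
      (h₁.eigenvectorUnitary : Matrix ι ι ℂ)ᴴ

/-- In the work frame this target and the purification of the thermal state of `H₀` have the same
overlap matrix, weighted on its rows here and on its columns there. The quotient of the weights
depends only on the work value. -/
theorem entries_sqrtGibbs (β : ℝ) :
    entries (sqrtGibbs h₁ β) = workFrame h₀ h₁ *ᵥ entries ((diagonal fun n =>
      (((√(partitionFn β H₁))⁻¹ * Real.exp (-β * h₁.eigenvalues n / 2) : ℝ) : ℂ)) *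
        overlap h₀ h₁) := by
  rw [workFrame_mulVec_entries, overlap, sqrtGibbs]
  congr 1
  simp only [Matrix.mul_assoc]
  rw [eigenvectorUnitary_mul_conjTranspose, Matrix.mul_one]

theorem sqrtGibbs_mul_conjTranspose [Nonempty ι] (β : ℝ) :
    sqrtGibbs h₁ β * (sqrtGibbs h₁ β)ᴴ = gibbs β H₁ := by
  have z₁ := partitionFn_pos β h₁
  rw [gibbs, boltzmann_eq β h₁, sqrtGibbs]
  set U := (h₁.eigenvectorUnitary : Matrix ι ι ℂ) with hU
  set D : Matrix ι ι ℂ := diagonal fun n =>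
    (((√(partitionFn β H₁))⁻¹ * Real.exp (-β * h₁.eigenvalues n / 2) : ℝ) : ℂ) with hD
  have hDH : Dᴴ = D := by
    rw [hD, diagonal_conjTranspose]
    congr 1
    ext i
    simp only [Pi.star_apply, Complex.star_def, Complex.conj_ofReal]
  have hDD : D * D = ((partitionFn β H₁ : ℂ))⁻¹ •
      diagonal (fun i => (Real.exp (-β * h₁.eigenvalues i) : ℂ)) := by
    rw [hD, diagonal_mul_diagonal, ← diagonal_smul]
    congr 1
    ext i
    rw [Pi.smul_apply, smul_eq_mul, ← Complex.ofReal_mul, ← Complex.ofReal_inv,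
      ← Complex.ofReal_mul]
    congr 1
    have h1 : -β * h₁.eigenvalues i =
      -β * h₁.eigenvalues i / 2 + -β * h₁.eigenvalues i / 2 := by ring
    have h2 : (partitionFn β H₁)⁻¹ = (√(partitionFn β H₁))⁻¹ * (√(partitionFn β H₁))⁻¹ := by
      rw [← mul_inv, Real.mul_self_sqrt z₁.le]
    rw [h2]
    conv_rhs => rw [h1, Real.exp_add]
    ring
  calc _ = U * D * (Uᴴ * U) * Dᴴ * Uᴴ := by
        simp only [conjTranspose_mul, conjTranspose_conjTranspose, Matrix.mul_assoc]
    _ = U * (D * D) * Uᴴ := by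
        rw [hU, eigenvectorUnitary_conjTranspose_mul, hDH, Matrix.mul_one, Matrix.mul_assoc _ D D]
    _ = _ := by rw [hDD, Matrix.mul_smul, Matrix.smul_mul]

theorem nsq_entries_sqrtGibbs [Nonempty ι] (β : ℝ) : nsq (entries (sqrtGibbs h₁ β)) = 1 := by
  have z₁ := partitionFn_pos β h₁
  have hov : overlap h₁ h₁ = 1 := eigenvectorUnitary_conjTranspose_mul h₁
  rw [entries_sqrtGibbs h₁ h₁, nsq_mulVec_of_unitary (workFrame_conjTranspose_mul h₁ h₁), hov,
    Matrix.mul_one, nsq, Fintype.sum_prod_type, ← sum_boltzmann_weights β h₁]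
  refine Finset.sum_congr rfl fun n _ => ?_
  rw [Finset.sum_eq_single n]
  · rw [entries, diagonal_apply_eq, Complex.norm_real, Real.norm_eq_abs, sq_abs, mul_pow, inv_pow,
      Real.sq_sqrt z₁.le, ← Real.exp_nat_mul, mul_comm, div_eq_mul_inv]
    congr 2
    push_cast
    ring
  · intro m _ hm
    rw [entries, diagonal_apply_ne _ hm.symm]
    simp
  · intro h
    exact absurd (Finset.mem_univ _) h

theorem nsq_purification [Nonempty ι] (β : ℝ) : nsq (purification β h₀) = 1 := by
  have hov : overlap h₀ h₀ = 1 := eigenvectorUnitary_conjTranspose_mul h₀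
  have e : purification β h₀ = entries (sqrtGibbs h₀ β) := by
    rw [purification_eq h₀ h₀, entries_sqrtGibbs h₀ h₀, hov, Matrix.mul_one, Matrix.one_mul]
  rw [e, nsq_entries_sqrtGibbs]

end Frame

/-! ### Comparison of partition functions -/

section Peierls

variable {ι : Type} [Fintype ι] [DecidableEq ι] {H₀ V : Matrix ι ι ℂ}

/-- The mean work in the eigenstate `m` of `H₀` is the expectation of `V` in that state. -/
theorem sum_overlap_work_le (h₀ : H₀.IsHermitian) (hV : V.IsHermitian) (m : ι) :
    ∑ n, ‖overlap h₀ (h₀.add hV) n m‖ ^ 2 * workValue h₀ (h₀.add hV) m n ≤ ‖V‖ := by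
  set h₁ := h₀.add hV
  set u := (h₀.eigenvectorUnitary : Matrix ι ι ℂ) *ᵥ Pi.single m 1 with hu
  have hent : ∀ B : Matrix ι ι ℂ, ∀ n, ((h₁.eigenvectorUnitary : Matrix ι ι ℂ)ᴴ * B *
      (h₀.eigenvectorUnitary : Matrix ι ι ℂ)) n m =
      ((h₁.eigenvectorUnitary : Matrix ι ι ℂ)ᴴ *ᵥ (B *ᵥ u)) n := by
    intro B n
    rw [hu, mulVec_mulVec, mulVec_mulVec, mulVec_single_one, col_apply, Matrix.mul_assoc]
  have e : ((∑ n, ‖overlap h₀ h₁ n m‖ ^ 2 * workValue h₀ h₁ m n : ℝ) : ℂ) =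
      star u ⬝ᵥ (V *ᵥ u) := by
    have h2 := star_dotProduct_mulVec u ((h₁.eigenvectorUnitary : Matrix ι ι ℂ)ᴴ *ᵥ (V *ᵥ u))
      (h₁.eigenvectorUnitary : Matrix ι ι ℂ)
    rw [mulVec_mulVec, eigenvectorUnitary_mul_conjTranspose, one_mulVec] at h2
    rw [h2, dotProduct, Complex.ofReal_sum]
    refine Finset.sum_congr rfl fun n _ => ?_
    have h3 := work_mul_apply h₀ h₁ 1 n m
    rw [Matrix.mul_one, Matrix.one_mul, add_sub_cancel_left, hent V] at h3
    have h4 : ((h₁.eigenvectorUnitary : Matrix ι ι ℂ)ᴴ *ᵥ u) n = overlap h₀ h₁ n m := by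
      rw [overlap, hu, mulVec_mulVec, mulVec_single_one, col_apply]
    rw [h3, Pi.star_apply, h4, Matrix.mul_one, ← overlap, Complex.star_def]
    push_cast
    rw [← Complex.conj_mul']
    ring
  have h1 := norm_star_dotProduct_mulVec_le V u u
  rw [← e, Complex.norm_real, hu,
    nsq_mulVec_of_unitary (eigenvectorUnitary_conjTranspose_mul h₀), nsq_single, Real.sqrt_one,
    mul_one, mul_one] at h1
  exact (le_abs_self _).trans h1

/-- The Peierls inequality for the perturbed partition function. -/
theorem partitionFn_le [Nonempty ι] (h₀ : H₀.IsHermitian) (hV : V.IsHermitian) {β : ℝ}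
    (hβ : 0 ≤ β) :
    partitionFn β H₀ ≤ Real.exp (β * ‖V‖) * partitionFn β (H₀ + V) := by
  set h₁ := h₀.add hV
  have e1 : partitionFn β (H₀ + V) = ∑ m, ∑ n, ‖overlap h₀ h₁ n m‖ ^ 2 *
      Real.exp (-β * h₁.eigenvalues n) := by
    rw [partitionFn_eq β h₁, Finset.sum_comm]
    refine Finset.sum_congr rfl fun n _ => ?_
    rw [← Finset.sum_mul, sum_norm_sq_row (overlap_mul_conjTranspose h₀ h₁), one_mul]
  rw [e1, partitionFn_eq β h₀, Finset.mul_sum]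
  refine Finset.sum_le_sum fun m _ => ?_
  have hw1 := sum_norm_sq_col (overlap_conjTranspose_mul h₀ h₁) m
  -- Jensen's inequality with the overlaps as weights bounds the diagonal entry of `e^{-βH₁}` at the
  -- eigenstate `m` of `H₀` from below.
  have hJ := convexOn_exp.map_sum_le (t := Finset.univ)
    (w := fun n => ‖overlap h₀ h₁ n m‖ ^ 2) (p := fun n => -β * h₁.eigenvalues n)
    (fun n _ => by positivity) hw1 (fun n _ => Set.mem_univ _)
  simp only [smul_eq_mul] at hJ
  have hS := sum_overlap_work_le h₀ hV m
  have e2 : ∑ n, ‖overlap h₀ h₁ n m‖ ^ 2 * (-β * h₁.eigenvalues n) =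
      -β * h₀.eigenvalues m - β * ∑ n, ‖overlap h₀ h₁ n m‖ ^ 2 * workValue h₀ h₁ m n := by
    have e3 : ∑ n, ‖overlap h₀ h₁ n m‖ ^ 2 * (-β * h₁.eigenvalues n) =
        ∑ n, (-β * h₀.eigenvalues m * ‖overlap h₀ h₁ n m‖ ^ 2 -
          β * (‖overlap h₀ h₁ n m‖ ^ 2 * workValue h₀ h₁ m n)) := by
      refine Finset.sum_congr rfl fun n _ => ?_
      rw [workValue]
      ring
    rw [e3, Finset.sum_sub_distrib, ← Finset.mul_sum, ← Finset.mul_sum, hw1, mul_one]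
  have h2 : Real.exp (-β * h₀.eigenvalues m) ≤ Real.exp (β * ‖V‖) *
      Real.exp (∑ n, ‖overlap h₀ h₁ n m‖ ^ 2 * (-β * h₁.eigenvalues n)) := by
    rw [← Real.exp_add, e2]
    apply Real.exp_le_exp.2
    have := mul_le_mul_of_nonneg_left hS hβ
    linarith
  exact h2.trans (mul_le_mul_of_nonneg_left hJ (Real.exp_pos _).le)

end Peierls

/-! ### Existence of block encodings -/

section BlockEncoding

variable {μ : Type} [Fintype μ] [DecidableEq μ]

/-- A diagonalizable contraction with a unitary eigenbasis has a unitary dilation. -/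
theorem exists_isBlockEncoding {Q : Matrix μ μ ℂ} (hQ : Qᴴ * Q = 1) (f : μ → ℂ)
    (hf : ∀ i, ‖f i‖ ≤ 1) :
    ∃ S : Matrix (Bool × μ) (Bool × μ) ℂ, IsBlockEncoding true S (Q * diagonal f * Qᴴ) := by
  set s : μ → ℝ := fun i => √(1 - ‖f i‖ ^ 2) with hs
  have hsf : ∀ i, (s i : ℂ) * s i = 1 - star (f i) * f i := by
    intro i
    rw [Complex.star_def, Complex.conj_mul', ← Complex.ofReal_mul, hs,
      Real.mul_self_sqrt (by have := hf i; have := norm_nonneg (f i); nlinarith)]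
    push_cast
    rfl
  -- On each eigenvector this is the Halmos dilation of the scalar `f i`, with off-diagonal entries
  -- `√(1 - |f i|²)`.
  set B : μ → Matrix Bool Bool ℂ := fun i => Matrix.of fun a b =>
    if a then (if b then f i else s i) else (if b then (s i : ℂ) else -star (f i)) with hB
  have hBu : ∀ i, (B i)ᴴ * B i = 1 := by
    intro i
    have h1 := hsf i
    simp only [Complex.star_def] at h1
    ext a b
    cases a <;> cases b <;>
      simp [hB, Matrix.mul_apply, conjTranspose_apply] <;>
      first
        | linear_combination h1
        | ring1
  have hBd : (blockDiagonal B)ᴴ * blockDiagonal B = 1 := by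
    rw [blockDiagonal_conjTranspose, ← blockDiagonal_mul]
    simp only [hBu]
    exact blockDiagonal_one
  set R : Matrix (Bool × μ) (Bool × μ) ℂ := (1 : Matrix Bool Bool ℂ) ⊗ₖ Q with hR
  have hRR : Rᴴ * R = 1 := by
    rw [hR, conjTranspose_kronecker, ← mul_kronecker_mul, hQ, conjTranspose_one, Matrix.mul_one,
      one_kronecker_one]
  have hRR' : R * Rᴴ = 1 := mul_eq_one_comm.1 hRR
  refine ⟨R * blockDiagonal B * Rᴴ, ?_, ?_⟩
  · rw [mem_unitaryGroup_iff', star_eq_conjTranspose]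
    calc _ = R * (blockDiagonal B)ᴴ * (Rᴴ * R) * blockDiagonal B * Rᴴ := by
          simp only [conjTranspose_mul, conjTranspose_conjTranspose, Matrix.mul_assoc]
      _ = R * ((blockDiagonal B)ᴴ * blockDiagonal B) * Rᴴ := by
          rw [hRR, Matrix.mul_one, Matrix.mul_assoc R]
      _ = 1 := by rw [hBd, Matrix.mul_one, hRR']
  · intro x y
    simp only [Matrix.mul_apply, Fintype.sum_prod_type, Fintype.sum_bool, hR, kroneckerMap_apply,
      conjTranspose_apply, blockDiagonal_apply, hB, Matrix.of_apply, one_apply]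
    simp [diagonal_apply]

end BlockEncoding

/-! ### The Fourier approximation on the spectrum of the work operator -/

section FourierSymbol

variable {β ε wl wmax : ℝ}

theorem four_le_fourierWidth (ε : ℝ) : 4 ≤ fourierWidth ε := le_max_left _ _

/-- The logarithm in `Δ` makes the relative Fourier error `(3/2) e^{-Δ²}` at most `ε/4`. -/
theorem exp_neg_fourierWidth_sq_le (hε : 0 < ε) :
    Real.exp (-fourierWidth ε ^ 2) ≤ ε / 6 := by
  have h6 : 0 < 6 / ε := by positivity
  have h1 : Real.log (6 / ε) ≤ fourierWidth ε ^ 2 :=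
    (Real.sqrt_le_iff.1 (le_max_right _ _)).2
  calc _ ≤ Real.exp (-Real.log (6 / ε)) := Real.exp_le_exp.2 (neg_le_neg h1)
    _ = _ := by rw [Real.exp_neg, Real.exp_log h6, inv_div]

theorem two_mul_fourierWidth_sq_le_fourierPeriod (hβ : 0 ≤ β) (hw : wl ≤ wmax) :
    2 * fourierWidth ε ^ 2 ≤ fourierPeriod β ε wl wmax := by
  have := mul_nonneg hβ (sub_nonneg.2 hw)
  rw [fourierPeriod]
  linarith

theorem le_fourierPeriod (hβ : 0 ≤ β) (hw : wl ≤ wmax) : 32 ≤ fourierPeriod β ε wl wmax := by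
  have h1 := two_mul_fourierWidth_sq_le_fourierPeriod (ε := ε) hβ hw
  have h2 := four_le_fourierWidth ε
  nlinarith

/-- This is the source of the factor `e^{√(ln(1/ε))}` in the cost. As `ln 6 ≤ 16`, the square root
of `ln 6 + ln(1/ε)` exceeds that of `ln(1/ε)` by at most `4`. -/
theorem fourierWidth_le (hε : 0 < ε) (hε1 : ε ≤ 1) :
    fourierWidth ε ≤ 4 + √(Real.log (1 / ε)) := by
  have h0 : 0 ≤ Real.log (1 / ε) := Real.log_nonneg (by rw [le_div_iff₀ hε]; linarith)
  have e : Real.log (6 / ε) = Real.log 6 + Real.log (1 / ε) := by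
    rw [← Real.log_mul (by norm_num) (by positivity)]
    congr 1
    ring
  have h6 : Real.log 6 ≤ 16 := (Real.log_le_sub_one_of_pos (by norm_num)).trans (by norm_num)
  refine max_le (by have := Real.sqrt_nonneg (Real.log (1 / ε)); linarith) ?_
  refine Real.sqrt_le_iff.2 ⟨by positivity, ?_⟩
  have h1 := Real.sq_sqrt h0
  have h2 := Real.sqrt_nonneg (Real.log (1 / ε))
  rw [e]
  nlinarith

/-- The powers of `√(2π)` combine with the step to `δ/(2π) = 1/z`. The remaining factors only move
the origin of the series to `wl`. -/
theorem fourierCoeff_eq (β ε wl wmax : ℝ) (j : ℤ) :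
    fourierCoeff β ε wl wmax j = (Real.exp (-β * wl / 2) : ℂ) *
      smoothExpFourier (fourierWidth ε) (fourierPeriod β ε wl wmax)
        (j * (2 * Real.pi / fourierPeriod β ε wl wmax)) *
      Complex.exp (-Complex.I * (((j * fourierStep β ε wl wmax) * β * wl / 2 : ℝ) : ℂ)) := by
  rw [fourierCoeff]
  congr 1
  rw [← fourierStep]
  have hs : fourierStep β ε wl wmax / (2 * Real.pi) = (fourierPeriod β ε wl wmax)⁻¹ := by
    have := Real.pi_ne_zero
    rw [fourierStep]
    field_simp
  generalize fourierStep β ε wl wmax = d at *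
  generalize fourierPeriod β ε wl wmax = z at *
  generalize fourierWidth ε = D
  generalize (j : ℝ) * d = ω
  have hq : (0 : ℝ) < √(2 * Real.pi) := Real.sqrt_pos.2 (by positivity)
  have hqq : √(2 * Real.pi) * √(2 * Real.pi) = 2 * Real.pi := Real.mul_self_sqrt (by positivity)
  set q := √(2 * Real.pi) with hqdef
  have e1 : Complex.exp (1 / 4 + D + Complex.I * ω * (1 / 2 + D) - ω ^ 2 / 4) =
      (Real.exp (-ω ^ 2 / 4) : ℂ) * (Real.exp (-1 / 4) : ℂ) *
        Complex.exp ((1 + Complex.I * ω) * (D + 1 / 2)) := by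
    rw [Complex.ofReal_exp, Complex.ofReal_exp, ← Complex.exp_add, ← Complex.exp_add]
    congr 1
    push_cast
    ring
  have e2 : (z : ℂ)⁻¹ = d / (q * q) := by
    rw [← Complex.ofReal_inv, ← hs, ← hqq]
    push_cast
    rfl
  have hq' : (q : ℂ) ≠ 0 := by exact_mod_cast hq.ne'
  rw [smoothExpFourier, e1, fourierH, fourierF, fourierG, ← hqdef, div_mul_eq_div_div,
    div_eq_mul_inv _ (z : ℂ), e2]
  push_cast
  field_simp

theorem norm_fourierCoeff (β ε wl wmax : ℝ) (j : ℤ) :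
    ‖fourierCoeff β ε wl wmax j‖ = Real.exp (-β * wl / 2) *
      ‖smoothExpFourier (fourierWidth ε) (fourierPeriod β ε wl wmax)
        (j * (2 * Real.pi / fourierPeriod β ε wl wmax))‖ := by
  rw [fourierCoeff_eq, norm_mul, norm_mul, Complex.norm_real, Real.norm_eq_abs, Real.abs_exp,
    neg_mul Complex.I, mul_comm Complex.I, ← neg_mul _ Complex.I, ← Complex.ofReal_neg,
    Complex.norm_exp_ofReal_mul_I, mul_one]

theorem coeffNorm_le (hβ : 0 ≤ β) (hw : wl ≤ wmax) (J : ℕ) :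
    coeffNorm β ε wl wmax J ≤ Real.exp (-β * wl / 2) * (4 * Real.exp (fourierWidth ε)) := by
  rw [coeffNorm]
  simp only [norm_fourierCoeff]
  rw [← Finset.mul_sum]
  exact mul_le_mul_of_nonneg_left (sum_norm_smoothExpFourier_le (le_fourierPeriod hβ hw) J)
    (Real.exp_pos _).le

/-- The value of the Fourier approximation of `e^{-β W / 2}` at the work value `w`. -/
def fourierSymbol (β ε wl wmax : ℝ) (J : ℕ) (w : ℝ) : ℂ :=
  ∑ j ∈ Finset.Icc (-(J : ℤ)) J, fourierCoeff β ε wl wmax j *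
    Complex.exp (Complex.I * ((j * fourierStep β ε wl wmax) * β * w / 2 : ℝ))

theorem norm_fourierSymbol_le (β ε wl wmax : ℝ) (J : ℕ) (w : ℝ) :
    ‖fourierSymbol β ε wl wmax J w‖ ≤ coeffNorm β ε wl wmax J := by
  refine (norm_sum_le _ _).trans (Finset.sum_le_sum fun j _ => ?_)
  rw [norm_mul, mul_comm Complex.I, Complex.norm_exp_ofReal_mul_I, mul_one]

/-- The substitution `x = β (w - wl)/2` reduces this to the series for `e^{-x}`. The period `z` is
chosen so that `w ≤ wmax` becomes `x ≤ z/2 - Δ²`. -/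
theorem norm_fourierSymbol_sub_exp_le (hβ : 0 ≤ β) (hε : 0 < ε) (hw : wl ≤ wmax) {J : ℕ}
    (hJ : IsTruncationOrder β ε wl wmax J) {w : ℝ} (hwmax : w ≤ wmax) :
    ‖fourierSymbol β ε wl wmax J w - (Real.exp (-β * w / 2) : ℂ)‖ ≤
      (ε / 4 + if w < wl then 1 else 0) * Real.exp (-β * w / 2) := by
  set z := fourierPeriod β ε wl wmax with hz
  set D := fourierWidth ε with hD
  set x := β * (w - wl) / 2 with hx
  have hxz : x ≤ z / 2 - D ^ 2 := by
    have := mul_le_mul_of_nonneg_left (sub_le_sub_right hwmax wl) hβ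
    rw [hz, fourierPeriod, ← hD, hx]
    linarith
  have hJ' : z ^ (3 / 2 : ℝ) / 3 ≤ J + 1 := by
    have h := Nat.le_of_ceil_le hJ
    exact_mod_cast h
  have key := norm_fourierSum_sub_exp_le (four_le_fourierWidth ε)
    (two_mul_fourierWidth_sq_le_fourierPeriod hβ hw) hxz hJ'
  have e : fourierSymbol β ε wl wmax J w - (Real.exp (-β * w / 2) : ℂ) =
      (Real.exp (-β * wl / 2) : ℂ) * (∑ n ∈ Finset.Icc (-(J : ℤ)) J,
        smoothExpFourier D z (n * (2 * Real.pi / z)) *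
        Complex.exp (Complex.I * (n * (2 * Real.pi / z) * x : ℝ)) - (Real.exp (-x) : ℂ)) := by
    rw [mul_sub, Finset.mul_sum, ← Complex.ofReal_mul, ← Real.exp_add]
    congr 1
    · refine Finset.sum_congr rfl fun j _ => ?_
      rw [fourierCoeff_eq, ← hz, ← hD, fourierStep, ← hz, mul_assoc, mul_assoc,
        ← Complex.exp_add]
      congr 3
      rw [hx]
      push_cast
      ring
    · congr 2
      rw [hx]
      ring
  rw [e, norm_mul, Complex.norm_real, Real.norm_eq_abs, Real.abs_exp]
  have h1 := exp_neg_fourierWidth_sq_le hε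
  rw [← hD] at h1
  have h2 : (if x < 0 then (1 : ℝ) else 0) ≤ if w < wl then 1 else 0 := by
    split_ifs with ha hb hb
    · exact le_rfl
    · have := mul_nonneg hβ (sub_nonneg.2 (not_lt.1 hb))
      rw [hx] at ha
      linarith
    · exact zero_le_one
    · exact le_rfl
  calc _ ≤ Real.exp (-β * wl / 2) * ((ε / 4 + if w < wl then 1 else 0) * Real.exp (-x)) := by
        refine mul_le_mul_of_nonneg_left (key.trans ?_) (Real.exp_pos _).le
        refine mul_le_mul_of_nonneg_right ?_ (Real.exp_pos _).le
        linarith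
    _ = (ε / 4 + if w < wl then 1 else 0) * (Real.exp (-β * wl / 2) * Real.exp (-x)) := by ring
    _ = _ := by
        rw [← Real.exp_add]
        congr 2
        rw [hx]
        ring

variable {ι : Type} [Fintype ι] [DecidableEq ι] {H₀ H₁ : Matrix ι ι ℂ}

theorem fourierOp_eq (h₀ : H₀.IsHermitian) (h₁ : H₁.IsHermitian) (J : ℕ) :
    fourierOp β ε wl wmax J H₀ H₁ = workFrame h₀ h₁ *
      diagonal (fun x => fourierSymbol β ε wl wmax J (workValue h₀ h₁ x.2 x.1)) *
      (workFrame h₀ h₁)ᴴ := by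
  set c := Complex.I * ((fourierStep β ε wl wmax * β / 2 : ℝ) : ℂ) with hc
  have hU := workFrame_conjTranspose_mul h₀ h₁
  have e : ∀ j : ℤ, evolution β ε wl wmax H₀ H₁ ^ j = workFrame h₀ h₁ *
      diagonal (fun x => Complex.exp (Complex.I *
        ((j * fourierStep β ε wl wmax) * β * workValue h₀ h₁ x.2 x.1 / 2 : ℝ))) *
      (workFrame h₀ h₁)ᴴ := by
    intro j
    rw [evolution, ← hc, ← Matrix.exp_zsmul, ← Int.cast_smul_eq_zsmul ℂ, smul_smul,
      workOp_eq h₀ h₁, exp_smul_conj_diagonal hU]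
    congr 3
    ext x
    congr 1
    rw [hc]
    push_cast
    ring
  have e2 : (diagonal (fun x => fourierSymbol β ε wl wmax J (workValue h₀ h₁ x.2 x.1)) :
      Matrix (ι × ι) (ι × ι) ℂ) = ∑ j ∈ Finset.Icc (-(J : ℤ)) J,
      fourierCoeff β ε wl wmax j • diagonal (fun x : ι × ι => Complex.exp (Complex.I *
        ((j * fourierStep β ε wl wmax) * β * workValue h₀ h₁ x.2 x.1 / 2 : ℝ))) := by
    ext x y
    rw [Matrix.sum_apply]
    by_cases hxy : x = y
    · subst hxy
      simp only [diagonal_apply_eq, Matrix.smul_apply, smul_eq_mul, fourierSymbol]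
    · simp only [diagonal_apply_ne _ hxy, Matrix.smul_apply, smul_zero, Finset.sum_const_zero]
  rw [fourierOp, e2, Matrix.mul_sum, Matrix.sum_mul]
  refine Finset.sum_congr rfl fun j _ => ?_
  rw [e, Matrix.mul_smul, Matrix.smul_mul]

end FourierSymbol

/-! ### The prepared state -/

section Prepared

variable {ι κ : Type} [Fintype ι] [DecidableEq ι] [Fintype κ] [DecidableEq κ]
variable {H₀ H₁ : Matrix ι ι ℂ}

theorem reducedState_one (σ : Matrix (κ × (ι × ι)) (κ × (ι × ι)) ℂ) (x y : ι) :
    reducedState 1 σ x y = ∑ a, ∑ t, σ (a, (x, t)) (a, (y, t)) := by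
  simp only [reducedState, one_map_star, one_kronecker_one, Matrix.one_mul, conjTranspose_one,
    Matrix.mul_one]

theorem continuous_reducedState_one :
    Continuous (reducedState (1 : Matrix ι ι ℂ) :
      Matrix (κ × (ι × ι)) (κ × (ι × ι)) ℂ → Matrix ι ι ℂ) := by
  refine continuous_matrix fun x y => ?_
  simp only [reducedState_one]
  exact continuous_finsetSum _ fun a _ => continuous_finsetSum _ fun t _ =>
    continuous_id.matrix_elem _ _

theorem reducedState_one_smul_pureState (a₀ : κ) (c : ℂ) (M : Matrix ι ι ℂ) :
    reducedState 1 (c • pureState (withAncilla a₀ (entries M))) = c • (M * Mᴴ) := by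
  ext x y
  rw [reducedState_one, Finset.sum_eq_single a₀]
  · simp only [Matrix.smul_apply, pureState, vecMulVec_apply, withAncilla, if_true, entries,
      Pi.star_apply, smul_eq_mul, Matrix.mul_apply, conjTranspose_apply, Finset.mul_sum]
  · intro a _ ha
    simp [pureState, vecMulVec_apply, withAncilla, ha]
  · intro h
    exact absurd (Finset.mem_univ _) h

theorem trace_mul_conjTranspose_eq (M : Matrix ι ι ℂ) :
    (M * Mᴴ).trace = (nsq (entries M) : ℂ) := by
  simp only [trace, diag_apply, Matrix.mul_apply, conjTranspose_apply, nsq, entries,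
    Fintype.sum_prod_type, Complex.star_def, Complex.mul_conj']
  push_cast
  rfl

theorem sum_norm_sq_withAncilla {μ : Type} [Fintype μ] (a₀ : κ) (v : μ → ℂ) :
    ∑ x, ‖withAncilla a₀ v x‖ ^ 2 = nsq v := by
  rw [Fintype.sum_prod_type, Finset.sum_eq_single a₀]
  · simp [withAncilla, nsq]
  · intro a _ ha
    simp [withAncilla, ha]
  · intro h
    exact absurd (Finset.mem_univ _) h

theorem IsBlockEncoding.goodProj_mulVec {μ : Type} [Fintype μ] [DecidableEq μ] {a₀ : κ}
    {S : Matrix (κ × μ) (κ × μ) ℂ} {Y : Matrix μ μ ℂ} (hS : IsBlockEncoding a₀ S Y)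
    (v : μ → ℂ) :
    goodProj a₀ *ᵥ (S *ᵥ withAncilla a₀ v) = withAncilla a₀ (Y *ᵥ v) := by
  ext ⟨a, x⟩
  rw [goodProj_mulVec_apply, withAncilla]
  by_cases ha : a = a₀
  · subst ha
    simp only [if_true, mulVec, dotProduct, Fintype.sum_prod_type]
    rw [Finset.sum_eq_single a]
    · simp [withAncilla, hS.2]
    · intro b _ hb
      simp [withAncilla, hb]
    · intro h
      exact absurd (Finset.mem_univ _) h
  · simp [ha]

theorem startVector_one (β : ℝ) (h₀ : H₀.IsHermitian) (a₀ : κ)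
    (S : Matrix (κ × (ι × ι)) (κ × (ι × ι)) ℂ) :
    startVector β h₀ 1 a₀ S = S *ᵥ withAncilla a₀ (purification β h₀) := by
  rw [startVector, one_kronecker_one, one_kronecker_one, Matrix.mul_one]

/-- The algorithm succeeds if the normalized block-encoded vector is close to the purification
of the target and its norm is not too small. -/
theorem IsBlockEncoding.succeeds [Nonempty ι] {c C β ε Q s : ℝ} {a₀ : κ}
    {S : Matrix (κ × (ι × ι)) (κ × (ι × ι)) ℂ} {Y : Matrix (ι × ι) (ι × ι) ℂ}
    (hS : IsBlockEncoding a₀ S Y) (hc : 1 < c)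
    (hC : ∀ (ψ : κ × (ι × ι) → ℂ) (p : ℝ), ∑ x, ‖ψ x‖ ^ 2 = 1 →
      ∑ x, ‖(goodProj a₀ *ᵥ ψ) x‖ ^ 2 = p → 0 < p →
      averageRounds c a₀ ψ ≤ ENNReal.ofReal (C / √p))
    (h₀ : H₀.IsHermitian) (h₁ : H₁.IsHermitian) {u : ι × ι → ℂ} (hs : 0 < s)
    (hY : Y *ᵥ purification β h₀ = (s : ℂ) • u) (hu : nsq u = 1)
    (hclose : √(nsq (u - entries (sqrtGibbs h₁ β))) ≤ ε) (hQ : C / s ≤ Q) :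
    Succeeds c β ε h₀ 1 H₁ a₀ S Q := by
  have hψ : ∑ x, ‖startVector β h₀ 1 a₀ S x‖ ^ 2 = 1 := by
    rw [startVector_one]
    have h1 := nsq_mulVec_of_unitary (mem_unitaryGroup_iff'.1 hS.1)
      (withAncilla a₀ (purification β h₀))
    exact h1.trans ((sum_norm_sq_withAncilla a₀ _).trans (nsq_purification h₀ β))
  have hgood : goodProj a₀ *ᵥ startVector β h₀ 1 a₀ S = withAncilla a₀ ((s : ℂ) • u) := by
    rw [startVector_one, hS.goodProj_mulVec, hY]
  have hp : ∑ x, ‖(goodProj a₀ *ᵥ startVector β h₀ 1 a₀ S) x‖ ^ 2 = s ^ 2 := by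
    rw [hgood, sum_norm_sq_withAncilla, nsq_smul, hu, mul_one, Complex.norm_real,
      Real.norm_eq_abs, sq_abs]
  have hp0 : 0 < s ^ 2 := by positivity
  -- Discarding the second copy of the pure state `u` leaves `M M†`.
  set M : Matrix ι ι ℂ := Matrix.of fun x t => u (x, t) with hM
  have hMu : entries M = u := rfl
  refine ⟨⟨M * Mᴴ, ?_, ?_, ?_⟩, ?_⟩
  · have h := (continuous_reducedState_one.tendsto _).comp
      (tendsto_truncatedOutput hc hψ hp hp0)
    rw [hgood, ← hMu] at h
    have e : entries ((s : ℂ) • M) = (s : ℂ) • entries M := rfl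
    rw [← e, reducedState_one_smul_pureState, conjTranspose_smul, Matrix.smul_mul,
      Matrix.mul_smul, smul_smul, smul_smul, Complex.star_def, Complex.conj_ofReal,
      ← Complex.ofReal_mul, ← Complex.ofReal_mul] at h
    have e2 : 1 / s ^ 2 * (s * s) = 1 := by
      field_simp
    rw [← mul_assoc] at e2
    rw [e2, Complex.ofReal_one, one_smul] at h
    exact h
  · rw [trace_mul_conjTranspose_eq, hMu, hu, Complex.ofReal_one]
  · rw [← sqrtGibbs_mul_conjTranspose h₁ β]
    have h := traceNorm_sub_le (M := M) (N := sqrtGibbs h₁ β) (by rw [hMu, hu])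
      (nsq_entries_sqrtGibbs h₁ β)
    rw [hMu] at h
    linarith
  · refine (hC _ _ hψ hp hp0).trans (ENNReal.ofReal_le_ofReal ?_)
    rwa [Real.sqrt_sq hs.le]

end Prepared

/-! ### Correctness and cost of the algorithm -/

section Correctness

variable {ι : Type} [Fintype ι] [DecidableEq ι] [Nonempty ι]

/-- Each coordinate of the error is the coordinate of the target times the relative error of the
Fourier symbol. Completeness of the overlaps handles the `ε/4` part and the cutoff condition the
rest, giving `ε²/16 + (ε/2 + 1)(ε/6)² ≤ (ε/2)²`. -/
theorem nsq_fourierOp_mulVec_sub_le {H₀ H₁ : Matrix ι ι ℂ} {β ε wl wmax : ℝ} {J : ℕ}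
    (h₀ : H₀.IsHermitian) (h₁ : H₁.IsHermitian) (hβ : 0 ≤ β) (hε : 0 < ε) (hε1 : ε ≤ 1)
    (hcut : IsWorkCutoff β ε h₀ h₁ 1 wl) (hmax : ∀ m n, workValue h₀ h₁ m n ≤ wmax)
    (hJ : IsTruncationOrder β ε wl wmax J) :
    nsq (((√(partitionFn β H₀) / √(partitionFn β H₁) : ℝ) : ℂ) •
        (fourierOp β ε wl wmax J H₀ H₁ *ᵥ purification β h₀) - entries (sqrtGibbs h₁ β)) ≤
      (ε / 2) ^ 2 := by
  have z₀ := partitionFn_pos β h₀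
  have z₁ := partitionFn_pos β h₁
  have hw := hcut.le_of_forall_le hε hε1 hmax
  have hF := workFrame_conjTranspose_mul h₀ h₁
  set c := √(partitionFn β H₀) / √(partitionFn β H₁) with hc
  set g₀ : ι → ℝ := fun m => (√(partitionFn β H₀))⁻¹ * Real.exp (-β * h₀.eigenvalues m / 2)
    with hg₀
  set g₁ : ι → ℝ := fun n => (√(partitionFn β H₁))⁻¹ * Real.exp (-β * h₁.eigenvalues n / 2)
    with hg₁
  have hg : ∀ n m, g₁ n = c * g₀ m * Real.exp (-β * workValue h₀ h₁ m n / 2) := by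
    intro n m
    have hs : √(partitionFn β H₀) ≠ 0 := (Real.sqrt_pos.2 z₀).ne'
    have e : -β * h₁.eigenvalues n / 2 =
        -β * h₀.eigenvalues m / 2 + -β * workValue h₀ h₁ m n / 2 := by
      rw [workValue]
      ring
    simp only [hg₁, hg₀, hc]
    rw [e, Real.exp_add]
    field_simp
  have hcg : ∀ m, 0 ≤ c * g₀ m := fun m => by positivity
  have hg₁sq : ∀ n, g₁ n ^ 2 = Real.exp (-β * h₁.eigenvalues n) / partitionFn β H₁ := by
    intro n
    simp only [hg₁]
    rw [mul_pow, inv_pow, Real.sq_sqrt z₁.le, ← Real.exp_nat_mul, mul_comm, div_eq_mul_inv]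
    congr 2
    push_cast
    ring
  set G := fourierSymbol β ε wl wmax J with hG
  have hvec : ((c : ℝ) : ℂ) • (fourierOp β ε wl wmax J H₀ H₁ *ᵥ purification β h₀) -
      entries (sqrtGibbs h₁ β) = workFrame h₀ h₁ *ᵥ fun x => ((c * g₀ x.2 : ℝ) : ℂ) *
        overlap h₀ h₁ x.1 x.2 * (G (workValue h₀ h₁ x.2 x.1) -
          (Real.exp (-β * workValue h₀ h₁ x.2 x.1 / 2) : ℂ)) := by
    rw [fourierOp_eq h₀ h₁, purification_eq h₀ h₁, entries_sqrtGibbs h₀ h₁, mulVec_mulVec,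
      Matrix.mul_assoc, hF, Matrix.mul_one, ← mulVec_mulVec, ← mulVec_smul, ← mulVec_sub]
    congr 1
    ext ⟨n, m⟩
    simp only [Pi.sub_apply, Pi.smul_apply, mulVec_diagonal, entries, mul_diagonal, diagonal_mul,
      smul_eq_mul]
    have h := hg n m
    simp only [hg₁, hg₀] at h ⊢
    rw [h]
    push_cast
    ring
  have hterm : ∀ n m, ‖((c * g₀ m : ℝ) : ℂ) * overlap h₀ h₁ n m * (G (workValue h₀ h₁ m n) -
      (Real.exp (-β * workValue h₀ h₁ m n / 2) : ℂ))‖ ^ 2 ≤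
      Real.exp (-β * h₁.eigenvalues n) / partitionFn β H₁ *
        (ε ^ 2 / 16 * ‖overlap h₀ h₁ n m‖ ^ 2 +
          (ε / 2 + 1) * if workValue h₀ h₁ m n < wl then ‖overlap h₀ h₁ n m‖ ^ 2 else 0) := by
    intro n m
    have hb := norm_fourierSymbol_sub_exp_le hβ hε hw hJ (hmax m n)
    rw [norm_mul, norm_mul, Complex.norm_real, Real.norm_eq_abs, abs_of_nonneg (hcg m)]
    calc _ ≤ (c * g₀ m * ‖overlap h₀ h₁ n m‖ *
          ((ε / 4 + if workValue h₀ h₁ m n < wl then 1 else 0) *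
            Real.exp (-β * workValue h₀ h₁ m n / 2))) ^ 2 := by
          have := hcg m
          gcongr
      _ = g₁ n ^ 2 * (‖overlap h₀ h₁ n m‖ ^ 2 *
          (ε / 4 + if workValue h₀ h₁ m n < wl then 1 else 0) ^ 2) := by
          rw [hg n m]
          ring
      _ ≤ _ := by
          rw [hg₁sq]
          refine mul_le_mul_of_nonneg_left (le_of_eq ?_) (by positivity)
          split_ifs <;> ring
  rw [hvec, nsq_mulVec_of_unitary hF, nsq, Fintype.sum_prod_type]
  rw [IsWorkCutoff, cutoff_sum_eq] at hcut
  calc _ ≤ ∑ n, ∑ m, Real.exp (-β * h₁.eigenvalues n) / partitionFn β H₁ *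
        (ε ^ 2 / 16 * ‖overlap h₀ h₁ n m‖ ^ 2 +
          (ε / 2 + 1) * if workValue h₀ h₁ m n < wl then ‖overlap h₀ h₁ n m‖ ^ 2 else 0) :=
        Finset.sum_le_sum fun n _ => Finset.sum_le_sum fun m _ => hterm n m
    _ = ε ^ 2 / 16 * ∑ n, Real.exp (-β * h₁.eigenvalues n) / partitionFn β H₁ +
        (ε / 2 + 1) * ∑ n, Real.exp (-β * h₁.eigenvalues n) / partitionFn β H₁ *
          ∑ m, if workValue h₀ h₁ m n < wl then ‖overlap h₀ h₁ n m‖ ^ 2 else 0 := by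
        rw [Finset.mul_sum, Finset.mul_sum, ← Finset.sum_add_distrib]
        refine Finset.sum_congr rfl fun n _ => ?_
        rw [← Finset.mul_sum, Finset.sum_add_distrib, ← Finset.mul_sum, ← Finset.mul_sum,
          sum_norm_sq_row (overlap_mul_conjTranspose h₀ h₁)]
        ring
    _ ≤ ε ^ 2 / 16 * 1 + (ε / 2 + 1) * (ε / 6) ^ 2 := by
        rw [sum_boltzmann_weights]
        gcongr
    _ ≤ _ := by nlinarith [sq_nonneg ε, mul_nonneg (sq_nonneg ε) (sub_nonneg.2 hε1)]

/-- A vector close to a unit vector can be normalized. -/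
theorem sqrt_nsq_normalize_sub_le {n : Type} [Fintype n] {u v : n → ℂ} {ε : ℝ} (hv : nsq v = 1)
    (hε : 0 ≤ ε) (hε1 : ε ≤ 1) (h : nsq (u - v) ≤ (ε / 2) ^ 2) :
    1 / 2 ≤ √(nsq u) ∧ √(nsq ((((√(nsq u))⁻¹ : ℝ) : ℂ) • u - v)) ≤ ε := by
  have h1 : √(nsq (u - v)) ≤ ε / 2 := Real.sqrt_le_iff.2 ⟨by positivity, h⟩
  have hv1 : √(nsq v) = 1 := by rw [hv, Real.sqrt_one]
  rw [sqrt_nsq] at h1 hv1 ⊢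
  rw [sqrt_nsq]
  rw [WithLp.toLp_sub] at h1 ⊢
  rw [WithLp.toLp_smul]
  set x := WithLp.toLp 2 u
  set y := WithLp.toLp 2 v
  have h2 : |‖x‖ - 1| ≤ ε / 2 := by
    rw [← hv1]
    exact (abs_norm_sub_norm_le x y).trans h1
  have h3 := abs_le.1 h2
  have hx : 1 / 2 ≤ ‖x‖ := by linarith
  refine ⟨hx, ?_⟩
  have hx0 : ‖x‖ ≠ 0 := by linarith
  -- Normalizing moves `x` by `|‖x‖ - 1| ≤ ε/2`, and the distance from `x` to `y` is another `ε/2`.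
  have e : (((‖x‖)⁻¹ : ℝ) : ℂ) • x - y = ((((‖x‖)⁻¹ : ℝ) : ℂ) - 1) • x + (x - y) := by
    rw [sub_smul, one_smul]
    abel
  rw [e]
  refine (norm_add_le _ _).trans ?_
  have e2 : ‖((((‖x‖)⁻¹ : ℝ) : ℂ) - 1) • x‖ = |‖x‖ - 1| := by
    rw [norm_smul, ← Complex.ofReal_one, ← Complex.ofReal_sub, Complex.norm_real,
      Real.norm_eq_abs]
    conv_lhs => rw [← abs_norm x, ← abs_mul, sub_mul]
    rw [abs_norm, inv_mul_cancel₀ hx0, one_mul, abs_sub_comm]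
  rw [e2]
  linarith

/-- The triangle inequality bounds the eigenvalues of `X` by `α`, so that `X/α` is a diagonalizable
contraction. -/
theorem exists_isBlockEncoding_fourierOp {H₀ H₁ : Matrix ι ι ℂ} (h₀ : H₀.IsHermitian)
    (h₁ : H₁.IsHermitian) (β ε wl wmax : ℝ) (J : ℕ) :
    ∃ S : Matrix (Bool × (ι × ι)) (Bool × (ι × ι)) ℂ, IsBlockEncoding true S
      (((coeffNorm β ε wl wmax J : ℝ) : ℂ)⁻¹ • fourierOp β ε wl wmax J H₀ H₁) := by
  obtain ⟨S, hS⟩ := exists_isBlockEncoding (workFrame_conjTranspose_mul h₀ h₁)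
    (fun x => ((coeffNorm β ε wl wmax J : ℝ) : ℂ)⁻¹ *
      fourierSymbol β ε wl wmax J (workValue h₀ h₁ x.2 x.1)) fun x => by
    have h1 := norm_fourierSymbol_le β ε wl wmax J (workValue h₀ h₁ x.2 x.1)
    have h0 : 0 ≤ coeffNorm β ε wl wmax J := (norm_nonneg _).trans h1
    rw [norm_mul, norm_inv, Complex.norm_real, Real.norm_eq_abs, abs_of_nonneg h0, mul_comm,
      ← div_eq_mul_inv]
    exact div_le_one_of_le₀ h1 h0
  refine ⟨S, ?_⟩
  rw [fourierOp_eq h₀ h₁, ← Matrix.smul_mul, ← Matrix.mul_smul, ← diagonal_smul]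
  exact hS

/-- With `N ≥ 1/2` the norm of the rescaled vector, the success amplitude is `√(𝒵₁/𝒵₀) N/(rα)`. The
constant `16 e⁴` collects `r/N ≤ 4` and `α ≤ 4 e⁴ e^{√(ln(1/ε))} e^{-β wl/2}`, and a larger cutoff
`wl ≥ w` only lowers the cost. -/
theorem preparesWith_of_isWorkCutoff {c C β ε w Q : ℝ} {H₀ V : Matrix ι ι ℂ} (hc : 1 < c)
    (hC0 : 0 < C)
    (hC : ∀ {κ μ : Type} [Fintype κ] [DecidableEq κ] [Fintype μ] [DecidableEq μ]
      (a₀ : κ) (ψ : κ × μ → ℂ) (p : ℝ), ∑ x, ‖ψ x‖ ^ 2 = 1 →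
      ∑ x, ‖(goodProj a₀ *ᵥ ψ) x‖ ^ 2 = p → 0 < p →
      averageRounds c a₀ ψ ≤ ENNReal.ofReal (C / √p))
    (h₀ : H₀.IsHermitian) (hV : V.IsHermitian) (hβ : 0 ≤ β) (hε : 0 < ε) (hε1 : ε ≤ 1)
    (hcut : IsWorkCutoff β ε h₀ (h₀.add hV) 1 w)
    (hQ : 16 * Real.exp 4 * C * Real.exp √(Real.log (1 / ε)) *
      Real.exp (-β * w / 2 + β * ‖V‖ / 2) ≤ Q) :
    PreparesWith c β ε h₀ (h₀.add hV) 1 w Q := by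
  set h₁ := h₀.add hV with hh₁
  refine ⟨hcut, fun wl hwl hcutl wmax hmax J hJ => ⟨?_, ?_⟩⟩
  · obtain ⟨S, hS⟩ := exists_isBlockEncoding_fourierOp h₀ h₁ β ε wl wmax J
    exact ⟨Bool, inferInstance, inferInstance, true, S, hS⟩
  intro r hr1 hr2 κ _ _ a₀ S hS
  have z₀ := partitionFn_pos β h₀
  have z₁ := partitionFn_pos β h₁
  have hw := hcutl.le_of_forall_le hε hε1 hmax
  have hsub := nsq_fourierOp_mulVec_sub_le h₀ h₁ hβ hε hε1 hcutl hmax hJ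
  set α := coeffNorm β ε wl wmax J with hα
  set s₀ := √(partitionFn β H₀) with hs₀
  set s₁ := √(partitionFn β (H₀ + V)) with hs₁
  have hs₀pos : 0 < s₀ := Real.sqrt_pos.2 z₀
  have hs₁pos : 0 < s₁ := Real.sqrt_pos.2 z₁
  set v := ((s₀ / s₁ : ℝ) : ℂ) • (fourierOp β ε wl wmax J H₀ (H₀ + V) *ᵥ purification β h₀)
    with hv
  obtain ⟨hhalf, hclose⟩ :=
    sqrt_nsq_normalize_sub_le (nsq_entries_sqrtGibbs h₁ β) hε.le hε1 hsub
  have hα0 : 0 ≤ α := Finset.sum_nonneg fun j _ => norm_nonneg _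
  -- If `α` vanished, so would `X`, and the prepared vector could not be close to a unit vector.
  have hαpos : 0 < α := by
    refine hα0.lt_of_ne' fun h => ?_
    have hG : ∀ w, fourierSymbol β ε wl wmax J w = 0 := fun w =>
      norm_le_zero_iff.1 ((norm_fourierSymbol_le β ε wl wmax J w).trans h.le)
    have hX : fourierOp β ε wl wmax J H₀ (H₀ + V) = 0 := by
      rw [fourierOp_eq h₀ h₁]
      simp only [hG]
      rw [diagonal_zero, Matrix.mul_zero, Matrix.zero_mul]
    rw [hv, hX, zero_mulVec, smul_zero] at hhalf
    have h0 : nsq (0 : ι × ι → ℂ) = 0 := by simp [nsq]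
    rw [h0, Real.sqrt_zero] at hhalf
    linarith
  set N := √(nsq v) with hN
  have hNpos : 0 < N := by linarith
  have hrα : 0 < r * α := mul_pos (by linarith) hαpos
  have hspos : 0 < s₁ / s₀ * N / (r * α) := by positivity
  refine hS.succeeds hc (hC a₀) h₀ h₁ hspos (u := ((N⁻¹ : ℝ) : ℂ) • v) ?_ ?_ hclose ?_
  · rw [smul_mulVec, hv, smul_smul, smul_smul]
    congr 1
    rw [← Complex.ofReal_mul, ← Complex.ofReal_mul, ← Complex.ofReal_inv]
    congr 1
    field_simp
  · rw [nsq_smul, Complex.norm_real, Real.norm_eq_abs, sq_abs, inv_pow, hN,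
      Real.sq_sqrt (nsq_nonneg v), inv_mul_cancel₀ (Real.sqrt_pos.1 hNpos).ne']
  · refine le_trans ?_ hQ
    have hZ : s₀ / s₁ ≤ Real.exp (β * ‖V‖ / 2) := by
      rw [div_le_iff₀ hs₁pos, hs₀, hs₁]
      refine Real.sqrt_le_iff.2 ⟨by positivity, ?_⟩
      rw [mul_pow, Real.sq_sqrt z₁.le, ← Real.exp_nat_mul]
      convert partitionFn_le h₀ hV hβ using 3
      push_cast
      ring
    have hαle := coeffNorm_le (ε := ε) hβ hw J
    have hD : Real.exp (fourierWidth ε) ≤ Real.exp 4 * Real.exp √(Real.log (1 / ε)) := by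
      rw [← Real.exp_add]
      exact Real.exp_le_exp.2 (fourierWidth_le hε hε1)
    have hwle : Real.exp (-β * wl / 2) ≤ Real.exp (-β * w / 2) := by
      apply Real.exp_le_exp.2
      have := mul_le_mul_of_nonneg_left hwl hβ
      linarith
    have hrN : r / N ≤ 4 := by
      rw [div_le_iff₀ hNpos]
      linarith
    calc C / (s₁ / s₀ * N / (r * α)) = C * (r / N) * α * (s₀ / s₁) := by field_simp
      _ ≤ C * 4 * (Real.exp (-β * w / 2) * (4 * (Real.exp 4 * Real.exp √(Real.log (1 / ε))))) *
          Real.exp (β * ‖V‖ / 2) := by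
          have hα' : α ≤ Real.exp (-β * w / 2) *
              (4 * (Real.exp 4 * Real.exp √(Real.log (1 / ε)))) := hαle.trans (by gcongr)
          gcongr
      _ = _ := by
          rw [Real.exp_add]
          ring

end Correctness

end ThermalPrep

end

/-! ### The three classes of Hamiltonians -/

open Classical in
theorem corollary1 (c : ℝ) (hc₁ : 1 < c) (hc₂ : c < 2) :
    ∃ C : ℝ, 0 < C ∧
      -- general Hamiltonians
      (∀ (ι : Type) [Fintype ι] [DecidableEq ι] [Nonempty ι] (H₀ V : Matrix ι ι ℂ)
          (h₀ : H₀.IsHermitian) (hV : V.IsHermitian) (β ε : ℝ), 0 ≤ β → 0 < ε → ε ≤ 1 →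
        ThermalPrep.PreparesWith c β ε h₀ (h₀.add hV) 1 (-(6 * ‖V‖ / ε))
          (C * Real.exp √(Real.log (1 / ε)) * Real.exp ((3 / ε + 1 / 2) * β * ‖V‖))) ∧
      -- commuting Hamiltonians
      (∀ (ι : Type) [Fintype ι] [DecidableEq ι] [Nonempty ι] (H₀ V : Matrix ι ι ℂ)
          (h₀ : H₀.IsHermitian) (hV : V.IsHermitian) (β ε : ℝ), 0 ≤ β → 0 < ε → ε ≤ 1 →
        Commute H₀ (H₀ + V) →
        ThermalPrep.PreparesWith c β ε h₀ (h₀.add hV) 1 (-‖V‖)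
          (C * Real.exp √(Real.log (1 / ε)) * Real.exp (β * ‖V‖))) ∧
      -- local Hamiltonians
      (∀ (𝔫 d : ℕ) (_ : 0 < d) (Λ : Finset (Finset (Fin 𝔫))) (k g M : ℕ) (h v ξ : ℝ)
          (t₀ tV : Finset (Fin 𝔫) → Matrix (Fin 𝔫 → Fin d) (Fin 𝔫 → Fin d) ℂ)
          (H₀ V : Matrix (Fin 𝔫 → Fin d) (Fin 𝔫 → Fin d) ℂ)
          (h₀ : H₀.IsHermitian) (hV : V.IsHermitian) (β ε : ℝ), 0 ≤ β → 0 < ε → ε ≤ 1 →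
        0 ≤ h → 0 ≤ v → 0 ≤ ξ →
        H₀ = ∑ X ∈ Λ, t₀ X → V = ∑ X ∈ Λ, tV X →
        ThermalPrep.IsLocalHamiltonian Λ k g h t₀ →
        ThermalPrep.IsLocalHamiltonian Λ k g v tV →
        (Λ.filter fun X => tV X ≠ 0).card ≤ M →
        M * v ≤ ξ * ‖V‖ →
        ThermalPrep.PreparesWith c β ε h₀ (h₀.add hV) 1
          (-(2 * M * v) - 2 * h * g * k * Real.log (6 / ε))
          (C * Real.exp √(Real.log (1 / ε)) *
            ((6 / ε) ^ (β * h * g * k) * Real.exp ((ξ + 1 / 2) * β * ‖V‖)))) := by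
  obtain ⟨C, hC0, hC⟩ := ThermalPrep.exists_averageRounds_le hc₁ hc₂
  refine ⟨16 * Real.exp 4 * C, by positivity, ?_, ?_, ?_⟩
  · intro ι _ _ _ H₀ V h₀ hV β ε hβ hε hε1
    refine ThermalPrep.preparesWith_of_isWorkCutoff hc₁ hC0 hC h₀ hV hβ hε hε1
      (ThermalPrep.isWorkCutoff_general h₀ hV β hε) (le_of_eq ?_)
    congr 2
    field_simp
    ring
  · intro ι _ _ _ H₀ V h₀ hV β ε hβ hε hε1 hcomm
    refine ThermalPrep.preparesWith_of_isWorkCutoff hc₁ hC0 hC h₀ hV hβ hε hε1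
      (ThermalPrep.isWorkCutoff_commuting h₀ hV β ε hcomm) (le_of_eq ?_)
    congr 2
    ring
  · intro 𝔫 d hd Λ k g M h v ξ t₀ tV H₀ V h₀ hV β ε hβ hε hε1 hh hv hξ hH₀ hVs hl₀ hlV hM hMv
    have : Nonempty (Fin d) := ⟨⟨0, hd⟩⟩
    have hcut := ThermalPrep.isWorkCutoff_local hd β h₀ hV hε hh hv hH₀ hVs hl₀ hlV
      (by convert hM)
    refine ThermalPrep.preparesWith_of_isWorkCutoff hc₁ hC0 hC h₀ hV hβ hε hε1 hcut ?_
    -- Half of `-β` times the cutoff is `β M v + β h g k ln(6/ε)`. The first summand is at most `ξ β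
    -- ‖V‖`, and the second is the exponent of the power of `6/ε`.
    rw [Real.rpow_def_of_pos (by positivity), ← Real.exp_add]
    refine mul_le_mul_of_nonneg_left (Real.exp_le_exp.2 ?_) (by positivity)
    have := mul_le_mul_of_nonneg_left hMv hβ
    linarith
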